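/- **Proposition (Lorentz–Strichartz estimates).** For $1\le p<\infty$ and $0<r\le\infty$ let $\|h\|_{L^{p,r}} = p^{1/r}\big\|\lambda\,|\{|h|>\lambda\}|^{1/p}\big\|_{L^r((0,\infty),\,d\lambda/\lambda)}$ be the Lorentz quasinorm, and for an interval $J\subset\mathbb R$ let $\|u\|_{L_t^{p,\theta}L_x^{q,\phi}(J)}$ be the $L^{p,\theta}(J)$ quasinorm of $t\mapsto\|u(t)\|_{L^{q,\phi}(\mathbb R^d)}$. Let $e^{it\Delta}$ be the free Schrödinger propagator on tempered distributions on $\mathbb R^d$, i.e. the Fourier multiplier with symbol $e^{-it|\xi|^2}$ (in angular frequency $\xi$). Let $d\ge 3$ and let $2<p,q<\infty$ satisfy $\frac2p+\frac dq=\frac d2$. Write $p',q'$ for the Hölder conjugates of $p,q$. 1. There is a constant $C=C(d,p,q)$ such that for every interval $J\subset\mathbb R$ and every $f\in L^2(\mathbb R^d)$, the function $e^{it\Delta}f$ (which has a jointly measurable version on $J\times\mathbb R^d$) satisfies $$\|e^{it\Delta}f\|_{L_t^{p,2}L_x^{q,2}(J)}\le C\,\|f\|_{L^2(\mathbb R^d)}.$$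 2. For all $0<\theta\le\infty$ and $1\le\phi\le\infty$ there is a constant $C=C(d,p,q,\theta,\phi)$ such that for every interval $J\subset\mathbb R$, every family of intervals $I(t)\subset J$ $(t\in J)$, and every measurable $F:J\times\mathbb R^d\to\mathbb C$ with $\|F\|_{L_t^{p',\theta}L_x^{q',\phi}(J)}<\infty$: for almost every $t\in J$ the integral $\int_{I(t)}e^{i(t-s)\Delta}F(s)\,ds$ converges absolutely against every Schwartz function and is given by a function on $\mathbb R^d$, and $$\Big\|\int_{I(t)}e^{i(t-s)\Delta}F(s)\,ds\Big\|_{L_t^{p,\theta}L_x^{q,\phi}(J)}\le C\,\|F\|_{L_t^{p',\theta}L_x^{q',\phi}(J)}.$$ If $\{(t,s): t\in J,\ s\in I(t)\}$ is a Borel set, the left-hand function has a jointly measurable version; no measurability of $t\mapsto I(t)$ is needed for the estimate itself (with distribution functions taken in outer measure). -/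

import Mathlib

open MeasureTheory Set
open scoped ENNReal NNReal SchwartzMap

noncomputable section

/-- The measure `dλ / λ` on `(0, ∞)`. -/
def dilationMeasure : Measure ℝ :=
  (volume.restrict (Ioi (0 : ℝ))).withDensity fun l => ENNReal.ofReal (1 / l)

/-- The Lorentz quasinorm
`‖h‖_{L^{p,r}(μ)} = p^{1/r} ‖ λ ↦ λ μ{h > λ}^{1/p} ‖_{L^r((0,∞), dλ/λ)}` of a `[0,∞]`-valued
function `h`, for `1 ≤ p < ∞` and `0 < r ≤ ∞` (with `1/∞ = 0`). -/
def lorentzNorm {α : Type*} [MeasurableSpace α] (p : ℝ) (r : ℝ≥0∞) (μ : Measure α)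
    (h : α → ℝ≥0∞) : ℝ≥0∞ :=
  ENNReal.ofReal p ^ (r⁻¹).toReal *
    eLpNorm (fun l : ℝ => ENNReal.ofReal l * μ {x | ENNReal.ofReal l < h x} ^ (1 / p))
      r dilationMeasure

/-- The mixed norm `‖u‖_{L_t^{p,θ} L_x^{q,φ}(J × ℝ^d)}`: the `L^{p,θ}(J)` quasinorm of
`t ↦ ‖u(t)‖_{L^{q,φ}(ℝ^d)}`. -/
def mixedLorentzNorm {d : ℕ} (p : ℝ) (θ : ℝ≥0∞) (q : ℝ) (φ : ℝ≥0∞) (J : Set ℝ)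
    (u : ℝ → EuclideanSpace ℝ (Fin d) → ℂ) : ℝ≥0∞ :=
  lorentzNorm p θ (volume.restrict J) fun t => lorentzNorm q φ volume fun x => ‖u t x‖ₑ

/-- The symbol of `e^{iτΔ}`. With the Fourier transform `∫ e^{-2πi⟨x,ξ⟩} f(x) dx`, the Laplacian
has symbol `-4π²|ξ|²`. -/
def schrodingerSymbol {d : ℕ} (τ : ℝ) (ξ : EuclideanSpace ℝ (Fin d)) : ℂ :=
  Complex.exp (Complex.I * ((-(4 * Real.pi ^ 2 * τ * ‖ξ‖ ^ 2) : ℝ) : ℂ))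

/-- The symbol is an admissible Fourier multiplier for tempered distributions. -/
theorem schrodingerSymbol_hasTemperateGrowth {d : ℕ} (τ : ℝ) :
    (schrodingerSymbol (d := d) τ).HasTemperateGrowth := by
  have hexp : (fun y : ℝ => Complex.exp (Complex.I * (y : ℂ))).HasTemperateGrowth := by
    refine ⟨(contDiff_const.mul Complex.ofRealCLM.contDiff).cexp, fun n => ⟨0, 1, fun x => ?_⟩⟩
    have key : ∀ n : ℕ, iteratedDeriv n (fun y : ℝ => Complex.exp (Complex.I * (y : ℂ))) =
        fun y : ℝ => Complex.I ^ n * Complex.exp (Complex.I * (y : ℂ)) := by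
      intro n
      induction n with
      | zero => simp
      | succ n ih =>
        rw [iteratedDeriv_succ, ih]
        funext y
        have h1 : HasDerivAt (fun y : ℝ => Complex.I * (y : ℂ)) (Complex.I * 1) y :=
          (Complex.ofRealCLM.hasDerivAt (x := y)).const_mul Complex.I
        rw [(h1.cexp.const_mul (Complex.I ^ n)).deriv]
        ring
    rw [norm_iteratedFDeriv_eq_norm_iteratedDeriv, key]
    simp [mul_comm Complex.I, Complex.norm_exp_ofReal_mul_I]
  have hsq : (fun ξ : EuclideanSpace ℝ (Fin d) =>
      -(4 * Real.pi ^ 2 * τ * ‖ξ‖ ^ 2)).HasTemperateGrowth := by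
    fun_prop
  exact hexp.comp hsq

/-- The free Schrödinger propagator `e^{iτΔ}` on tempered distributions. -/
def freeFlow {d : ℕ} (τ : ℝ) :
    𝓢'(EuclideanSpace ℝ (Fin d), ℂ) →L[ℂ] 𝓢'(EuclideanSpace ℝ (Fin d), ℂ) :=
  TemperedDistribution.fourierMultiplierCLM ℂ (schrodingerSymbol τ)

/-- The tempered distribution `T` is the function `f`. -/
def IsFunction {d : ℕ} (T : 𝓢'(EuclideanSpace ℝ (Fin d), ℂ))
    (f : EuclideanSpace ℝ (Fin d) → ℂ) : Prop :=
  ∀ g : 𝓢(EuclideanSpace ℝ (Fin d), ℂ),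
    Integrable (fun x => g x * f x) ∧ T g = ∫ x, g x * f x

open Classical in
/-- A function `f`, seen as a tempered distribution (`0` if `f` does not define one). -/
def toDistribution {d : ℕ} (f : EuclideanSpace ℝ (Fin d) → ℂ) :
    𝓢'(EuclideanSpace ℝ (Fin d), ℂ) :=
  if h : ∃ T, IsFunction T f then h.choose else 0

/-- The function `v` on `ℝ^d` is the integral `∫_A e^{i(t-s)Δ} F(s) ds`: almost every `F(s)` is a
tempered distribution, and the integral of the distributions `e^{i(t-s)Δ} F(s)` over `s ∈ A`
converges absolutely against every Schwartz function and equals `v`. Such a `v` is unique up to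
null sets. -/
structure IsDuhamelIntegral {d : ℕ} (A : Set ℝ) (t : ℝ)
    (F : ℝ → EuclideanSpace ℝ (Fin d) → ℂ) (v : EuclideanSpace ℝ (Fin d) → ℂ) : Prop where
  tempered : ∀ᵐ s ∂(volume.restrict A), ∃ T, IsFunction T (F s)
  integrable : ∀ g : 𝓢(EuclideanSpace ℝ (Fin d), ℂ),
    IntegrableOn (fun s => freeFlow (t - s) (toDistribution (F s)) g) A
  integrable_mul : ∀ g : 𝓢(EuclideanSpace ℝ (Fin d), ℂ), Integrable fun x => g x * v x
  integral_eq : ∀ g : 𝓢(EuclideanSpace ℝ (Fin d), ℂ),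
    ∫ x, g x * v x = ∫ s in A, freeFlow (t - s) (toDistribution (F s)) g

end

/-! ### The scale-invariant measure `dλ/λ` and decreasing rearrangements -/

noncomputable section

/-! Two facts about the propagator carry everything: it is unitary on L², and it maps L¹ to L^∞ with
norm at most (4π|τ|)^(-d/2). Interpolating between them gives L^{q',φ} → L^{q,φ} with norm at most
C|τ|^(-2/p), since admissibility says (d/2)(1 - 2/q) = 2/p. As 0 < 2/p < 1, the
Hardy–Littlewood–Sobolev inequality bounds the time integral with kernel |t-s|^(-2/p) from L^{p',θ}
to L^{p,θ}. Minkowski's inequality, where φ ≥ 1 enters, puts the spatial norm inside the time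
integral, and the retarded estimate follows. Absolute values are taken inside the s-integral, so
restricting s to I(t) ⊆ J costs nothing.

The interpolation is done by hand. The layer-cake formula splits the input into its level sets, each
level set obeys two endpoint bounds, and the minimum of the two is integrated over the levels. The
resulting operator `calderonSum` is dominated by a weighted sum of dilates of the rearrangement.
Since dλ/λ is dilation invariant, `exists_eLpNorm_calderonSum_le` bounds it for all 0 < r ≤ ∞. This
is used in time for `exists_lorentzNorm_rieszPotential_le` and in space for
`exists_eLpNorm_layerBound_le`.

The Duhamel integral is known only through its pairings with Schwartz functions.
`WeightedMemL2.exists_schwartz_test` supplies test functions that recover the mass of a function on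
a bounded set while keeping L¹ and L² norms comparable to those of the indicator. Mass on sets
controls the rearrangement, which gives `lorentzNorm_le_eLpNorm_duhamelBound`.

The homogeneous estimate is a TT* argument. For F in L¹_t L²_x, the pairing of F with the flow of f
equals the pairing of f with some y in L². Then ‖y‖² is the pairing of F with the flow of the
conjugate of y, and that flow is controlled by the same Duhamel majorant over all of J with second
exponents 2. Hölder's inequality in Lorentz spaces closes the bound ‖y‖ ≤ C‖F‖. The explicit dual
function `lorentzDual` then turns it into a bound for the norm of the flow. -/

theorem lintegral_dilationMeasure_exp (f : ℝ → ℝ≥0∞) :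
    ∫⁻ l, f l ∂dilationMeasure = ∫⁻ x : ℝ, f (Real.exp x) := by
  have h := lintegral_image_eq_lintegral_abs_deriv_mul (s := univ) MeasurableSet.univ
    (fun x _ => (Real.hasDerivAt_exp x).hasDerivWithinAt) Real.exp_injective.injOn
    (fun l => ENNReal.ofReal (1 / l) * f l)
  rw [image_univ, Real.range_exp, setLIntegral_univ] at h
  rw [dilationMeasure, lintegral_withDensity_eq_lintegral_mul_non_measurable]
  · simp only [Pi.mul_apply]
    rw [h]
    refine lintegral_congr fun x => ?_
    rw [← mul_assoc, ← ENNReal.ofReal_mul (abs_nonneg _), abs_of_pos (Real.exp_pos x),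
      mul_one_div_cancel (Real.exp_pos x).ne', ENNReal.ofReal_one, one_mul]
  · fun_prop
  · exact Filter.Eventually.of_forall fun _ => ENNReal.ofReal_lt_top

theorem dilationMeasure_eq_map_exp : dilationMeasure = (volume : Measure ℝ).map Real.exp := by
  ext s hs
  rw [← lintegral_indicator_one hs, lintegral_dilationMeasure_exp,
    Measure.map_apply Real.measurable_exp hs, ← lintegral_indicator_one (Real.measurable_exp hs)]
  rfl

theorem lintegral_dilationMeasure (f : ℝ → ℝ≥0∞) :
    ∫⁻ l, f l ∂dilationMeasure = ∫⁻ l in Ioi (0 : ℝ), ENNReal.ofReal (1 / l) * f l := by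
  rw [dilationMeasure, lintegral_withDensity_eq_lintegral_mul_non_measurable]
  · rfl
  · fun_prop
  · exact Filter.Eventually.of_forall fun _ => ENNReal.ofReal_lt_top

theorem measurableEmbedding_exp : MeasurableEmbedding Real.exp :=
  Real.isOpenEmbedding_exp.measurableEmbedding

instance : SigmaFinite dilationMeasure := by
  rw [dilationMeasure]
  infer_instance

theorem ae_dilationMeasure_pos : ∀ᵐ l ∂dilationMeasure, 0 < l := by
  rw [dilationMeasure_eq_map_exp, measurableEmbedding_exp.ae_map_iff]
  exact Filter.Eventually.of_forall Real.exp_pos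

/-- In the variable log λ a dilation is a translation. -/
theorem measurePreserving_mul_dilationMeasure {c : ℝ} (hc : 0 < c) :
    MeasurePreserving (fun x => c * x) dilationMeasure dilationMeasure := by
  refine ⟨by fun_prop, ?_⟩
  conv_lhs => rw [dilationMeasure_eq_map_exp]
  rw [Measure.map_map (by fun_prop) Real.measurable_exp]
  have : (fun x => c * x) ∘ Real.exp = Real.exp ∘ fun x => Real.log c + x := by
    funext x
    simp [Real.exp_add, Real.exp_log hc]
  rw [this, ← Measure.map_map Real.measurable_exp (by fun_prop), map_add_left_eq_self,
    dilationMeasure_eq_map_exp]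

/-- In the variable log λ inversion is the reflection x ↦ -x. -/
theorem measurePreserving_inv_dilationMeasure :
    MeasurePreserving (fun x : ℝ => x⁻¹) dilationMeasure dilationMeasure := by
  refine ⟨by fun_prop, ?_⟩
  conv_lhs => rw [dilationMeasure_eq_map_exp]
  rw [Measure.map_map (by fun_prop) Real.measurable_exp]
  have : (fun x : ℝ => x⁻¹) ∘ Real.exp = Real.exp ∘ fun x => -x := by
    funext x
    simp [Real.exp_neg]
  rw [this, ← Measure.map_map Real.measurable_exp (by fun_prop), Measure.map_neg_eq_self,
    dilationMeasure_eq_map_exp]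

/-- The decreasing rearrangement of a `[0,∞]`-valued function. -/
def rearr {α : Type*} [MeasurableSpace α] (μ : Measure α) (h : α → ℝ≥0∞) (b : ℝ≥0∞) : ℝ≥0∞ :=
  sInf {l | μ {x | l < h x} ≤ b}

section Rearrangement

variable {α : Type*} [MeasurableSpace α] {μ : Measure α} {h : α → ℝ≥0∞}

/-- The infimum is attained: if u n decreases to it, the sets {h > u n} increase to {h > inf}, and
continuity from below applies. That continuity holds for outer measures too, so h need not be
measurable. -/
theorem measure_lt_rearr_le (b : ℝ≥0∞) : μ {x | rearr μ h b < h x} ≤ b := by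
  have hne : {l | μ {x | l < h x} ≤ b}.Nonempty := ⟨∞, by simp⟩
  obtain ⟨u, hanti, -, hu, hmem⟩ := (isGLB_sInf _).exists_seq_antitone_tendsto hne
  have hset : {x | rearr μ h b < h x} = ⋃ n, {x | u n < h x} := by
    ext x
    simp only [Set.mem_ofPred_eq, mem_iUnion]
    refine ⟨fun hx => (hu.eventually_lt_const hx).exists, fun ⟨n, hn⟩ =>
      lt_of_le_of_lt (sInf_le (hmem n)) hn⟩
  rw [hset, Monotone.measure_iUnion]
  · exact iSup_le hmem
  · exact fun m n hmn x hx => lt_of_le_of_lt (hanti hmn) hx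

/-- Rearrangement and distribution function have the same region under their graphs, up to swapping
the axes. Every later exchange of level and measure is this equivalence. -/
theorem lt_rearr_iff {l b : ℝ≥0∞} : l < rearr μ h b ↔ b < μ {x | l < h x} := by
  constructor
  · intro hl
    by_contra hb
    exact absurd (sInf_le (not_lt.1 hb) : rearr μ h b ≤ l) (not_le.2 hl)
  · intro hb
    by_contra hl
    refine absurd (measure_lt_rearr_le (μ := μ) (h := h) b) (not_le.2 (hb.trans_le ?_))
    exact measure_mono fun x hx => lt_of_le_of_lt (not_lt.1 hl) hx

theorem antitone_rearr : Antitone (rearr μ h) := fun _ _ hab =>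
  sInf_le_sInf fun _ hl => le_trans hl hab

theorem antitone_measure_lt : Antitone fun l : ℝ≥0∞ => μ {x | l < h x} :=
  fun _ _ hab => measure_mono fun _ hx => lt_of_le_of_lt hab hx

theorem measurable_rearr : Measurable (rearr μ h) := antitone_rearr.measurable

theorem measurable_measure_lt : Measurable fun l : ℝ≥0∞ => μ {x | l < h x} :=
  antitone_measure_lt.measurable

end Rearrangement

theorem lintegral_Ioo_rpow {r : ℝ} (hr : 0 < r) {c : ℝ} (hc : 0 ≤ c) :
    ENNReal.ofReal r * ∫⁻ l in Ioo 0 c, ENNReal.ofReal (l ^ (r - 1)) = ENNReal.ofReal (c ^ r) := by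
  have hi : IntervalIntegrable (fun l : ℝ => l ^ (r - 1)) volume 0 c :=
    intervalIntegral.intervalIntegrable_rpow' (by linarith)
  have h1 : IntegrableOn (fun l : ℝ => l ^ (r - 1)) (Ioo 0 c) :=
    ((intervalIntegrable_iff_integrableOn_Ioc_of_le hc).1 hi).mono_set Ioo_subset_Ioc_self
  rw [← ofReal_integral_eq_lintegral_ofReal h1, ← ENNReal.ofReal_mul hr.le,
    ← integral_Ioc_eq_integral_Ioo, ← intervalIntegral.integral_of_le hc,
    integral_rpow (Or.inl (by linarith))]
  · congr 1
    rw [sub_add_cancel, Real.zero_rpow hr.ne']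
    field_simp
    ring
  · exact (ae_restrict_iff' measurableSet_Ioo).2 (Filter.Eventually.of_forall fun l hl =>
      Real.rpow_nonneg hl.1.le _)

/-- Writing a power as an integral of an indicator against dλ/λ lets Tonelli's theorem act on powers
of distribution functions. The value c = ∞ is included. -/
theorem lintegral_dilationMeasure_rpow {r : ℝ} (hr : 0 < r) (c : ℝ≥0∞) :
    ENNReal.ofReal r * ∫⁻ l, {l | ENNReal.ofReal l < c}.indicator (fun l => ENNReal.ofReal l ^ r) l
      ∂dilationMeasure = c ^ r := by
  have key : ∀ c : ℝ, 0 ≤ c → ENNReal.ofReal r * ∫⁻ l, {l | ENNReal.ofReal l <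
      ENNReal.ofReal c}.indicator (fun l => ENNReal.ofReal l ^ r) l ∂dilationMeasure =
      ENNReal.ofReal c ^ r := by
    intro c hc
    rw [ENNReal.ofReal_rpow_of_nonneg hc hr.le, ← lintegral_Ioo_rpow hr hc,
      lintegral_dilationMeasure, ← lintegral_indicator measurableSet_Ioi,
      ← lintegral_indicator measurableSet_Ioo]
    congr 1
    refine lintegral_congr fun l => ?_
    by_cases h0 : 0 < l
    · by_cases h1 : l < c
      · have h2 : ENNReal.ofReal l < ENNReal.ofReal c :=
          (ENNReal.ofReal_lt_ofReal_iff (h0.trans h1)).2 h1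
        rw [indicator_of_mem (mem_Ioi.2 h0), indicator_of_mem (by exact h2),
          indicator_of_mem (mem_Ioo.2 ⟨h0, h1⟩), ENNReal.ofReal_rpow_of_pos h0,
          ← ENNReal.ofReal_mul (by positivity), Real.rpow_sub_one h0.ne']
        congr 1
        ring
      · have h2 : ¬ ENNReal.ofReal l < ENNReal.ofReal c :=
          not_lt.2 (ENNReal.ofReal_le_ofReal (not_lt.1 h1))
        rw [indicator_of_mem (mem_Ioi.2 h0), indicator_of_notMem (by exact h2),
          indicator_of_notMem (fun h => h1 h.2), mul_zero]
    · rw [indicator_of_notMem (by simpa using h0), indicator_of_notMem (fun h => h0 h.1)]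
  rcases eq_or_ne c ∞ with rfl | hc
  · rw [ENNReal.top_rpow_of_pos hr, eq_top_iff]
    -- For c = ∞ the integral exceeds every x, by comparison with the cutoff x^(1/r).
    refine ENNReal.le_of_forall_nnreal_lt fun x _ => ?_
    have h1 := key ((x : ℝ) ^ (1 / r)) (by positivity)
    rw [ENNReal.ofReal_rpow_of_nonneg (by positivity) hr.le, ← Real.rpow_mul x.coe_nonneg,
      one_div_mul_cancel hr.ne', Real.rpow_one, ENNReal.ofReal_coe_nnreal] at h1
    rw [← h1]
    gcongr with l
    exact le_top
  · have := key c.toReal ENNReal.toReal_nonneg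
    rwa [ENNReal.ofReal_toReal hc] at this

theorem lintegral_Ioi_indicator_lt (c : ℝ≥0∞) :
    ∫⁻ l in Ioi (0 : ℝ), {l | ENNReal.ofReal l < c}.indicator 1 l = c := by
  have h := lintegral_dilationMeasure_rpow one_pos c
  simp only [ENNReal.ofReal_one, one_mul, ENNReal.rpow_one] at h
  rw [lintegral_dilationMeasure] at h
  conv_rhs => rw [← h]
  refine setLIntegral_congr_fun measurableSet_Ioi fun l hl => ?_
  have hl : 0 < l := hl
  by_cases hc : ENNReal.ofReal l < c
  · rw [indicator_of_mem (by exact hc), indicator_of_mem (by exact hc),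
      ← ENNReal.ofReal_mul (by positivity), one_div_mul_cancel hl.ne']
    simp
  · rw [indicator_of_notMem (by exact hc), indicator_of_notMem (by exact hc), mul_zero]

end

/-! ### Layer cake, and the Lorentz quasinorm through rearrangements -/

noncomputable section

theorem measurableSet_ofReal_lt {β : Type*} [MeasurableSpace β] {f : β → ℝ≥0∞}
    (hf : Measurable f) : MeasurableSet {z : ℝ × β | ENNReal.ofReal z.1 < f z.2} :=
  measurableSet_lt (ENNReal.measurable_ofReal.comp measurable_fst) (hf.comp measurable_snd)

/-- The layer cake formula. -/
theorem lintegral_mul_eq_lintegral_lt {α : Type*} [MeasurableSpace α] {μ : Measure α} [SFinite μ]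
    {h w : α → ℝ≥0∞} (hh : Measurable h) (hw : Measurable w) :
    ∫⁻ x, h x * w x ∂μ = ∫⁻ l in Ioi (0 : ℝ), ∫⁻ x in {x | ENNReal.ofReal l < h x}, w x ∂μ := by
  calc ∫⁻ x, h x * w x ∂μ
      = ∫⁻ x, (∫⁻ l in Ioi (0 : ℝ), {l | ENNReal.ofReal l < h x}.indicator 1 l * w x) ∂μ := by
        refine lintegral_congr fun x => ?_
        rw [lintegral_mul_const, lintegral_Ioi_indicator_lt]
        exact measurable_one.indicator (measurableSet_lt ENNReal.measurable_ofReal measurable_const)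
    _ = ∫⁻ l in Ioi (0 : ℝ), (∫⁻ x, {l | ENNReal.ofReal l < h x}.indicator 1 l * w x ∂μ) := by
        refine lintegral_lintegral_swap ?_
        refine Measurable.aemeasurable ?_
        have h1 : Measurable ({z : ℝ × α | ENNReal.ofReal z.1 < h z.2}.indicator
          (1 : ℝ × α → ℝ≥0∞)) := measurable_one.indicator (measurableSet_ofReal_lt hh)
        exact (h1.comp measurable_swap).mul (hw.comp measurable_fst)
    _ = _ := by
        refine lintegral_congr fun l => ?_
        rw [← lintegral_indicator (measurableSet_lt measurable_const hh)]
        refine lintegral_congr fun x => ?_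
        by_cases hx : ENNReal.ofReal l < h x
        · rw [indicator_of_mem (by exact hx), indicator_of_mem (by exact hx)]
          simp
        · rw [indicator_of_notMem (by exact hx), indicator_of_notMem (by exact hx), zero_mul]

theorem eLpNorm_dilationMeasure_eq_lintegral {r : ℝ≥0∞} (h0 : r ≠ 0) (h1 : r ≠ ∞)
    (f : ℝ → ℝ≥0∞) : eLpNorm f r dilationMeasure =
      (∫⁻ l, f l ^ r.toReal ∂dilationMeasure) ^ (1 / r.toReal) := by
  rw [eLpNorm_eq_lintegral_rpow_enorm_toReal h0 h1]
  rfl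

/-- The essential supremum of a left lower semicontinuous function is its supremum. -/
theorem eLpNorm_top_dilationMeasure {x : ℝ} (hx : 0 < x) {g : ℝ≥0∞ → ℝ≥0∞} (hg : Antitone g) :
    eLpNorm (fun b : ℝ => ENNReal.ofReal b ^ x * g (ENNReal.ofReal b)) ∞ dilationMeasure =
      ⨆ b : Ioi (0 : ℝ), ENNReal.ofReal b ^ x * g (ENNReal.ofReal b) := by
  rw [eLpNorm_exponent_top, eLpNormEssSup]
  refine le_antisymm (essSup_le_of_ae_le _ ?_) (iSup_le fun ⟨b, hb⟩ => ?_)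
  · filter_upwards [ae_dilationMeasure_pos] with b hb
    exact le_iSup (fun b : Ioi (0 : ℝ) => ENNReal.ofReal b ^ x * g (ENNReal.ofReal b)) ⟨b, hb⟩
  · have hb : 0 < b := hb
    -- A single point is invisible to the essential supremum, but the interval (sb, b) has positive
    -- measure, and on it the function is at least (sb)^x g(b) because g is antitone. Then s → 1.
    have key : ∀ s : ℝ, s ∈ Ioo 0 1 → ENNReal.ofReal (s * b) ^ x * g (ENNReal.ofReal b) ≤
        essSup (fun b : ℝ => ‖ENNReal.ofReal b ^ x * g (ENNReal.ofReal b)‖ₑ) dilationMeasure := by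
      intro s hs
      have hpos : dilationMeasure (Ioo (s * b) b) ≠ 0 := by
        rw [dilationMeasure_eq_map_exp, Measure.map_apply Real.measurable_exp measurableSet_Ioo]
        refine (IsOpen.measure_pos _ (isOpen_Ioo.preimage Real.continuous_exp) ?_).ne'
        obtain ⟨c, hc⟩ := exists_between (show s * b < b by nlinarith [hs.2])
        refine ⟨Real.log c, ?_⟩
        rw [mem_preimage, Real.exp_log ((mul_pos hs.1 hb).trans hc.1)]
        exact hc
      have hae : ∀ᵐ c ∂dilationMeasure.restrict (Ioo (s * b) b),
          ‖ENNReal.ofReal c ^ x * g (ENNReal.ofReal c)‖ₑ ≤ essSup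
            (fun b : ℝ => ‖ENNReal.ofReal b ^ x * g (ENNReal.ofReal b)‖ₑ) dilationMeasure :=
        ae_restrict_of_ae (ENNReal.ae_le_essSup _)
      have hae2 := hae.and (ae_restrict_mem measurableSet_Ioo)
      have : (ae (dilationMeasure.restrict (Ioo (s * b) b))).NeBot := by
        rw [ae_neBot]
        rwa [Ne, Measure.restrict_eq_zero]
      obtain ⟨c, hc1, hc2⟩ := hae2.exists
      refine le_trans ?_ hc1
      rw [enorm_eq_self]
      gcongr
      · exact hc2.1.le
      · exact hg (ENNReal.ofReal_le_ofReal hc2.2.le)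
    have hlim : Filter.Tendsto (fun s : ℝ => ENNReal.ofReal (s * b) ^ x * g (ENNReal.ofReal b))
        (nhdsWithin 1 (Iio 1)) (nhds (ENNReal.ofReal b ^ x * g (ENNReal.ofReal b))) := by
      have h1 : Filter.Tendsto (fun s : ℝ => ENNReal.ofReal (s * b) ^ x) (nhdsWithin 1 (Iio 1))
          (nhds (ENNReal.ofReal b ^ x)) := by
        have : Continuous fun s : ℝ => ENNReal.ofReal (s * b) ^ x :=
          ENNReal.continuous_rpow_const.comp (ENNReal.continuous_ofReal.comp (by fun_prop))
        have h2 := this.tendsto 1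
        rw [one_mul] at h2
        exact h2.mono_left nhdsWithin_le_nhds
      refine ENNReal.Tendsto.mul_const h1 (Or.inl ?_)
      simp [hb, ENNReal.rpow_eq_zero_iff, hx.not_gt]
    refine le_of_tendsto hlim ?_
    filter_upwards [Ioo_mem_nhdsLT (show (0 : ℝ) < 1 by norm_num)] with s hs using key s hs

theorem rearr_eq_iSup {α : Type*} [MeasurableSpace α] {μ : Measure α} {h : α → ℝ≥0∞} (b : ℝ≥0∞) :
    rearr μ h b = ⨆ (l : Ioi (0 : ℝ)) (_ : b < μ {x | ENNReal.ofReal l < h x}),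
      ENNReal.ofReal l := by
  refine le_antisymm (le_of_forall_lt fun c hc => ?_) (iSup₂_le fun l hl =>
    (lt_rearr_iff.2 hl).le)
  obtain ⟨c', h1, h2⟩ := exists_between hc
  obtain ⟨c'', h3, h4⟩ := exists_between h1
  have ht : c' ≠ ∞ := (h2.trans_le le_top).ne
  have hpos : 0 < c'.toReal := ENNReal.toReal_pos (bot_lt_of_lt h1).ne' ht
  refine h1.trans_le ?_
  rw [← ENNReal.ofReal_toReal ht] at h2 ⊢
  exact le_iSup₂_of_le ⟨c'.toReal, hpos⟩ (lt_rearr_iff.1 h2) le_rfl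

/-- For r = ∞ both sides are the supremum of l · b^(1/p) over the region b < μ{h > l}. For r = R < ∞
both are R-th roots of multiples of the integral of l^R b^(R/p) over that region: integrating out b
first produces the factor R/p, integrating out l first produces R, and the constant p^(1/r) in the
definition makes up the difference. -/
theorem lorentzNorm_eq_eLpNorm_rearr {α : Type*} [MeasurableSpace α] {μ : Measure α}
    {p : ℝ} (hp : 0 < p) {r : ℝ≥0∞} (hr : r ≠ 0) (h : α → ℝ≥0∞) :
    lorentzNorm p r μ h = eLpNorm (fun b : ℝ => ENNReal.ofReal b ^ (1 / p) *
      rearr μ h (ENNReal.ofReal b)) r dilationMeasure := by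
  have hp' : 0 < 1 / p := by positivity
  rcases eq_or_ne r ∞ with rfl | hr'
  · rw [eLpNorm_top_dilationMeasure hp' antitone_rearr, lorentzNorm]
    have := eLpNorm_top_dilationMeasure one_pos
      (g := fun l => μ {x | l < h x} ^ (1 / p)) fun a b hab =>
        ENNReal.rpow_le_rpow (antitone_measure_lt hab) hp'.le
    simp only [ENNReal.rpow_one] at this
    rw [this]
    simp only [ENNReal.inv_top, ENNReal.toReal_zero, ENNReal.rpow_zero, one_mul]
    refine le_antisymm (iSup_le fun l => ?_) (iSup_le fun b => ?_)
    · refine ENNReal.mul_le_of_forall_lt fun u hu v hv => ?_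
      have hv' : v ^ p < μ {x | ENNReal.ofReal l < h x} := by
        have := ENNReal.rpow_lt_rpow hv hp
        rwa [← ENNReal.rpow_mul, one_div_mul_cancel hp.ne', ENNReal.rpow_one] at this
      obtain ⟨b, hb1, hb2⟩ := exists_between hv'
      have hbt : b ≠ ∞ := (hb2.trans_le le_top).ne
      have hb0 : 0 < b.toReal := ENNReal.toReal_pos (bot_lt_of_lt hb1).ne' hbt
      refine le_trans ?_ (le_iSup _ (⟨b.toReal, hb0⟩ : Ioi (0 : ℝ)))
      simp only [ENNReal.ofReal_toReal hbt]
      rw [mul_comm]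
      refine mul_le_mul' ?_ (hu.le.trans (lt_rearr_iff.2 hb2).le)
      have := ENNReal.rpow_le_rpow hb1.le hp'.le
      rwa [← ENNReal.rpow_mul, mul_one_div_cancel hp.ne', ENNReal.rpow_one] at this
    · rw [rearr_eq_iSup]
      simp only [ENNReal.mul_iSup]
      refine iSup₂_le fun l hl => ?_
      refine le_trans ?_ (le_iSup _ l)
      rw [mul_comm]
      gcongr
  · have hr0 : 0 < r.toReal := ENNReal.toReal_pos hr hr'
    rw [lorentzNorm, eLpNorm_dilationMeasure_eq_lintegral hr hr',
      eLpNorm_dilationMeasure_eq_lintegral hr hr', ENNReal.toReal_inv, one_div r.toReal,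
      ← ENNReal.mul_rpow_of_nonneg _ _ (by positivity)]
    congr 1
    set R := r.toReal
    have hm : Measurable fun z : ℝ × ℝ => {z : ℝ × ℝ | ENNReal.ofReal z.2 <
        μ {x | ENNReal.ofReal z.1 < h x}}.indicator
        (fun z => ENNReal.ofReal z.1 ^ R * ENNReal.ofReal z.2 ^ (R / p)) z := by
      refine Measurable.indicator (by fun_prop) (measurableSet_lt (by fun_prop) ?_)
      exact measurable_measure_lt.comp (ENNReal.measurable_ofReal.comp measurable_fst)
    have hL : ∀ l : ℝ, (ENNReal.ofReal l * μ {x | ENNReal.ofReal l < h x} ^ (1 / p)) ^ R =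
        ENNReal.ofReal (R / p) * ∫⁻ b, {z : ℝ × ℝ | ENNReal.ofReal z.2 <
        μ {x | ENNReal.ofReal z.1 < h x}}.indicator
        (fun z => ENNReal.ofReal z.1 ^ R * ENNReal.ofReal z.2 ^ (R / p)) (l, b)
          ∂dilationMeasure := by
      intro l
      rw [ENNReal.mul_rpow_of_nonneg _ _ hr0.le, ← ENNReal.rpow_mul, one_div_mul_eq_div,
        ← lintegral_dilationMeasure_rpow (show 0 < R / p by positivity), mul_left_comm,
        ← lintegral_const_mul']
      · congr 1
        refine lintegral_congr fun b => ?_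
        by_cases hb : ENNReal.ofReal b < μ {x | ENNReal.ofReal l < h x}
        · rw [indicator_of_mem (by exact hb), indicator_of_mem (by exact hb)]
        · rw [indicator_of_notMem (by exact hb), indicator_of_notMem (by exact hb), mul_zero]
      · exact (ENNReal.rpow_lt_top_of_nonneg hr0.le ENNReal.ofReal_ne_top).ne
    have hRt : ∀ b : ℝ, (ENNReal.ofReal b ^ (1 / p) * rearr μ h (ENNReal.ofReal b)) ^ R =
        ENNReal.ofReal R * ∫⁻ l, {z : ℝ × ℝ | ENNReal.ofReal z.2 <
        μ {x | ENNReal.ofReal z.1 < h x}}.indicator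
        (fun z => ENNReal.ofReal z.1 ^ R * ENNReal.ofReal z.2 ^ (R / p)) (l, b)
          ∂dilationMeasure := by
      intro b
      rw [ENNReal.mul_rpow_of_nonneg _ _ hr0.le, ← ENNReal.rpow_mul, one_div_mul_eq_div,
        ← lintegral_dilationMeasure_rpow hr0 (rearr μ h _), mul_left_comm,
        ← lintegral_const_mul']
      · congr 1
        refine lintegral_congr fun l => ?_
        by_cases hb : ENNReal.ofReal b < μ {x | ENNReal.ofReal l < h x}
        · rw [indicator_of_mem (by exact lt_rearr_iff.2 hb), indicator_of_mem (by exact hb),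
            mul_comm]
        · rw [indicator_of_notMem (by exact fun hl => hb (lt_rearr_iff.1 hl)),
            indicator_of_notMem (by exact hb), mul_zero]
      · exact (ENNReal.rpow_lt_top_of_nonneg (by positivity) ENNReal.ofReal_ne_top).ne
    simp_rw [hL, hRt]
    rw [lintegral_const_mul' _ _ ENNReal.ofReal_ne_top,
      lintegral_const_mul' _ _ ENNReal.ofReal_ne_top, lintegral_lintegral_swap hm.aemeasurable,
      ← mul_assoc, ← ENNReal.ofReal_mul hp.le, mul_div_cancel₀ _ hp.ne']

end

/-! ### Minkowski's inequality and sums in L^r for all r > 0 -/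

noncomputable section

/-- **Minkowski's integral inequality**. -/
theorem eLpNorm_lintegral_le {β γ : Type*} [MeasurableSpace β] [MeasurableSpace γ]
    {μ : Measure β} [SFinite μ] {ν : Measure γ} [SigmaFinite ν] {f : β → γ → ℝ≥0∞}
    (hf : Measurable (Function.uncurry f)) {r : ℝ≥0∞} (hr : 1 ≤ r) :
    eLpNorm (fun y => ∫⁻ x, f x y ∂μ) r ν ≤ ∫⁻ x, eLpNorm (f x) r ν ∂μ := by
  have hH : Measurable fun y => ∫⁻ x, f x y ∂μ := hf.lintegral_prod_left'
  have hsw : Measurable (Function.uncurry fun y x => f x y) := hf.comp measurable_swap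
  have hfx : ∀ x, Measurable (f x) := fun x => hf.comp measurable_prodMk_left
  rcases eq_or_ne r ∞ with rfl | hr'
  · simp only [eLpNorm_exponent_top]
    by_contra hcon
    obtain ⟨c, hc1, hc2⟩ := exists_between (not_le.1 hcon)
    have hpos : ν {y | c < ∫⁻ x, f x y ∂μ} ≠ 0 := fun h0 => by
      refine absurd hc2 (not_lt.2 ?_)
      refine essSup_le_of_ae_le c ?_
      rw [Filter.EventuallyLE, ae_iff]
      simpa using h0
    -- For r = ∞, integrate over a set of finite positive measure where the left side exceeds c;
    -- after exchanging the integrals its measure cancels.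
    obtain ⟨Y, hYm, hY, hY0, hYt⟩ : ∃ Y, MeasurableSet Y ∧
        Y ⊆ {y | c < ∫⁻ x, f x y ∂μ} ∧ 0 < ν Y ∧ ν Y < ∞ := by
      obtain ⟨Y, h1, h2, h3, h4⟩ := Measure.exists_subset_measure_lt_top
        (measurableSet_lt measurable_const hH) (pos_iff_ne_zero.2 hpos)
      exact ⟨Y, h1, h2, h3, h4⟩
    have h1 : c * ν Y ≤ ∫⁻ y in Y, ∫⁻ x, f x y ∂μ ∂ν := by
      rw [← setLIntegral_const]
      exact setLIntegral_mono hH fun y hy => (show c < _ from hY hy).le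
    rw [lintegral_lintegral_swap hsw.aemeasurable] at h1
    have h2 : ∫⁻ x, ∫⁻ y in Y, f x y ∂ν ∂μ ≤ ∫⁻ x, eLpNormEssSup (f x) ν * ν Y ∂μ := by
      refine lintegral_mono fun x => ?_
      rw [← setLIntegral_const]
      exact lintegral_mono_ae (ae_restrict_of_ae (ae_le_eLpNormEssSup (f := f x)))
    rw [lintegral_mul_const' _ _ hYt.ne] at h2
    exact absurd hc1 (not_lt.2 ((ENNReal.mul_le_mul_iff_left hY0.ne' hYt.ne).1 (h1.trans h2)))
  rcases eq_or_ne r 1 with rfl | hr1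
  · simp only [eLpNorm_one_eq_lintegral_enorm, enorm_eq_self]
    rw [lintegral_lintegral_swap hsw.aemeasurable]
  have hr0 : r ≠ 0 := (one_pos.trans_le hr).ne'
  have hR : 1 < r.toReal := by
    rw [← ENNReal.toReal_one]
    exact (ENNReal.toReal_lt_toReal ENNReal.one_ne_top hr').2 (lt_of_le_of_ne hr (Ne.symm hr1))
  simp only [eLpNorm_eq_lintegral_rpow_enorm_toReal hr0 hr', enorm_eq_self]
  set R := r.toReal
  have hR0 : 0 < R := by linarith
  set A := ∫⁻ x, (∫⁻ y, f x y ^ R ∂ν) ^ (1 / R) ∂μ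
  set H := fun y => ∫⁻ x, f x y ∂μ with hHdef
  -- The duality argument divides by a power of the integral of H^R, so it is run on truncations for
  -- which that integral is finite.
  set Hn : ℕ → γ → ℝ≥0∞ := fun n => (spanningSets ν n).indicator fun y => min (H y) n with hHn
  have hHnm : ∀ n, Measurable (Hn n) := fun n =>
    (hH.min measurable_const).indicator (measurableSet_spanningSets ν n)
  have hHnH : ∀ n y, Hn n y ≤ H y := fun n y =>
    (indicator_le_self' (fun _ _ => zero_le) y).trans (min_le_left _ _)
  have hconj : R.HolderConjugate (R / (R - 1)) := Real.HolderConjugate.conjExponent hR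
  have step : ∀ n, ∫⁻ y, Hn n y ^ R ∂ν ≤ A ^ R := by
    intro n
    set B := ∫⁻ y, Hn n y ^ R ∂ν with hB
    have hBt : B ≠ ∞ := by
      have : B ≤ ∫⁻ y in spanningSets ν n, (n : ℝ≥0∞) ^ R ∂ν := by
        rw [← lintegral_indicator (measurableSet_spanningSets ν n)]
        refine lintegral_mono fun y => ?_
        by_cases hy : y ∈ spanningSets ν n
        · simp only [hHn, indicator_of_mem hy]
          exact ENNReal.rpow_le_rpow (min_le_right _ _) hR0.le
        · simp [hHn, indicator_of_notMem hy, hR0]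
      refine ne_top_of_le_ne_top ?_ this
      rw [setLIntegral_const]
      exact ENNReal.mul_ne_top (ENNReal.rpow_ne_top_of_nonneg hR0.le (by simp))
        (measure_spanningSets_lt_top ν n).ne
    -- Write H^R = H · H^(R-1), exchange integrals and apply Hölder in y. The second factor is B to
    -- the power 1 - 1/R, which is then cancelled.
    have h1 : B ≤ A * B ^ (1 / (R / (R - 1))) := by
      calc B ≤ ∫⁻ y, ∫⁻ x, f x y * Hn n y ^ (R - 1) ∂μ ∂ν := by
            refine lintegral_mono fun y => ?_
            simp only
            rw [lintegral_mul_const _ (show Measurable fun x => f x y from hf.comp measurable_prodMk_right)]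
            calc Hn n y ^ R = Hn n y ^ (1 + (R - 1)) := by ring_nf
              _ = Hn n y * Hn n y ^ (R - 1) := by
                rw [ENNReal.rpow_add_of_nonneg _ _ zero_le_one (by linarith), ENNReal.rpow_one]
              _ ≤ _ := by gcongr; exact hHnH n y
        _ = ∫⁻ x, ∫⁻ y, f x y * Hn n y ^ (R - 1) ∂ν ∂μ := by
            refine lintegral_lintegral_swap ?_
            exact (hsw.mul
              (((hHnm n).comp measurable_fst).pow_const _)).aemeasurable
        _ ≤ ∫⁻ x, (∫⁻ y, f x y ^ R ∂ν) ^ (1 / R) * B ^ (1 / (R / (R - 1))) ∂μ := by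
            refine lintegral_mono fun x => ?_
            refine (ENNReal.lintegral_mul_le_Lp_mul_Lq ν hconj (hfx x).aemeasurable
              ((hHnm n).pow_const _).aemeasurable).trans ?_
            simp only [← ENNReal.rpow_mul]
            rw [show (R - 1) * (R / (R - 1)) = R by
              have : R - 1 ≠ 0 := by linarith
              field_simp]
        _ = A * B ^ (1 / (R / (R - 1))) := by
            rw [lintegral_mul_const']
            exact ENNReal.rpow_ne_top_of_nonneg (by
              have : 0 < R - 1 := by linarith
              positivity) hBt
    rcases eq_or_ne B 0 with h0 | h0
    · rw [h0]; exact zero_le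
    have h2 : B ^ (1 / R) ≤ A := by
      have h3 : B = B ^ (1 / R) * B ^ (1 / (R / (R - 1))) := by
        rw [← ENNReal.rpow_add _ _ h0 hBt, show 1 / R + 1 / (R / (R - 1)) = 1 by
          have : R - 1 ≠ 0 := by linarith
          field_simp
          ring, ENNReal.rpow_one]
      refine (ENNReal.mul_le_mul_iff_left ?_ ?_).1 (h3.symm.trans_le h1)
      · simp [ENNReal.rpow_eq_zero_iff, h0, hBt]
      · exact ENNReal.rpow_ne_top_of_nonneg (by
          have : 0 < R - 1 := by linarith
          positivity) hBt
    have h4 := ENNReal.rpow_le_rpow h2 hR0.le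
    rwa [← ENNReal.rpow_mul, one_div_mul_cancel hR0.ne', ENNReal.rpow_one] at h4
  have hmono : ∀ y, Monotone fun n => Hn n y := by
    intro y m n hmn
    simp only [hHn]
    classical
    rw [indicator_apply, indicator_apply]
    split_ifs with h1 h2
    · exact min_le_min le_rfl (by exact_mod_cast hmn)
    · exact absurd (monotone_spanningSets ν hmn h1) h2
    · exact zero_le
    · exact zero_le
  have hsup : ∀ y, H y ≤ ⨆ n, Hn n y := by
    intro y
    refine le_of_forall_lt fun c hc => ?_
    obtain ⟨n, hn⟩ := ENNReal.exists_nat_gt (hc.trans_le le_top).ne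
    have hy := mem_spanningSetsIndex ν y
    have hmem : y ∈ spanningSets ν (max n (spanningSetsIndex ν y)) :=
      monotone_spanningSets ν (le_max_right _ _) hy
    refine lt_of_lt_of_le ?_ (le_iSup _ (max n (spanningSetsIndex ν y)))
    simp only [hHn, indicator_of_mem hmem]
    refine lt_min hc (hn.trans_le (by exact_mod_cast le_max_left _ _))
  have hfin : ∫⁻ y, H y ^ R ∂ν ≤ A ^ R := by
    calc ∫⁻ y, H y ^ R ∂ν ≤ ∫⁻ y, ⨆ n, Hn n y ^ R ∂ν := by
          refine lintegral_mono fun y => ?_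
          have : (⨆ n, Hn n y) ^ R = ⨆ n, Hn n y ^ R :=
            (ENNReal.orderIsoRpow R hR0).map_iSup fun n => Hn n y
          simp only [← this]
          exact ENNReal.rpow_le_rpow (hsup y) hR0.le
      _ = ⨆ n, ∫⁻ y, Hn n y ^ R ∂ν := by
          refine lintegral_iSup (fun n => (hHnm n).pow_const _) fun m n hmn y => ?_
          exact ENNReal.rpow_le_rpow (hmono y hmn) hR0.le
      _ ≤ A ^ R := iSup_le step
  have h5 := ENNReal.rpow_le_rpow hfin (show 0 ≤ 1 / R by positivity)
  rwa [← ENNReal.rpow_mul A, mul_one_div_cancel hR0.ne', ENNReal.rpow_one] at h5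

theorem ENNReal.tsum_rpow_le_tsum_rpow {ι : Type*} (f : ι → ℝ≥0∞) {r : ℝ} (h0 : 0 < r)
    (h1 : r ≤ 1) : (∑' i, f i) ^ r ≤ ∑' i, f i ^ r := by
  classical
  have hfin : ∀ s : Finset ι, (∑ i ∈ s, f i) ^ r ≤ ∑ i ∈ s, f i ^ r := by
    intro s
    induction s using Finset.induction_on with
    | empty => simp [h0]
    | insert a s ha ih =>
      rw [Finset.sum_insert ha, Finset.sum_insert ha]
      exact (ENNReal.rpow_add_le_add_rpow _ _ h0.le h1).trans (by gcongr)
  have h2 : (∑' i, f i) ^ r = ⨆ s : Finset ι, (∑ i ∈ s, f i) ^ r := by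
    rw [ENNReal.tsum_eq_iSup_sum]
    exact (ENNReal.orderIsoRpow r h0).map_iSup _
  rw [h2]
  exact iSup_le fun s => (hfin s).trans (ENNReal.sum_le_tsum s)

theorem eLpNorm_const_mul_ennreal {γ : Type*} [MeasurableSpace γ] {ν : Measure γ} {g : γ → ℝ≥0∞}
    (hg : Measurable g) {r : ℝ≥0∞} (hr : r ≠ 0) (c : ℝ≥0∞) :
    eLpNorm (fun y => c * g y) r ν = c * eLpNorm g r ν := by
  rcases eq_or_ne r ∞ with rfl | hrt
  · simp only [eLpNorm_exponent_top, eLpNormEssSup]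
    exact ENNReal.essSup_const_mul
  · have hR := ENNReal.toReal_pos hr hrt
    simp only [eLpNorm_eq_lintegral_rpow_enorm_toReal hr hrt, enorm_eq_self]
    simp only [ENNReal.mul_rpow_of_nonneg _ _ hR.le]
    rw [lintegral_const_mul _ (hg.pow_const _),
      ENNReal.mul_rpow_of_nonneg _ _ (by positivity), ← ENNReal.rpow_mul,
      mul_one_div_cancel hR.ne', ENNReal.rpow_one]

/-- A weighted sum of functions with a common `L^r` bound. -/
theorem eLpNorm_tsum_mul_le {ι γ : Type*} [Countable ι] [MeasurableSpace γ] {ν : Measure γ}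
    [SigmaFinite ν] {g : ι → γ → ℝ≥0∞} (hg : ∀ i, Measurable (g i)) {r : ℝ≥0∞} (hr : r ≠ 0)
    {e : ι → ℝ≥0∞} {s : ℝ} (hs0 : 0 < s) (hs1 : s ≤ 1) (hsr : ENNReal.ofReal s ≤ r) 
    (hsr' : s < 1 → r = ENNReal.ofReal s)
    {N : ℝ≥0∞} (hN : ∀ i, eLpNorm (g i) r ν ≤ N) :
    eLpNorm (fun y => ∑' i, e i * g i y) r ν ≤ (∑' i, e i ^ s) ^ (1 / s) * N := by
  -- If s < 1 then r = s and the s-th power is subadditive. If s = 1 then r ≥ 1 and Minkowski's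
  -- inequality applies with counting measure on the index set.
  rcases hs1.lt_or_eq with h | rfl
  · have hrr := hsr' h
    have hrt : r ≠ ∞ := by rw [hrr]; exact ENNReal.ofReal_ne_top
    have hrs : r.toReal = s := by rw [hrr, ENNReal.toReal_ofReal hs0.le]
    rw [eLpNorm_eq_lintegral_rpow_enorm_toReal hr hrt, hrs]
    have h1 : ∀ i, ∫⁻ y, g i y ^ s ∂ν ≤ N ^ s := by
      intro i
      have h2 := ENNReal.rpow_le_rpow (hN i) hs0.le
      rw [eLpNorm_eq_lintegral_rpow_enorm_toReal hr hrt, hrs, ← ENNReal.rpow_mul,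
        one_div_mul_cancel hs0.ne', ENNReal.rpow_one] at h2
      exact h2
    calc (∫⁻ y, ‖∑' i, e i * g i y‖ₑ ^ s ∂ν) ^ (1 / s)
        ≤ (∫⁻ y, ∑' i, e i ^ s * g i y ^ s ∂ν) ^ (1 / s) := by
          gcongr with y
          rw [enorm_eq_self]
          refine (ENNReal.tsum_rpow_le_tsum_rpow _ hs0 hs1).trans (le_of_eq ?_)
          exact tsum_congr fun i => ENNReal.mul_rpow_of_nonneg _ _ hs0.le
      _ = (∑' i, e i ^ s * ∫⁻ y, g i y ^ s ∂ν) ^ (1 / s) := by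
          rw [lintegral_tsum fun i => (((hg i).pow_const s).const_mul _).aemeasurable]
          congr 1
          exact tsum_congr fun i => lintegral_const_mul _ ((hg i).pow_const s)
      _ ≤ (∑' i, e i ^ s * N ^ s) ^ (1 / s) := by
          gcongr with i
          exact h1 i
      _ = _ := by
          rw [ENNReal.tsum_mul_right, ENNReal.mul_rpow_of_nonneg _ _ (by positivity),
            ← ENNReal.rpow_mul N, mul_one_div_cancel hs0.ne', ENNReal.rpow_one]
  · rw [ENNReal.ofReal_one] at hsr
    simp only [ENNReal.rpow_one, div_one]
    let : MeasurableSpace ι := ⊤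
    have hm : Measurable (Function.uncurry fun i y => e i * g i y) :=
      measurable_from_prod_countable_right fun i => by
        simpa using (hg i).const_mul (e i)
    have h1 := eLpNorm_lintegral_le (μ := Measure.count) (ν := ν) hm hsr
    simp only [lintegral_count] at h1
    refine h1.trans ?_
    rw [← ENNReal.tsum_mul_right]
    refine ENNReal.tsum_le_tsum fun i => ?_
    rw [eLpNorm_const_mul_ennreal (hg i) hr]
    gcongr
    exact hN i

end

/-! ### Boundedness of the Calderón-type operator -/

noncomputable section

/-- The Calderón-type operator
`c ↦ ∫_0^∞ min ((m(l)/c)^a, (m(l)/c)^b) dl`, where `m` is the distribution function of `h`. -/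
def calderonSum {α : Type*} [MeasurableSpace α] (μ : Measure α) (a b : ℝ) (h : α → ℝ≥0∞)
    (c : ℝ≥0∞) : ℝ≥0∞ :=
  ∫⁻ l in Ioi (0 : ℝ), min ((μ {x | ENNReal.ofReal l < h x} / c) ^ a)
    ((μ {x | ENNReal.ofReal l < h x} / c) ^ b)

/-- Dyadic weights. -/
def dyadicWeight (a b : ℝ) (k : ℤ) : ℝ≥0∞ :=
  min (((2 : ℝ≥0∞) ^ (k + 1)) ^ a) (((2 : ℝ≥0∞) ^ (k + 1)) ^ b)

/-- For finite y > 0, the single index k with 2^k < y ≤ 2^(k+1) already suffices, which is why the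
weights use 2^(k+1). For y = ∞ all terms with k ≥ 0 are at least 1. -/
theorem min_rpow_le_tsum_dyadicWeight {a b : ℝ} (ha : 0 < a) (hb : 0 < b) (y : ℝ≥0∞) :
    min (y ^ a) (y ^ b) ≤ ∑' k : ℤ, dyadicWeight a b k * {k : ℤ | (2 : ℝ≥0∞) ^ k < y}.indicator 1 k := by
  rcases eq_or_ne y 0 with rfl | h0
  · simp [ha, hb]
  rcases eq_or_ne y ∞ with rfl | ht
  · have h1 : (∞ : ℝ≥0∞) ≤ ∑' n : ℕ, dyadicWeight a b (n : ℤ) *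
        {k : ℤ | (2 : ℝ≥0∞) ^ k < ∞}.indicator 1 (n : ℤ) := by
      refine (ENNReal.tsum_const_eq_top_of_ne_zero (α := ℕ) (c := 1) one_ne_zero).ge.trans ?_
      refine ENNReal.tsum_le_tsum fun n => ?_
      have hlt : (2 : ℝ≥0∞) ^ (n : ℤ) < ∞ := by
        rw [zpow_natCast]; exact ENNReal.pow_lt_top (by simp)
      rw [indicator_of_mem (by exact hlt)]
      have h2 : (1 : ℝ≥0∞) ≤ 2 ^ ((n : ℤ) + 1) := by
        rw [show (n : ℤ) + 1 = ((n + 1 : ℕ) : ℤ) by push_cast; rfl, zpow_natCast]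
        exact one_le_pow₀ (by norm_num)
      simp only [Pi.one_apply, mul_one, dyadicWeight]
      exact le_min (ENNReal.one_le_rpow h2 ha) (ENNReal.one_le_rpow h2 hb)
    exact le_top.trans (h1.trans (ENNReal.tsum_comp_le_tsum_of_injective Nat.cast_injective
      fun k : ℤ => dyadicWeight a b k * {k : ℤ | (2 : ℝ≥0∞) ^ k < ∞}.indicator 1 k))
  · obtain ⟨k, hk1, hk2⟩ := ENNReal.exists_mem_Ioc_zpow h0 ht (by norm_num : (1 : ℝ≥0∞) < 2)
      (by simp)
    refine le_trans ?_ (ENNReal.le_tsum k)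
    rw [indicator_of_mem (by exact hk1)]
    simp only [Pi.one_apply, mul_one, dyadicWeight]
    gcongr

/-- The condition 2^k < m(l)/c says exactly l < h*(c 2^k), so integrating the dyadic bound over the
levels l leaves the rearrangement at the points c 2^k. -/
theorem calderonSum_le_tsum {α : Type*} [MeasurableSpace α] {μ : Measure α} {a b : ℝ} (ha : 0 < a)
    (hb : 0 < b) (h : α → ℝ≥0∞) {c : ℝ≥0∞} (hc0 : c ≠ 0) (hct : c ≠ ∞) :
    calderonSum μ a b h c ≤ ∑' k : ℤ, dyadicWeight a b k * rearr μ h (c * 2 ^ k) := by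
  have hm : ∀ k : ℤ, Measurable fun l : ℝ =>
      {l : ℝ | ENNReal.ofReal l < rearr μ h (c * 2 ^ k)}.indicator (1 : ℝ → ℝ≥0∞) l := fun k =>
    measurable_one.indicator (measurableSet_lt ENNReal.measurable_ofReal measurable_const)
  calc calderonSum μ a b h c
      ≤ ∫⁻ l in Ioi (0 : ℝ), ∑' k : ℤ, dyadicWeight a b k *
          {l : ℝ | ENNReal.ofReal l < rearr μ h (c * 2 ^ k)}.indicator 1 l := by
        refine lintegral_mono fun l => (min_rpow_le_tsum_dyadicWeight ha hb _).trans (le_of_eq ?_)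
        refine tsum_congr fun k => ?_
        congr 1
        have hiff : (2 : ℝ≥0∞) ^ k < μ {x | ENNReal.ofReal l < h x} / c ↔
            ENNReal.ofReal l < rearr μ h (c * 2 ^ k) := by
          rw [lt_rearr_iff, ENNReal.lt_div_iff_mul_lt (Or.inl hc0) (Or.inl hct), mul_comm]
        by_cases hl : ENNReal.ofReal l < rearr μ h (c * 2 ^ k)
        · rw [indicator_of_mem (by exact hiff.2 hl), indicator_of_mem (by exact hl)]
          rfl
        · rw [indicator_of_notMem (by exact fun h => hl (hiff.1 h)), indicator_of_notMem (by exact hl)]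
    _ = _ := by
        rw [lintegral_tsum fun k => ((hm k).const_mul _).aemeasurable]
        refine tsum_congr fun k => ?_
        rw [lintegral_const_mul _ (hm k), lintegral_Ioi_indicator_lt]

/-- The exponent a controls the terms with k ≥ 0 and b those with k ≤ 0. Since x lies strictly
between them, there is geometric decay in both directions, at rate at least min(b - x, x - a). -/
theorem tsum_dyadicWeight_lt_top {a b x s : ℝ} (hax : a < x) (hxb : x < b) (hs : 0 < s) :
    ∑' k : ℤ, (dyadicWeight a b k * ((2 : ℝ≥0∞) ^ k) ^ (-x)) ^ s < ∞ := by
  set η := min (b - x) (x - a)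
  have hη : 0 < η := lt_min (by linarith) (by linarith)
  set Q : ℝ≥0∞ := 2 ^ (-(η * s))
  have hQ : Q < 1 := ENNReal.rpow_lt_one_of_one_lt_of_neg (by norm_num) (by
    have : 0 < η * s := by positivity
    linarith)
  set K : ℝ≥0∞ := 2 ^ (max a b * s)
  have hK : K ≠ ∞ := by
    simp [K, ENNReal.rpow_eq_top_iff]
  have hpt : ∀ k : ℤ, (dyadicWeight a b k * ((2 : ℝ≥0∞) ^ k) ^ (-x)) ^ s ≤ K * Q ^ k.natAbs := by
    intro k
    have hz : ∀ (j : ℤ) (y : ℝ), ((2 : ℝ≥0∞) ^ j) ^ y = 2 ^ ((j : ℝ) * y) := fun j y => by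
      rw [← ENNReal.rpow_intCast, ENNReal.rpow_mul]
    have h2 : ∀ u v : ℝ, (2 : ℝ≥0∞) ^ u * 2 ^ v = 2 ^ (u + v) := fun u v =>
      (ENNReal.rpow_add _ _ (by simp) (by simp)).symm
    have hmono : ∀ {u v : ℝ}, u ≤ v → (2 : ℝ≥0∞) ^ u ≤ 2 ^ v := fun huv =>
      ENNReal.rpow_le_rpow_of_exponent_le (by norm_num) huv
    rw [← ENNReal.rpow_natCast Q, ← ENNReal.rpow_mul, h2]
    rcases le_total 0 k with hk | hk
    · have hkR : ((k.natAbs : ℕ) : ℝ) = (k : ℝ) := by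
        rw [Nat.cast_natAbs, abs_of_nonneg hk]
      have hk' : (0 : ℝ) ≤ k := by exact_mod_cast hk
      calc _ ≤ (((2 : ℝ≥0∞) ^ (k + 1)) ^ a * ((2 : ℝ≥0∞) ^ k) ^ (-x)) ^ s := by
            gcongr; exact min_le_left _ _
        _ = 2 ^ ((((k : ℝ) + 1) * a - k * x) * s) := by
            rw [hz, hz, h2, ← ENNReal.rpow_mul]
            push_cast
            ring_nf
        _ ≤ _ := hmono (by
            rw [hkR]
            have h3 : η ≤ x - a := min_le_right _ _
            have h4 : (k : ℝ) * η ≤ k * (x - a) := by gcongr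
            have h5 : a ≤ max a b := le_max_left _ _
            nlinarith)
    · have hkR : ((k.natAbs : ℕ) : ℝ) = -(k : ℝ) := by
        rw [Nat.cast_natAbs, abs_of_nonpos hk]; push_cast; rfl
      have hk' : (k : ℝ) ≤ 0 := by exact_mod_cast hk
      calc _ ≤ (((2 : ℝ≥0∞) ^ (k + 1)) ^ b * ((2 : ℝ≥0∞) ^ k) ^ (-x)) ^ s := by
            gcongr; exact min_le_right _ _
        _ = 2 ^ ((((k : ℝ) + 1) * b - k * x) * s) := by
            rw [hz, hz, h2, ← ENNReal.rpow_mul]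
            push_cast
            ring_nf
        _ ≤ _ := hmono (by
            rw [hkR]
            have h3 : η ≤ b - x := min_le_left _ _
            have h4 : (-k : ℝ) * η ≤ -k * (b - x) := by
              gcongr
              linarith
            have h5 : b ≤ max a b := le_max_right _ _
            nlinarith)
  refine (ENNReal.tsum_le_tsum hpt).trans_lt ?_
  rw [ENNReal.tsum_mul_left]
  refine ENNReal.mul_lt_top hK.lt_top ?_
  have hgeo : ∑' n : ℕ, Q ^ n < ∞ := by
    rw [ENNReal.tsum_geometric]
    simpa using hQ
  rw [tsum_of_nat_of_neg_add_one ENNReal.summable ENNReal.summable]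
  refine ENNReal.add_lt_top.2 ⟨by simpa using hgeo, ?_⟩
  refine lt_of_le_of_lt (ENNReal.tsum_le_tsum fun n => ?_) hgeo
  have : (-((n : ℤ) + 1)).natAbs = n + 1 := by omega
  rw [this]
  exact pow_le_pow_right_of_le_one' hQ.le (by omega)

/-- Up to weights, the left function is dominated by a sum of the dilates G(2^k c) of G(c) = c^x
h*(c). They all have the same L^r(dc/c) quasinorm, and the weights are summable to the power s =
min(1, r), which is what adding functions in L^r requires even when r < 1. -/
theorem exists_eLpNorm_calderonSum_le {a b x : ℝ} (ha : 0 < a) (hax : a < x) (hxb : x < b)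
    {r : ℝ≥0∞} (hr : r ≠ 0) : ∃ C : ℝ≥0, ∀ {α : Type*} [MeasurableSpace α] (μ : Measure α)
      (h : α → ℝ≥0∞),
      eLpNorm (fun c : ℝ => ENNReal.ofReal c ^ x * calderonSum μ a b h (ENNReal.ofReal c)) r
        dilationMeasure ≤ C * eLpNorm (fun c : ℝ => ENNReal.ofReal c ^ x *
          rearr μ h (ENNReal.ofReal c)) r dilationMeasure := by
  set s : ℝ := (min 1 r).toReal
  have hmt : min 1 r ≠ ∞ := ne_top_of_le_ne_top ENNReal.one_ne_top (min_le_left _ _)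
  have hs0 : 0 < s := ENNReal.toReal_pos (by simp [hr]) hmt
  have hs1 : s ≤ 1 := by
    have := ENNReal.toReal_mono ENNReal.one_ne_top (min_le_left 1 r)
    simpa using this
  have hofs : ENNReal.ofReal s = min 1 r := ENNReal.ofReal_toReal hmt
  set K := (∑' k : ℤ, (dyadicWeight a b k * ((2 : ℝ≥0∞) ^ k) ^ (-x)) ^ s) ^ (1 / s)
  have hK : K ≠ ∞ := ENNReal.rpow_ne_top_of_nonneg (by positivity)
    (tsum_dyadicWeight_lt_top hax hxb hs0).ne
  refine ⟨K.toNNReal, fun μ h => ?_⟩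
  rw [ENNReal.coe_toNNReal hK]
  set G : ℝ → ℝ≥0∞ := fun c => ENNReal.ofReal c ^ x * rearr μ h (ENNReal.ofReal c) with hG
  have hGm : Measurable G := (ENNReal.measurable_ofReal.pow_const x).mul
    (measurable_rearr.comp ENNReal.measurable_ofReal)
  refine le_trans ?_ (eLpNorm_tsum_mul_le (ν := dilationMeasure) (g := fun (k : ℤ) (c : ℝ) =>
    G ((2 : ℝ) ^ k * c)) (fun k => hGm.comp (by fun_prop)) hr hs0 hs1 (by rw [hofs]; exact min_le_right _ _)
    (fun hs => ?_) (fun k => ?_))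
  · refine eLpNorm_mono_enorm_ae ?_
    filter_upwards [ae_dilationMeasure_pos] with c hc
    simp only [enorm_eq_self]
    refine (mul_le_mul_right (calderonSum_le_tsum ha (ha.trans (hax.trans hxb)) h (by simpa using hc)
      ENNReal.ofReal_ne_top) _).trans (le_of_eq ?_)
    rw [← ENNReal.tsum_mul_left]
    refine tsum_congr fun k => ?_
    have h2k : ENNReal.ofReal ((2 : ℝ) ^ k * c) = ENNReal.ofReal c * 2 ^ k := by
      rw [ENNReal.ofReal_mul (by positivity), mul_comm, ← Real.rpow_intCast,
        ← ENNReal.ofReal_rpow_of_pos (by norm_num), ENNReal.rpow_intCast]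
      simp
    simp only [hG, h2k]
    have hz0 : (2 : ℝ≥0∞) ^ k ≠ 0 := (ENNReal.zpow_pos (by simp) (by simp) k).ne'
    have hzt : (2 : ℝ≥0∞) ^ k ≠ ∞ := (ENNReal.zpow_lt_top (by simp) (by simp) k).ne
    rw [ENNReal.mul_rpow_of_ne_top ENNReal.ofReal_ne_top hzt]
    have h1 : ((2 : ℝ≥0∞) ^ k) ^ (-x) * ((2 : ℝ≥0∞) ^ k) ^ x = 1 := by
      rw [← ENNReal.rpow_add _ _ hz0 hzt, neg_add_cancel, ENNReal.rpow_zero]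
    calc _ = dyadicWeight a b k * (((2 : ℝ≥0∞) ^ k) ^ (-x) * ((2 : ℝ≥0∞) ^ k) ^ x) *
          (ENNReal.ofReal c ^ x * rearr μ h (ENNReal.ofReal c * 2 ^ k)) := by
          rw [h1]; ring
      _ = _ := by ring
  · rw [hofs]
    refine (min_eq_right ?_).symm
    by_contra hlt
    rw [not_le] at hlt
    have : s = 1 := by simp [s, min_eq_left hlt.le]
    linarith
  · exact (eLpNorm_comp_measurePreserving hGm.aestronglyMeasurable
      (measurePreserving_mul_dilationMeasure (by positivity))).le

end

/-! ### Basic Lorentz estimates and Hardy–Littlewood–Sobolev -/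

noncomputable section

theorem ENNReal.self_mul_rpow {A : ℝ≥0∞} (h0 : A ≠ 0) (ht : A ≠ ∞) (x : ℝ) :
    A * A ^ x = A ^ (1 + x) := by
  rw [ENNReal.rpow_add _ _ h0 ht, ENNReal.rpow_one]

theorem ae_lt_top_of_eLpNorm_lt_top {γ : Type*} [MeasurableSpace γ] {ν : Measure γ} {r : ℝ≥0∞}
    {f : γ → ℝ≥0∞} (hf : Measurable f) (hr : r ≠ 0) (h : eLpNorm f r ν < ∞) :
    ∀ᵐ b ∂ν, f b < ∞ := by
  rcases eq_or_ne r ∞ with rfl | hrt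
  · rw [eLpNorm_exponent_top] at h
    filter_upwards [ae_le_eLpNormEssSup (f := f) (μ := ν)] with b hb
    exact lt_of_le_of_lt hb h
  · have hR := ENNReal.toReal_pos hr hrt
    rw [eLpNorm_lt_top_iff_lintegral_rpow_enorm_lt_top hr hrt] at h
    filter_upwards [ae_lt_top (hf.enorm.pow_const r.toReal) h.ne] with b hb
    simpa [ENNReal.rpow_lt_top_iff_of_pos hR] using hb

section LorentzBasic

variable {α : Type*} [MeasurableSpace α] {μ : Measure α} {p : ℝ} {r : ℝ≥0∞} {h h' : α → ℝ≥0∞}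

theorem lorentzNorm_mono_ae (hp : 0 < p) (hh : h ≤ᵐ[μ] h') :
    lorentzNorm p r μ h ≤ lorentzNorm p r μ h' := by
  refine mul_le_mul_right (eLpNorm_mono_enorm fun l => ?_) _
  simp only [enorm_eq_self]
  refine mul_le_mul_right (ENNReal.rpow_le_rpow (measure_mono_ae ?_) (by positivity)) _
  filter_upwards [hh] with x hx hl
  exact lt_of_lt_of_le hl hx

theorem lorentzNorm_congr_ae (hp : 0 < p) (hh : h =ᵐ[μ] h') :
    lorentzNorm p r μ h = lorentzNorm p r μ h' :=
  le_antisymm (lorentzNorm_mono_ae hp hh.le) (lorentzNorm_mono_ae hp hh.symm.le)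

theorem lorentzNorm_le_of_rearr_le (hp : 0 < p) (hr : r ≠ 0) {V : ℝ → ℝ≥0∞}
    (hV : ∀ b, 0 < b → rearr μ h (ENNReal.ofReal b) ≤ V b) :
    lorentzNorm p r μ h ≤ eLpNorm (fun b => ENNReal.ofReal b ^ (1 / p) * V b) r
      dilationMeasure := by
  rw [lorentzNorm_eq_eLpNorm_rearr hp hr]
  refine eLpNorm_mono_enorm_ae ?_
  filter_upwards [ae_dilationMeasure_pos] with b hb
  simp only [enorm_eq_self]
  gcongr
  exact hV b hb

theorem rearr_const_mul_le (c b : ℝ≥0∞) : rearr μ (fun x => c * h x) b ≤ c * rearr μ h b := by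
  refine sInf_le ?_
  refine (measure_mono fun x hx => ?_).trans (measure_lt_rearr_le (μ := μ) (h := h) b)
  exact lt_of_mul_lt_mul_left' (show c * _ < c * h x from hx)

theorem measurable_rpow_mul_rearr (x : ℝ) : Measurable fun b : ℝ => ENNReal.ofReal b ^ x *
    rearr μ h (ENNReal.ofReal b) :=
  (ENNReal.measurable_ofReal.pow_const x).mul (measurable_rearr.comp ENNReal.measurable_ofReal)

theorem lorentzNorm_const_mul_le (hp : 0 < p) (hr : r ≠ 0) (c : ℝ≥0∞) :
    lorentzNorm p r μ (fun x => c * h x) ≤ c * lorentzNorm p r μ h := by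
  refine (lorentzNorm_le_of_rearr_le hp hr fun b _ => rearr_const_mul_le c _).trans ?_
  rw [lorentzNorm_eq_eLpNorm_rearr hp hr, ← eLpNorm_const_mul_ennreal
    (measurable_rpow_mul_rearr _) hr]
  refine le_of_eq (congrArg (fun f => eLpNorm f r dilationMeasure) ?_)
  funext b
  ring

theorem rearr_lt_top_of_lorentzNorm_lt_top (hp : 0 < p) (hr : r ≠ 0)
    (hh : lorentzNorm p r μ h < ∞) : ∀ᵐ b ∂dilationMeasure, rearr μ h (ENNReal.ofReal b) < ∞ := by
  rw [lorentzNorm_eq_eLpNorm_rearr hp hr] at hh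
  have h1 := ae_lt_top_of_eLpNorm_lt_top (measurable_rpow_mul_rearr (1 / p)) hr hh
  filter_upwards [h1, ae_dilationMeasure_pos] with b hb hb0
  refine lt_of_not_ge fun htop => ?_
  rw [top_le_iff.1 htop, ENNReal.mul_top] at hb
  · exact absurd hb (lt_irrefl _)
  · have : 0 < ENNReal.ofReal b := by simpa using hb0
    exact (ENNReal.rpow_pos this ENNReal.ofReal_ne_top).ne'

/-- A function of finite Lorentz quasinorm is finite almost everywhere. -/
theorem ae_lt_top_of_lorentzNorm_lt_top (hp : 0 < p) (hr : r ≠ 0)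
    (hh : lorentzNorm p r μ h < ∞) : ∀ᵐ x ∂μ, h x < ∞ := by
  have h1 : μ {x | ∞ ≤ h x} = 0 := by
    by_contra h0
    have hpos : 0 < μ {x | ∞ ≤ h x} := pos_iff_ne_zero.2 h0
    have hcard : ∀ b : ℝ, ENNReal.ofReal b < μ {x | ∞ ≤ h x} →
        rearr μ h (ENNReal.ofReal b) = ∞ := by
      intro b hb
      refine ENNReal.eq_top_of_forall_nnreal_le fun l => ?_
      refine (lt_rearr_iff.2 (hb.trans_le (measure_mono fun x hx => ?_))).le
      exact ENNReal.coe_lt_top.trans_le hx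
    obtain ⟨c, hc0, hc⟩ := exists_between hpos
    have hct : c ≠ ∞ := (hc.trans_le le_top).ne
    have hae := rearr_lt_top_of_lorentzNorm_lt_top hp hr hh
    have hc0' : 0 < c.toReal := ENNReal.toReal_pos hc0.ne' hct
    have hpos' : dilationMeasure (Ioo 0 c.toReal) ≠ 0 := by
      rw [dilationMeasure_eq_map_exp, Measure.map_apply Real.measurable_exp measurableSet_Ioo]
      refine (IsOpen.measure_pos _ (isOpen_Ioo.preimage Real.continuous_exp) ?_).ne'
      refine ⟨Real.log (c.toReal / 2), ?_⟩
      rw [mem_preimage, Real.exp_log (by positivity)]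
      constructor <;> linarith
    refine hpos' (measure_mono_null (fun b hb => ?_) (ae_iff.1 hae))
    have := hcard b (lt_of_le_of_lt (ENNReal.ofReal_le_ofReal hb.2.le)
      (by rwa [ENNReal.ofReal_toReal hct]))
    simp [this]
  rw [ae_iff]
  simpa using h1

end LorentzBasic

theorem rpow_mul_min_div_rpow {c : ℝ≥0∞} (hc0 : c ≠ 0) (hct : c ≠ ∞) {a b : ℝ} (ha : 0 ≤ a)
    (hb : 0 ≤ b) (m : ℝ≥0∞) :
    c ^ a * min ((m / c) ^ a) ((m / c) ^ b) = min (m ^ a) (m ^ b * c ^ (a - b)) := by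
  have h1 : c ^ a ≠ 0 := (ENNReal.rpow_pos (pos_iff_ne_zero.2 hc0) hct).ne'
  have h2 : c ^ a ≠ ∞ := ENNReal.rpow_ne_top_of_nonneg ha hct
  have hmin : c ^ a * min ((m / c) ^ a) ((m / c) ^ b) =
      min (c ^ a * (m / c) ^ a) (c ^ a * (m / c) ^ b) :=
    (show Monotone fun y => c ^ a * y from fun _ _ h => mul_le_mul_right h _).map_min
  rw [hmin]
  congr 1
  · rw [← ENNReal.mul_rpow_of_nonneg _ _ ha, ENNReal.mul_div_cancel hc0 hct]
  · rw [ENNReal.div_rpow_of_nonneg _ _ hb, ENNReal.rpow_sub _ _ hc0 hct]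
    simp only [div_eq_mul_inv]
    ring

/-- Once c^a is absorbed into the minimum, c survives only in the factor c^(a-b), whose exponent is
nonpositive. This allows the measure of a test set to be replaced by any smaller b. -/
theorem antitone_rpow_mul_calderonSum {α : Type*} [MeasurableSpace α] {μ : Measure α} {a b : ℝ}
    (ha : 0 ≤ a) (hab : a ≤ b) (h : α → ℝ≥0∞) {c c' : ℝ≥0∞} (hc0 : c ≠ 0) (hcc : c ≤ c')
    (hct : c' ≠ ∞) : c' ^ a * calderonSum μ a b h c' ≤ c ^ a * calderonSum μ a b h c := by
  have hct' : c ≠ ∞ := ne_top_of_le_ne_top hct hcc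
  have hc0' : c' ≠ 0 := (lt_of_lt_of_le (pos_iff_ne_zero.2 hc0) hcc).ne'
  rw [calderonSum, calderonSum, ← lintegral_const_mul' _ _ (ENNReal.rpow_ne_top_of_nonneg ha hct),
    ← lintegral_const_mul' _ _ (ENNReal.rpow_ne_top_of_nonneg ha hct')]
  refine lintegral_mono fun l => ?_
  simp only
  rw [rpow_mul_min_div_rpow hc0 hct' ha (ha.trans hab),
    rpow_mul_min_div_rpow hc0' hct ha (ha.trans hab)]
  refine min_le_min le_rfl (mul_le_mul_right ?_ _)
  rw [← neg_sub b a, ENNReal.rpow_neg, ENNReal.rpow_neg]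
  exact ENNReal.inv_le_inv.2 (ENNReal.rpow_le_rpow hcc (by linarith))

/-- Split at distance R = |E| from s. Each side of the near part contributes at most R^(1-g)/(1-g).
On the far part the kernel is at most R^(-g), over a set of measure at most R. -/
theorem exists_setLIntegral_abs_sub_rpow_le {g : ℝ} (hg0 : 0 < g) (hg1 : g < 1) :
    ∃ C : ℝ≥0, ∀ (E : Set ℝ), MeasurableSet E → ∀ s : ℝ,
      ∫⁻ t in E, ENNReal.ofReal |t - s| ^ (-g) ≤ C * volume E ^ (1 - g) := by
  refine ⟨2 * (1 / (1 - g)).toNNReal + 1, fun E hE s => ?_⟩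
  rcases eq_or_ne (volume E) 0 with h0 | h0
  · rw [Measure.restrict_eq_zero.2 h0]; simp
  rcases eq_or_ne (volume E) ∞ with ht | ht
  · rw [ht, ENNReal.top_rpow_of_pos (by linarith), ENNReal.mul_top]
    · exact le_top
    · simp
  set R := (volume E).toReal
  have hR : 0 < R := ENNReal.toReal_pos h0 ht
  have hER : volume E = ENNReal.ofReal R := (ENNReal.ofReal_toReal ht).symm
  set f : ℝ → ℝ≥0∞ := (Ioo 0 R).indicator fun t => ENNReal.ofReal (t ^ (-g)) with hf
  have hfm : Measurable f := Measurable.indicator (by fun_prop) measurableSet_Ioo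
  have hfi : ∫⁻ t, f t = ENNReal.ofReal (1 / (1 - g)) * ENNReal.ofReal R ^ (1 - g) := by
    have h1 := lintegral_Ioo_rpow (show 0 < 1 - g by linarith) hR.le
    rw [hf, lintegral_indicator measurableSet_Ioo, ENNReal.ofReal_rpow_of_pos hR, ← h1,
      ← mul_assoc, ← ENNReal.ofReal_mul (by
        have : 0 < 1 - g := by linarith
        positivity), one_div_mul_cancel (by linarith), ENNReal.ofReal_one, one_mul]
    ring_nf
  have hpt : ∀ t, t ≠ s → ENNReal.ofReal |t - s| ^ (-g) ≤
      f (t - s) + f (s - t) + ENNReal.ofReal R ^ (-g) := by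
    intro t hts
    have habs : 0 < |t - s| := abs_pos.2 (sub_ne_zero.2 hts)
    rcases lt_or_ge |t - s| R with hlt | hge
    · refine le_trans ?_ le_self_add
      rw [ENNReal.ofReal_rpow_of_pos habs]
      rcases lt_or_gt_of_ne hts with h1 | h1
      · have h2 : s - t ∈ Ioo 0 R := ⟨by linarith, lt_of_le_of_lt (by
          rw [abs_sub_comm]; exact le_abs_self _) hlt⟩
        refine le_trans (le_of_eq ?_) (show f (s - t) ≤ f (t - s) + f (s - t) from le_add_self)
        rw [hf, indicator_of_mem h2, abs_sub_comm, abs_of_pos h2.1]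
      · have h2 : t - s ∈ Ioo 0 R := ⟨by linarith, lt_of_le_of_lt (le_abs_self _) hlt⟩
        refine le_trans (le_of_eq ?_) (le_self_add (a := f (t - s)))
        rw [hf, indicator_of_mem h2, abs_of_pos h2.1]
    · refine le_trans ?_ le_add_self
      rw [ENNReal.rpow_neg, ENNReal.rpow_neg]
      exact ENNReal.inv_le_inv.2 (ENNReal.rpow_le_rpow (ENNReal.ofReal_le_ofReal hge) hg0.le)
  calc ∫⁻ t in E, ENNReal.ofReal |t - s| ^ (-g)
      ≤ ∫⁻ t in E, (f (t - s) + f (s - t) + ENNReal.ofReal R ^ (-g)) := by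
        refine lintegral_mono_ae (ae_restrict_of_ae ?_)
        have : ∀ᵐ t : ℝ, t ≠ s := by simp [ae_iff]
        filter_upwards [this] with t ht using hpt t ht
    _ ≤ (∫⁻ t, f (t - s)) + (∫⁻ t, f (s - t)) + ENNReal.ofReal R ^ (-g) * volume E := by
        rw [lintegral_add_right _ measurable_const, lintegral_add_left (by fun_prop),
          setLIntegral_const]
        gcongr <;> exact Measure.restrict_le_self
    _ = _ := by
        rw [lintegral_sub_right_eq_self f, lintegral_sub_left_eq_self f, hfi, hER]
        have h3 : ENNReal.ofReal R ^ (-g) * ENNReal.ofReal R = ENNReal.ofReal R ^ (1 - g) := by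
          rw [mul_comm, ENNReal.self_mul_rpow (by simpa using hR) ENNReal.ofReal_ne_top]
          ring_nf
        rw [h3]
        have h4 : ENNReal.ofReal (1 / (1 - g)) = ((1 / (1 - g)).toNNReal : ℝ≥0∞) := rfl
        rw [h4]
        push_cast
        ring

/-- The **Hardy–Littlewood–Sobolev inequality** in Lorentz spaces. -/
theorem exists_lorentzNorm_rieszPotential_le {p : ℝ} (hp : 2 < p) {r : ℝ≥0∞} (hr : r ≠ 0) :
    ∃ C : ℝ≥0, ∀ J : Set ℝ, MeasurableSet J → ∀ N : ℝ → ℝ≥0∞, Measurable N →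
      lorentzNorm p r (volume.restrict J)
        (fun t => ∫⁻ s in J, ENNReal.ofReal |t - s| ^ (-(2 / p)) * N s) ≤
        C * lorentzNorm p.conjExponent r (volume.restrict J) N := by
  have hp0 : 0 < p := by linarith
  set g := 2 / p
  have hg0 : 0 < g := by positivity
  have hg1 : g < 1 := (div_lt_one hp0).2 hp
  have hip : 1 / p.conjExponent = 1 - 1 / p := by
    rw [Real.conjExponent]
    field_simp
  have hpc : 0 < p.conjExponent := div_pos hp0 (by linarith)
  obtain ⟨C₁, hC₁⟩ := exists_setLIntegral_abs_sub_rpow_le hg0 hg1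
  -- Here x = 1/p', and 1 - g < x < 1 because g = 2/p.
  obtain ⟨C₂, hC₂⟩ := exists_eLpNorm_calderonSum_le (a := 1 - g) (b := 1) (x := 1 - 1 / p)
    (by linarith) (by
      have : g = 2 * (1 / p) := by simp [g, div_eq_mul_inv]
      have h1 : 0 < 1 / p := by positivity
      linarith) (by
      have h1 : 0 < 1 / p := by positivity
      linarith) hr
  refine ⟨C₁ * C₂, fun J hJ N hN => ?_⟩
  set μ := (volume : Measure ℝ).restrict J with hμ
  have hK : Measurable fun z : ℝ × ℝ => ENNReal.ofReal |z.1 - z.2| ^ (-g) :=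
    (ENNReal.measurable_ofReal.comp (by fun_prop)).pow_const _
  have hker : ∀ E : Set ℝ, MeasurableSet E → ∀ s : ℝ,
      ∫⁻ t in E, ENNReal.ofReal |t - s| ^ (-g) ∂μ ≤ C₁ * μ E ^ (1 - g) := by
    intro E hE s
    rw [hμ, Measure.restrict_restrict hE, Measure.restrict_apply hE]
    exact hC₁ _ (hE.inter hJ) s
  set U : ℝ → ℝ≥0∞ := fun t => ∫⁻ s, ENNReal.ofReal |t - s| ^ (-g) * N s ∂μ with hU
  have hUm : Measurable U := (hK.mul (hN.comp measurable_snd)).lintegral_prod_right'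
  have key : ∀ b, 0 < b → rearr μ U (ENNReal.ofReal b) ≤ C₁ * (ENNReal.ofReal b ^ (1 - g) *
      calderonSum μ (1 - g) 1 N (ENNReal.ofReal b)) := by
    intro b hb
    refine le_of_forall_lt fun l hl => ?_
    obtain ⟨l', hl1, hl2⟩ := exists_between hl
    refine hl1.trans_le ?_
    -- A subset of {U > l'} of finite measure A, still larger than b. Integrating U over it bounds
    -- l' A from above.
    obtain ⟨E, hEm, hEs, hEb, hEt⟩ := Measure.exists_subset_measure_lt_top
      (measurableSet_lt measurable_const hUm) (lt_rearr_iff.1 hl2)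
    set A := μ E
    have hA0 : A ≠ 0 := (bot_lt_of_lt hEb).ne'
    have h1 : l' * A ≤ C₁ * (A ^ (2 - g) * calderonSum μ (1 - g) 1 N A) := by
      set w : ℝ → ℝ≥0∞ := fun s => ∫⁻ t in E, ENNReal.ofReal |t - s| ^ (-g) ∂μ with hw
      have hwm : Measurable w := by
        exact Measurable.lintegral_prod_left' (μ := μ.restrict E) hK
      calc l' * A ≤ ∫⁻ t in E, U t ∂μ := by
            rw [← setLIntegral_const]
            exact setLIntegral_mono hUm fun t ht => (show l' < U t from hEs ht).le
        _ = ∫⁻ s, N s * w s ∂μ := by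
            rw [hU, lintegral_lintegral_swap (hK.mul (hN.comp measurable_snd)).aemeasurable]
            refine lintegral_congr fun s => ?_
            rw [lintegral_mul_const _ (show Measurable fun t : ℝ => ENNReal.ofReal |t - s| ^ (-g) from
              hK.comp measurable_prodMk_right), mul_comm]
        _ = ∫⁻ l in Ioi (0 : ℝ), ∫⁻ s in {s | ENNReal.ofReal l < N s}, w s ∂μ :=
            lintegral_mul_eq_lintegral_lt hN hwm
        _ ≤ ∫⁻ l in Ioi (0 : ℝ), C₁ * (A ^ (2 - g) *
              min ((μ {s | ENNReal.ofReal l < N s} / A) ^ (1 - g))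
                ((μ {s | ENNReal.ofReal l < N s} / A) ^ (1 : ℝ))) := by
            refine lintegral_mono fun l => ?_
            set S := {s | ENNReal.ofReal l < N s}
            have hS : MeasurableSet S := measurableSet_lt measurable_const hN
            have e1 : A ^ (2 - g) = A * A ^ (1 - g) := by
              rw [ENNReal.self_mul_rpow hA0 hEt.ne]
              ring_nf
            have e2 : A ^ (2 - g) * min ((μ S / A) ^ (1 - g)) ((μ S / A) ^ (1 : ℝ)) =
                min (A * μ S ^ (1 - g)) (A ^ (1 - g) * μ S) := by
              rw [e1, mul_assoc, rpow_mul_min_div_rpow hA0 hEt.ne (by linarith) zero_le_one,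
                (show Monotone fun y => A * y from fun _ _ h => mul_le_mul_right h _).map_min]
              congr 1
              have e3 : A * A ^ (1 - g - 1) = A ^ (1 - g) := by
                rw [ENNReal.self_mul_rpow hA0 hEt.ne]
                ring_nf
              rw [ENNReal.rpow_one, ← e3]
              ring
            simp only
            rw [e2, (show Monotone fun y => (C₁ : ℝ≥0∞) * y from
              fun _ _ h => mul_le_mul_right h _).map_min]
            -- The double integral of the kernel over E × S is estimated in both orders: integrating
            -- over S first gives A · μ(S)^(1-g), integrating over E first gives A^(1-g) · μ(S).
            refine le_min ?_ ?_
            · calc ∫⁻ s in S, w s ∂μ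
                  = ∫⁻ t in E, ∫⁻ s in S, ENNReal.ofReal |t - s| ^ (-g) ∂μ ∂μ :=
                    (lintegral_lintegral_swap hK.aemeasurable).symm
                _ ≤ ∫⁻ t in E, C₁ * μ S ^ (1 - g) ∂μ := by
                    refine lintegral_mono fun t => ?_
                    simp only [abs_sub_comm t]
                    exact hker S hS t
                _ = _ := by
                    rw [setLIntegral_const]
                    ring
            · calc ∫⁻ s in S, w s ∂μ ≤ ∫⁻ s in S, C₁ * A ^ (1 - g) ∂μ :=
                    lintegral_mono fun s => hker E hEm s
                _ = _ := by
                    rw [setLIntegral_const]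
                    ring
        _ = _ := by
            rw [lintegral_const_mul' _ _ ENNReal.coe_ne_top, lintegral_const_mul' _ _
              (ENNReal.rpow_ne_top_of_nonneg (by linarith) hEt.ne)]
            rfl
    have h2 : l' ≤ C₁ * (A ^ (1 - g) * calderonSum μ (1 - g) 1 N A) := by
      refine (ENNReal.mul_le_mul_iff_left hA0 hEt.ne).1 (h1.trans (le_of_eq ?_))
      have e1 : A ^ (2 - g) = A ^ (1 - g) * A := by
        rw [mul_comm, ENNReal.self_mul_rpow hA0 hEt.ne]
        ring_nf
      rw [e1]
      ring
    refine h2.trans (mul_le_mul_right ?_ _)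
    exact antitone_rpow_mul_calderonSum (by linarith) (by linarith) N (by simpa using hb) hEb.le
      hEt.ne
  refine (lorentzNorm_le_of_rearr_le hp0 hr key).trans ?_
  rw [lorentzNorm_eq_eLpNorm_rearr hpc hr, hip]
  push_cast
  rw [mul_assoc]
  refine le_trans ?_ (mul_le_mul_right (hC₂ μ N) _)
  have hCm : Measurable fun c : ℝ => ENNReal.ofReal c ^ (1 - 1 / p) *
      calderonSum μ (1 - g) 1 N (ENNReal.ofReal c) := by
    have h1 : Measurable fun z : ℝ × ℝ => μ {x | ENNReal.ofReal z.2 < N x} / ENNReal.ofReal z.1 :=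
      (measurable_measure_lt.comp (ENNReal.measurable_ofReal.comp measurable_snd)).div
        (ENNReal.measurable_ofReal.comp measurable_fst)
    exact (ENNReal.measurable_ofReal.pow_const _).mul
      ((h1.pow_const _).min (h1.pow_const _)).lintegral_prod_right'
  rw [← eLpNorm_const_mul_ennreal hCm hr]
  refine eLpNorm_mono_enorm_ae ?_
  filter_upwards [ae_dilationMeasure_pos] with b hb
  simp only [enorm_eq_self]
  refine le_of_eq ?_
  -- The exponents match because g = 2/p.
  have : ENNReal.ofReal b ^ (1 - 1 / p) = ENNReal.ofReal b ^ (1 / p) *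
      ENNReal.ofReal b ^ (1 - g) := by
    rw [← ENNReal.rpow_add _ _ (by simpa using hb) ENNReal.ofReal_ne_top]
    congr 1
    simp only [g]
    ring
  rw [this]
  ring

end

/-! ### Interpolation between an L² and an L^∞ bound by layer cake -/

noncomputable section

/-- Layer-cake majorant of `∫ h w` when `‖w‖_2 ≤ x` and `‖w‖_∞ ≤ y`. -/
def layerBound {α : Type*} [MeasurableSpace α] (μ : Measure α) (h : α → ℝ≥0∞) (x y : ℝ≥0∞) :
    ℝ≥0∞ :=
  ∫⁻ l in Ioi (0 : ℝ), min (μ {z | ENNReal.ofReal l < h z} ^ (1 / 2 : ℝ) * x)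
    (μ {z | ENNReal.ofReal l < h z} * y)

section LayerBound

variable {α : Type*} [MeasurableSpace α] {μ : Measure α} {h : α → ℝ≥0∞}

/-- On each level set of h, Cauchy–Schwarz against the indicator gives the first entry of the
minimum and the sup bound gives the second. -/
theorem lintegral_mul_le_layerBound [SFinite μ] (hh : Measurable h) {w : α → ℝ≥0∞}
    (hw : Measurable w) {x y : ℝ≥0∞} (hx : (∫⁻ z, w z ^ (2 : ℝ) ∂μ) ^ (1 / 2 : ℝ) ≤ x)
    (hy : ∀ z, w z ≤ y) : ∫⁻ z, h z * w z ∂μ ≤ layerBound μ h x y := by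
  rw [lintegral_mul_eq_lintegral_lt hh hw]
  refine lintegral_mono fun l => le_min ?_ ?_
  · have h1 := ENNReal.lintegral_mul_le_Lp_mul_Lq
      (μ.restrict {z | ENNReal.ofReal l < h z}) Real.HolderConjugate.two_two
      (f := 1) (g := w) aemeasurable_one hw.aemeasurable
    simp only [Pi.mul_apply, Pi.one_apply, one_mul, ENNReal.one_rpow, lintegral_one,
      Measure.restrict_apply_univ] at h1
    refine h1.trans (mul_le_mul_right (le_trans ?_ hx) _)
    gcongr
    exact Measure.restrict_le_self
  · calc ∫⁻ z in {z | ENNReal.ofReal l < h z}, w z ∂μ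
        ≤ ∫⁻ z in {z | ENNReal.ofReal l < h z}, y ∂μ := lintegral_mono fun z => hy z
      _ = _ := by rw [setLIntegral_const, mul_comm]

theorem layerBound_mono {x x' y y' : ℝ≥0∞} (hx : x ≤ x') (hy : y ≤ y') :
    layerBound μ h x y ≤ layerBound μ h x' y' := by
  unfold layerBound
  gcongr

theorem layerBound_mul {c : ℝ≥0∞} (hc : c ≠ ∞) (x y : ℝ≥0∞) :
    layerBound μ h (c * x) (c * y) = c * layerBound μ h x y := by
  rw [layerBound, layerBound, ← lintegral_const_mul' _ _ hc]
  refine lintegral_congr fun l => ?_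
  rw [(show Monotone fun y => c * y from fun _ _ h => mul_le_mul_right h _).map_min]
  congr 1 <;> ring

/-- With c = 1/(D² a), the layer bound is D⁻¹ times the Calderón operator with exponents 1/2 and 1
at c. The substitution a ↦ c preserves da/a, and the powers of D collect to D^(1-2/q). The Calderón
bound applies because 1/2 < 1 - 1/q < 1, that is, q > 2. With D the dispersive constant, this is the
interpolated decay of the propagator. -/
theorem exists_eLpNorm_layerBound_le {q : ℝ} (hq : 2 < q) {r : ℝ≥0∞} (hr : r ≠ 0) :
    ∃ C : ℝ≥0, ∀ {α : Type*} [MeasurableSpace α] (μ : Measure α) (h : α → ℝ≥0∞) (D : ℝ), 0 < D →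
      eLpNorm (fun a : ℝ => ENNReal.ofReal a ^ (1 / q - 1) *
        layerBound μ h (ENNReal.ofReal a ^ (1 / 2 : ℝ)) (ENNReal.ofReal D * ENNReal.ofReal a)) r
        dilationMeasure ≤ C * (ENNReal.ofReal D ^ (1 - 2 / q) *
          lorentzNorm q.conjExponent r μ h) := by
  have hq0 : 0 < q := by linarith
  have hqi : 1 / q < 1 / 2 := one_div_lt_one_div_of_lt (by norm_num) hq
  have hqi0 : 0 < 1 / q := by positivity
  have hip : 1 / q.conjExponent = 1 - 1 / q := by
    rw [Real.conjExponent]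
    field_simp
  have hqc : 0 < q.conjExponent := div_pos hq0 (by linarith)
  obtain ⟨C, hC⟩ := exists_eLpNorm_calderonSum_le (a := 1 / 2) (b := 1) (x := 1 - 1 / q)
    (by norm_num) (by linarith) (by linarith) hr
  refine ⟨C, fun μ h D hD => ?_⟩
  rw [lorentzNorm_eq_eLpNorm_rearr hqc hr, hip, mul_left_comm]
  refine le_trans ?_ (mul_le_mul_right (hC μ h) _)
  set G : ℝ → ℝ≥0∞ := fun c => ENNReal.ofReal c ^ (1 - 1 / q) *
      calderonSum μ (1 / 2) 1 h (ENNReal.ofReal c) with hG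
  have hGm : Measurable G := by
    have h1 : Measurable fun z : ℝ × ℝ => μ {x | ENNReal.ofReal z.2 < h x} / ENNReal.ofReal z.1 :=
      (measurable_measure_lt.comp (ENNReal.measurable_ofReal.comp measurable_snd)).div
        (ENNReal.measurable_ofReal.comp measurable_fst)
    exact (ENNReal.measurable_ofReal.pow_const _).mul
      ((h1.pow_const _).min (h1.pow_const _)).lintegral_prod_right'
  have hmp := measurePreserving_inv_dilationMeasure.comp
    (measurePreserving_mul_dilationMeasure (show 0 < D ^ 2 by positivity))
  rw [← eLpNorm_comp_measurePreserving hGm.aestronglyMeasurable hmp,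
    ← eLpNorm_const_mul_ennreal (hGm.comp hmp.measurable) hr]
  refine eLpNorm_mono_enorm_ae ?_
  filter_upwards [ae_dilationMeasure_pos] with a ha
  simp only [enorm_eq_self, Function.comp_apply, hG]
  set A := ENNReal.ofReal a
  set E := ENNReal.ofReal D
  have hA0 : A ≠ 0 := by simpa [A] using ha
  have hAt : A ≠ ∞ := ENNReal.ofReal_ne_top
  have hE0 : E ≠ 0 := by simpa [E] using hD
  have hEt : E ≠ ∞ := ENNReal.ofReal_ne_top
  have hc : ENNReal.ofReal (D ^ 2 * a)⁻¹ = (E ^ (2 : ℝ) * A)⁻¹ := by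
    rw [ENNReal.ofReal_inv_of_pos (by positivity), ENNReal.ofReal_mul (by positivity),
      ENNReal.ofReal_pow hD.le]
    norm_cast
  rw [hc]
  have hcal : calderonSum μ (1 / 2) 1 h (E ^ (2 : ℝ) * A)⁻¹ =
      E * layerBound μ h (A ^ (1 / 2 : ℝ)) (E * A) := by
    rw [← layerBound_mul hEt]
    refine lintegral_congr fun l => ?_
    rw [div_eq_mul_inv, inv_inv]
    congr 1
    · rw [ENNReal.mul_rpow_of_nonneg _ _ (by norm_num), ENNReal.mul_rpow_of_nonneg _ _ (by norm_num),
        ← ENNReal.rpow_mul]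
      norm_num
    · rw [ENNReal.rpow_one, show (2 : ℝ) = 1 + 1 by norm_num, ENNReal.rpow_add _ _ hE0 hEt,
        ENNReal.rpow_one]
      ring
  rw [hcal, ENNReal.inv_rpow, ← ENNReal.rpow_neg, ENNReal.mul_rpow_of_ne_top
    (ENNReal.rpow_ne_top_of_nonneg (by norm_num) hEt) hAt, ← ENNReal.rpow_mul]
  refine le_of_eq ?_
  have h1 : E ^ (1 - 2 / q) * E ^ (2 * -(1 - 1 / q)) * E = 1 := by
    rw [mul_comm, ← ENNReal.rpow_add _ _ hE0 hEt, ENNReal.self_mul_rpow hE0 hEt]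
    convert ENNReal.rpow_zero using 2
    ring
  calc _ = A ^ (1 / q - 1) * layerBound μ h (A ^ (1 / 2 : ℝ)) (E * A) *
        (E ^ (1 - 2 / q) * E ^ (2 * -(1 - 1 / q)) * E) := by rw [h1, mul_one]
    _ = _ := by
      rw [neg_sub]
      ring

end LayerBound

end

/-! ### The Schrödinger flow on Schwartz functions and its dispersive decay -/

noncomputable section

open FourierTransform

/-- The free Schrödinger flow on Schwartz functions. -/
def schwartzFlow {d : ℕ} (τ : ℝ) (u : 𝓢(EuclideanSpace ℝ (Fin d), ℂ)) :
    𝓢(EuclideanSpace ℝ (Fin d), ℂ) :=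
  𝓕 (SchwartzMap.smulLeftCLM ℂ (schrodingerSymbol τ) (𝓕⁻ u))

section SchwartzFlow

variable {d : ℕ}

local notation "ℝᵈ" => EuclideanSpace ℝ (Fin d)

/-- The multiplier acts on distributions by transposition, which exchanges the roles of the Fourier
transform and its inverse. This is why `schwartzFlow` starts with the inverse transform; the symbol
being even, it is the same propagator. -/
theorem freeFlow_apply (τ : ℝ) (T : 𝓢'(ℝᵈ, ℂ)) (u : 𝓢(ℝᵈ, ℂ)) :
    freeFlow τ T u = T (schwartzFlow τ u) := rfl

theorem norm_schrodingerSymbol (τ : ℝ) (ξ : ℝᵈ) : ‖schrodingerSymbol τ ξ‖ = 1 := by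
  rw [schrodingerSymbol, mul_comm, Complex.norm_exp_ofReal_mul_I]

theorem schrodingerSymbol_add (s t : ℝ) :
    schrodingerSymbol (d := d) (s + t) = schrodingerSymbol s * schrodingerSymbol t := by
  funext ξ
  simp only [schrodingerSymbol, Pi.mul_apply, ← Complex.exp_add]
  congr 1
  push_cast
  ring

theorem schwartzFlow_add (s t : ℝ) (u : 𝓢(ℝᵈ, ℂ)) :
    schwartzFlow s (schwartzFlow t u) = schwartzFlow (s + t) u := by
  rw [schwartzFlow, schwartzFlow, fourierInv_fourier_eq, schwartzFlow,
    SchwartzMap.smulLeftCLM_smulLeftCLM_apply (schrodingerSymbol_hasTemperateGrowth s)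
      (schrodingerSymbol_hasTemperateGrowth t), schrodingerSymbol_add]

/-- Plancherel, applied twice, together with the symbol having modulus one. -/
theorem integral_inner_schwartzFlow (τ : ℝ) (u v : 𝓢(ℝᵈ, ℂ)) :
    ∫ x, inner ℂ (schwartzFlow τ u x) (schwartzFlow τ v x) = ∫ x, inner ℂ (u x) (v x) := by
  rw [schwartzFlow, schwartzFlow, SchwartzMap.integral_inner_fourier_fourier]
  have h := SchwartzMap.integral_inner_fourier_fourier (𝓕⁻ u) (𝓕⁻ v)
  rw [fourier_fourierInv_eq, fourier_fourierInv_eq] at h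
  rw [h]
  refine integral_congr_ae (Filter.Eventually.of_forall fun ξ => ?_)
  simp only [SchwartzMap.smulLeftCLM_apply_apply (schrodingerSymbol_hasTemperateGrowth τ),
    smul_eq_mul, RCLike.inner_apply, map_mul]
  have h1 := Complex.mul_conj (schrodingerSymbol τ ξ)
  rw [Complex.normSq_eq_norm_sq, norm_schrodingerSymbol] at h1
  calc _ = schrodingerSymbol τ ξ * (starRingEnd ℂ) (schrodingerSymbol τ ξ) *
        ((𝓕⁻ v) ξ * (starRingEnd ℂ) ((𝓕⁻ u) ξ)) := by ring
    _ = _ := by rw [h1]; simp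

theorem integral_conj_schwartzFlow_mul (s t : ℝ) (u v : 𝓢(ℝᵈ, ℂ)) :
    ∫ x, starRingEnd ℂ (schwartzFlow t u x) * schwartzFlow s v x =
      ∫ x, starRingEnd ℂ (schwartzFlow (t - s) u x) * v x := by
  have h := integral_inner_schwartzFlow s (schwartzFlow (t - s) u) v
  rw [schwartzFlow_add, add_sub_cancel] at h
  simpa [RCLike.inner_apply, mul_comm] using h

theorem eLpNorm_schwartzFlow_two (τ : ℝ) (u : 𝓢(ℝᵈ, ℂ)) :
    eLpNorm (schwartzFlow τ u) 2 volume = eLpNorm u 2 volume := by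
  have h := integral_inner_schwartzFlow τ u u
  replace h := (SchwartzMap.inner_toL2_toL2_eq (schwartzFlow τ u) (schwartzFlow τ u) volume).trans
    (h.trans (SchwartzMap.inner_toL2_toL2_eq u u volume).symm)
  rw [inner_self_eq_norm_sq_to_K, inner_self_eq_norm_sq_to_K] at h
  have h1 : ‖(schwartzFlow τ u).toLp 2‖ ^ 2 = ‖u.toLp 2‖ ^ 2 := by exact_mod_cast h
  have h2 : ‖(schwartzFlow τ u).toLp 2‖ = ‖u.toLp 2‖ :=
    (pow_left_inj₀ (norm_nonneg _) (norm_nonneg _) two_ne_zero).1 h1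
  rw [SchwartzMap.norm_toLp, SchwartzMap.norm_toLp] at h2
  have h3 : eLpNorm (schwartzFlow τ u) 2 volume ≠ ∞ := ((schwartzFlow τ u).eLpNorm_lt_top 2 volume).ne
  have h4 : eLpNorm u 2 volume ≠ ∞ := (u.eLpNorm_lt_top 2 volume).ne
  exact (ENNReal.toReal_eq_toReal_iff' h3 h4).1 h2

theorem schwartzFlow_apply (τ : ℝ) (u : 𝓢(ℝᵈ, ℂ)) (x : ℝᵈ) :
    schwartzFlow τ u x = ∫ ξ, Real.fourierChar (-inner ℝ ξ x) •
      (schrodingerSymbol τ ξ * (𝓕⁻ u) ξ) := by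
  rw [schwartzFlow, SchwartzMap.fourier_coe, Real.fourier_eq]
  refine integral_congr_ae (Filter.Eventually.of_forall fun ξ => ?_)
  simp only [SchwartzMap.smulLeftCLM_apply_apply (schrodingerSymbol_hasTemperateGrowth τ),
    smul_eq_mul]

theorem continuous_schrodingerSymbol :
    Continuous fun z : ℝ × ℝᵈ => schrodingerSymbol z.1 z.2 := by
  unfold schrodingerSymbol
  fun_prop

theorem continuous_schwartzFlow (u : 𝓢(ℝᵈ, ℂ)) :
    Continuous fun z : ℝ × ℝᵈ => schwartzFlow z.1 u z.2 := by
  simp only [schwartzFlow_apply]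
  have hc : ∀ ξ : ℝᵈ, Continuous fun z : ℝ × ℝᵈ => Real.fourierChar (-inner ℝ ξ z.2) •
      (schrodingerSymbol z.1 ξ * (𝓕⁻ u) ξ) := by
    intro ξ
    have h1 : Continuous fun z : ℝ × ℝᵈ => schrodingerSymbol z.1 ξ :=
      continuous_schrodingerSymbol.comp (by fun_prop : Continuous fun z : ℝ × ℝᵈ => (z.1, ξ))
    have h2 : Continuous fun z : ℝ × ℝᵈ => Real.fourierChar (-inner ℝ ξ z.2) := by fun_prop
    exact h2.smul (h1.mul continuous_const)
  refine continuous_of_dominated (bound := fun ξ => ‖(𝓕⁻ u) ξ‖) (fun z => ?_) (fun z => ?_)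
    (𝓕⁻ u).integrable.norm (Filter.Eventually.of_forall hc)
  · refine Continuous.aestronglyMeasurable ?_
    have h1 : Continuous fun ξ : ℝᵈ => schrodingerSymbol z.1 ξ :=
      continuous_schrodingerSymbol.comp (by fun_prop : Continuous fun ξ : ℝᵈ => (z.1, ξ))
    have h2 : Continuous fun ξ : ℝᵈ => Real.fourierChar (-inner ℝ ξ z.2) := by fun_prop
    exact h2.smul (h1.mul (𝓕⁻ u).continuous)
  · refine Filter.Eventually.of_forall fun ξ => ?_
    rw [Circle.norm_smul, norm_mul, norm_schrodingerSymbol, one_mul]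

/-- The Gaussian with complex parameter b = ε + 4π²τ i transforms to (π/b)^(d/2) times an
exponential of modulus at most 1, since Re(1/b) ≥ 0. The bound |b| ≥ 4π²|τ| is uniform in ε. -/
theorem norm_fourier_gaussian_le {τ : ℝ} (hτ : τ ≠ 0) {ε : ℝ} (hε : 0 < ε) (x w : ℝᵈ) :
    ‖𝓕 (fun v : ℝᵈ => Complex.exp (-((ε : ℂ) + (4 * Real.pi ^ 2 * τ : ℝ) * Complex.I) * ‖v‖ ^ 2 +
      2 * Real.pi * Complex.I * (inner ℝ x v : ℝ))) w‖ ≤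
      (4 * Real.pi * |τ|) ^ (-(d / 2 : ℝ)) := by
  set b : ℂ := (ε : ℂ) + (4 * Real.pi ^ 2 * τ : ℝ) * Complex.I with hb
  have hbre : b.re = ε := by
    rw [hb, Complex.add_re, Complex.ofReal_re, Complex.re_ofReal_mul, Complex.I_re, mul_zero, add_zero]
  have hbim : b.im = 4 * Real.pi ^ 2 * τ := by
    rw [hb, Complex.add_im, Complex.ofReal_im, Complex.im_ofReal_mul, Complex.I_im, mul_one, zero_add]
  have hbpos : 0 < b.re := by rw [hbre]; exact hε
  have hb0 : b ≠ 0 := fun h => by rw [h] at hbpos; simp at hbpos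
  rw [fourier_gaussian_innerProductSpace' hbpos, norm_mul]
  have h1 : ‖((Real.pi : ℂ) / b) ^ (Module.finrank ℝ ℝᵈ / 2 : ℂ)‖ = (Real.pi / ‖b‖) ^ (d / 2 : ℝ) := by
    have : (Module.finrank ℝ ℝᵈ / 2 : ℂ) = ((d / 2 : ℝ) : ℂ) := by simp
    rw [this, Complex.norm_cpow_real, norm_div, Complex.norm_real, Real.norm_of_nonneg Real.pi_pos.le]
  have h2 : ‖Complex.exp (-(Real.pi : ℂ) ^ 2 * ‖x - w‖ ^ 2 / b)‖ ≤ 1 := by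
    rw [Complex.norm_exp, Real.exp_le_one_iff]
    have : (-(Real.pi : ℂ) ^ 2 * ‖x - w‖ ^ 2 / b) =
        ((-(Real.pi ^ 2 * ‖x - w‖ ^ 2) : ℝ) : ℂ) * b⁻¹ := by
      push_cast
      ring
    rw [this, Complex.re_ofReal_mul, Complex.inv_re]
    have h3 : 0 ≤ b.re / Complex.normSq b := div_nonneg hbpos.le (Complex.normSq_nonneg _)
    have h4 : 0 ≤ Real.pi ^ 2 * ‖x - w‖ ^ 2 := by positivity
    nlinarith
  have h3 : 4 * Real.pi ^ 2 * |τ| ≤ ‖b‖ := by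
    have := Complex.abs_im_le_norm b
    rwa [hbim, abs_mul, abs_of_pos (by positivity)] at this
  have hτ' : 0 < |τ| := abs_pos.2 hτ
  rw [h1]
  calc _ ≤ (Real.pi / ‖b‖) ^ (d / 2 : ℝ) * 1 := by gcongr
    _ ≤ (Real.pi / (4 * Real.pi ^ 2 * |τ|)) ^ (d / 2 : ℝ) := by
        rw [mul_one]
        gcongr
    _ = _ := by
        rw [Real.rpow_neg (by positivity), ← Real.inv_rpow (by positivity)]
        congr 1
        field_simp

/-- The dispersive estimate. -/
theorem norm_schwartzFlow_le {τ : ℝ} (hτ : τ ≠ 0) (u : 𝓢(ℝᵈ, ℂ)) (x : ℝᵈ) :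
    ‖schwartzFlow τ u x‖ ≤ (4 * Real.pi * |τ|) ^ (-(d / 2 : ℝ)) * ∫ y, ‖u y‖ := by
  -- The oscillating factor in the Fourier representation of the flow at x, damped by exp(-ε|v|²).
  -- Damping makes it integrable, so the Fourier transform can be moved from u onto it; then ε → 0
  -- by dominated convergence.
  set k : ℝ → ℝᵈ → ℂ := fun ε v => Complex.exp (-((ε : ℂ) + (4 * Real.pi ^ 2 * τ : ℝ) *
    Complex.I) * ‖v‖ ^ 2 + 2 * Real.pi * Complex.I * (inner ℝ x v : ℝ)) with hk
  have hkint : ∀ ε, 0 < ε → Integrable (k ε) := by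
    intro ε hε
    have := GaussianFourier.integrable_cexp_neg_mul_sq_norm_add (V := ℝᵈ)
      (b := (ε : ℂ) + (4 * Real.pi ^ 2 * τ : ℝ) * Complex.I) (by
        rw [Complex.add_re, Complex.ofReal_re, Complex.re_ofReal_mul, Complex.I_re, mul_zero, add_zero]
        exact hε)
      (2 * Real.pi * Complex.I) x
    exact this
  have hknorm : ∀ ε, 0 ≤ ε → ∀ v, ‖k ε v‖ ≤ 1 := by
    intro ε hε v
    rw [hk, Complex.norm_exp, Real.exp_le_one_iff]
    have : (-((ε : ℂ) + (4 * Real.pi ^ 2 * τ : ℝ) * Complex.I) * ‖v‖ ^ 2 +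
        2 * Real.pi * Complex.I * (inner ℝ x v : ℝ)) = ((-(ε * ‖v‖ ^ 2) : ℝ) : ℂ) +
        ((-(4 * Real.pi ^ 2 * τ * ‖v‖ ^ 2) + 2 * Real.pi * inner ℝ x v : ℝ) : ℂ) * Complex.I := by
      push_cast
      ring
    rw [this]
    simp only [Complex.add_re, Complex.ofReal_re, Complex.re_ofReal_mul, Complex.I_re, mul_zero,
      add_zero, neg_nonpos]
    positivity
  have hbound : ∀ ε, 0 < ε → ‖∫ v, (𝓕 u) v * k ε v‖ ≤
      (4 * Real.pi * |τ|) ^ (-(d / 2 : ℝ)) * ∫ y, ‖u y‖ := by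
    intro ε hε
    have h1 : ∫ v, (𝓕 u) v * k ε v = ∫ y, u y * 𝓕 (k ε) y := by
      have := VectorFourier.integral_bilin_fourierIntegral_eq_flip (ContinuousLinearMap.mul ℂ ℂ)
        (L := innerₗ ℝᵈ) (μ := volume) (ν := volume) Real.continuous_fourierChar continuous_inner
        u.integrable (hkint ε hε)
      simpa using! this
    rw [h1]
    refine (norm_integral_le_integral_norm _).trans ?_
    rw [← integral_const_mul]
    refine integral_mono_of_nonneg (Filter.Eventually.of_forall fun y => norm_nonneg _)
      (u.integrable.norm.const_mul _) (Filter.Eventually.of_forall fun y => ?_)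
    simp only [norm_mul]
    rw [mul_comm]
    gcongr
    exact norm_fourier_gaussian_le hτ hε x y
  have hlim : Filter.Tendsto (fun ε : ℝ => ∫ v, (𝓕 u) v * k ε v) (nhdsWithin 0 (Ioi 0))
      (nhds (∫ v, (𝓕 u) v * k 0 v)) := by
    refine tendsto_integral_filter_of_dominated_convergence (fun v => ‖(𝓕 u) v‖) ?_ ?_
      (𝓕 u).integrable.norm ?_
    · refine Filter.Eventually.of_forall fun ε => Continuous.aestronglyMeasurable ?_
      have : Continuous (k ε) := by
        simp only [hk]
        fun_prop
      exact (𝓕 u).continuous.mul this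
    · filter_upwards [self_mem_nhdsWithin] with ε hε
      refine Filter.Eventually.of_forall fun v => ?_
      rw [norm_mul]
      exact mul_le_of_le_one_right (norm_nonneg _) (hknorm ε (le_of_lt hε) v)
    · refine Filter.Eventually.of_forall fun v => ?_
      have : Continuous fun ε => (𝓕 u) v * k ε v := by
        simp only [hk]
        fun_prop
      exact (this.tendsto 0).mono_left nhdsWithin_le_nhds
  have heq : schwartzFlow τ u x = ∫ v, (𝓕 u) v * k 0 v := by
    -- The reflection ξ ↦ -ξ turns the inverse transform of u into the transform and leaves the
    -- symbol unchanged.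
    rw [schwartzFlow_apply, ← integral_neg_eq_self]
    refine integral_congr_ae (Filter.Eventually.of_forall fun v => ?_)
    simp only [SchwartzMap.fourierInv_apply_eq, SchwartzMap.compCLMOfContinuousLinearEquiv_apply]
    simp only [Function.comp_apply, hk, schrodingerSymbol]
    simp only [Circle.smul_def, smul_eq_mul, Real.fourierChar_apply, inner_neg_left, neg_neg,
      norm_neg]
    simp
    rw [← mul_assoc, ← Complex.exp_add, mul_comm, real_inner_comm]
    congr 2
    ring
  rw [heq]
  exact le_of_tendsto hlim.norm (by filter_upwards [self_mem_nhdsWithin] with ε hε using hbound ε hε)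

end SchwartzFlow

end

/-! ### Functions determined by their pairings with Schwartz functions -/

noncomputable section

theorem lintegral_enorm_mul_le {α F : Type*} [MeasurableSpace α] {μ : Measure α}
    [NormedAddCommGroup F] {f g : α → F} (hf : AEStronglyMeasurable f μ)
    (hg : AEStronglyMeasurable g μ) :
    ∫⁻ x, ‖f x‖ₑ * ‖g x‖ₑ ∂μ ≤ eLpNorm f 2 μ * eLpNorm g 2 μ := by
  have h := ENNReal.lintegral_mul_le_Lp_mul_Lq μ Real.HolderConjugate.two_two hf.enorm hg.enorm
  simpa [eLpNorm_eq_lintegral_rpow_enorm_toReal] using h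

theorem integrable_mul_of_memLp_two {α : Type*} [MeasurableSpace α] {μ : Measure α}
    {f g : α → ℂ} (hf : MemLp f 2 μ) (hg : MemLp g 2 μ) : Integrable (fun x => f x * g x) μ := by
  refine ⟨hf.1.mul hg.1, ?_⟩
  rw [hasFiniteIntegral_iff_enorm]
  simp only [enorm_mul]
  exact (lintegral_enorm_mul_le hf.1 hg.1).trans_lt (ENNReal.mul_lt_top hf.2 hg.2)

/-- A square-integrable weight, bounded by `1`, with temperate inverse. -/
def decayWeight {d : ℕ} (x : EuclideanSpace ℝ (Fin d)) : ℝ :=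
  (1 + ‖x‖ ^ 2) ^ (-((d : ℝ) + 1) / 4)

/-- The inverse of `decayWeight`. -/
def growWeight {d : ℕ} (x : EuclideanSpace ℝ (Fin d)) : ℝ :=
  (1 + ‖x‖ ^ 2) ^ (((d : ℝ) + 1) / 4)

/-- Square-integrability with respect to the weight `decayWeight`. -/
def WeightedMemL2 {d : ℕ} (v : EuclideanSpace ℝ (Fin d) → ℂ) : Prop :=
  MemLp (fun x => (decayWeight x : ℂ) * v x) 2 volume

section Weight

variable {d : ℕ}

local notation "ℝᵈ" => EuclideanSpace ℝ (Fin d)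

theorem growWeight_mul_decayWeight (x : ℝᵈ) : growWeight x * decayWeight x = 1 := by
  rw [growWeight, decayWeight, ← Real.rpow_add (by positivity)]
  ring_nf
  simp

theorem decayWeight_mul_growWeight (x : ℝᵈ) : (decayWeight x : ℂ) * growWeight x = 1 := by
  rw [mul_comm]
  exact_mod_cast growWeight_mul_decayWeight x

theorem decayWeight_pos (x : ℝᵈ) : 0 < decayWeight x := by
  unfold decayWeight
  positivity

theorem growWeight_pos (x : ℝᵈ) : 0 < growWeight x := by
  unfold growWeight
  positivity

theorem decayWeight_le_one (x : ℝᵈ) : decayWeight x ≤ 1 := by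
  refine Real.rpow_le_one_of_one_le_of_nonpos ?_ ?_
  · nlinarith [sq_nonneg ‖x‖]
  · have : (0 : ℝ) ≤ d := by positivity
    linarith

theorem hasTemperateGrowth_decayWeight :
    (fun x : ℝᵈ => (decayWeight x : ℂ)).HasTemperateGrowth :=
  (Function.HasTemperateGrowth.comp (g := fun y : ℝ => (y : ℂ)) (Function.Complex.hasTemperateGrowth_ofReal) <| Function.hasTemperateGrowth_one_add_norm_sq_rpow ℝᵈ _)

theorem hasTemperateGrowth_growWeight :
    (fun x : ℝᵈ => (growWeight x : ℂ)).HasTemperateGrowth :=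
  (Function.HasTemperateGrowth.comp (g := fun y : ℝ => (y : ℂ)) (Function.Complex.hasTemperateGrowth_ofReal) <| Function.hasTemperateGrowth_one_add_norm_sq_rpow ℝᵈ _)

theorem continuous_decayWeight : Continuous fun x : ℝᵈ => (decayWeight x : ℂ) :=
  hasTemperateGrowth_decayWeight.1.continuous

theorem continuous_growWeight : Continuous fun x : ℝᵈ => (growWeight x : ℂ) :=
  hasTemperateGrowth_growWeight.1.continuous

/-- The squared weight is (1 + |x|²)^(-(d+1)/2), integrable since d + 1 > d. -/
theorem memLp_decayWeight : MemLp (fun x : ℝᵈ => (decayWeight x : ℂ)) 2 volume := by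
  rw [memLp_two_iff_integrable_sq_norm continuous_decayWeight.aestronglyMeasurable]
  have h := integrable_rpow_neg_one_add_norm_sq (E := ℝᵈ) (μ := volume) (r := (d : ℝ) + 1)
    (by simp)
  refine h.congr (Filter.Eventually.of_forall fun x => ?_)
  simp only
  rw [Complex.norm_real, Real.norm_of_nonneg (decayWeight_pos x).le, decayWeight,
    ← Real.rpow_mul_natCast (by positivity)]
  congr 1
  push_cast
  ring

/-- Multiplication of Schwartz functions by `decayWeight`. -/
def decayMul : 𝓢(ℝᵈ, ℂ) →L[ℂ] 𝓢(ℝᵈ, ℂ) :=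
  SchwartzMap.smulLeftCLM ℂ fun x : ℝᵈ => (decayWeight x : ℂ)

/-- Multiplication of Schwartz functions by `growWeight`. -/
def growMul : 𝓢(ℝᵈ, ℂ) →L[ℂ] 𝓢(ℝᵈ, ℂ) :=
  SchwartzMap.smulLeftCLM ℂ fun x : ℝᵈ => (growWeight x : ℂ)

theorem decayMul_apply (g : 𝓢(ℝᵈ, ℂ)) (x : ℝᵈ) : decayMul g x = decayWeight x * g x := by
  rw [decayMul, SchwartzMap.smulLeftCLM_apply_apply hasTemperateGrowth_decayWeight, smul_eq_mul]

theorem growMul_apply (g : 𝓢(ℝᵈ, ℂ)) (x : ℝᵈ) : growMul g x = growWeight x * g x := by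
  rw [growMul, SchwartzMap.smulLeftCLM_apply_apply hasTemperateGrowth_growWeight, smul_eq_mul]

theorem decayMul_growMul (g : 𝓢(ℝᵈ, ℂ)) : decayMul (growMul g) = g := by
  ext x
  rw [decayMul_apply, growMul_apply, ← mul_assoc, decayWeight_mul_growWeight, one_mul]

variable {v : EuclideanSpace ℝ (Fin d) → ℂ}

theorem growMul_mul_decayWeight_mul (g : 𝓢(ℝᵈ, ℂ)) (x : ℝᵈ) :
    growMul g x * (decayWeight x * v x) = g x * v x := by
  rw [growMul_apply]
  linear_combination (g x * v x) * decayWeight_mul_growWeight x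

theorem WeightedMemL2.integrable_mul (hv : WeightedMemL2 v) (g : 𝓢(ℝᵈ, ℂ)) :
    Integrable fun x => g x * v x := by
  refine (integrable_mul_of_memLp_two ((growMul g).memLp 2 volume) hv).congr
    (Filter.Eventually.of_forall fun x => growMul_mul_decayWeight_mul g x)

theorem WeightedMemL2.locallyIntegrable (hv : WeightedMemL2 v) : LocallyIntegrable v := by
  have h1 : LocallyIntegrable (fun x => (decayWeight x : ℂ) * v x) volume :=
    MemLp.locallyIntegrable hv (by norm_num)
  have h2 := h1.continuous_mul continuous_growWeight
  refine h2.congr (Filter.Eventually.of_forall fun x => ?_)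
  simp only
  linear_combination v x * decayWeight_mul_growWeight x

theorem WeightedMemL2.congr_ae {v' : ℝᵈ → ℂ} (hv : WeightedMemL2 v) (h : v =ᵐ[volume] v') :
    WeightedMemL2 v' := by
  refine (memLp_congr_ae ?_).1 hv
  filter_upwards [h] with x hx
  rw [hx]

theorem MeasureTheory.MemLp.weightedMemL2 (hv : MemLp v 2 volume) : WeightedMemL2 v := by
  refine MemLp.mono hv (continuous_decayWeight.aestronglyMeasurable.mul hv.1)
    (Filter.Eventually.of_forall fun x => ?_)
  rw [norm_mul, Complex.norm_real, Real.norm_of_nonneg (decayWeight_pos x).le]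
  exact mul_le_of_le_one_left (norm_nonneg _) (decayWeight_le_one x)

theorem eLpNorm_decayWeight_mul_two_le (h : ℝᵈ → ℂ) :
    eLpNorm (fun x => (decayWeight x : ℂ) * h x) 2 volume ≤ eLpNorm h 2 volume := by
  refine eLpNorm_mono fun x => ?_
  rw [norm_mul, Complex.norm_real, Real.norm_of_nonneg (decayWeight_pos x).le]
  exact mul_le_of_le_one_left (norm_nonneg _) (decayWeight_le_one x)

theorem eLpNorm_decayWeight_mul_one_le {h : ℝᵈ → ℂ} (hh : AEStronglyMeasurable h volume) :
    eLpNorm (fun x => (decayWeight x : ℂ) * h x) 1 volume ≤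
      eLpNorm (fun x : ℝᵈ => (decayWeight x : ℂ)) 2 volume * eLpNorm h 2 volume := by
  rw [eLpNorm_one_eq_lintegral_enorm]
  simp only [enorm_mul]
  exact lintegral_enorm_mul_le continuous_decayWeight.aestronglyMeasurable hh

/-- A functional on Schwartz functions dominated by the `L²` norm is a square-integrable
function. -/
theorem exists_memLp_two_of_bound (S : 𝓢(ℝᵈ, ℂ) →ₗ[ℂ] ℂ) {K : ℝ≥0∞} (hK : K ≠ ∞)
    (hS : ∀ g : 𝓢(ℝᵈ, ℂ), ‖S g‖ₑ ≤ K * eLpNorm g 2 volume) :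
    ∃ y : ℝᵈ → ℂ, MemLp y 2 volume ∧ ∀ g : 𝓢(ℝᵈ, ℂ), S g = ∫ x, g x * y x := by
  set e : 𝓢(ℝᵈ, ℂ) →ₗ[ℂ] Lp ℂ 2 (volume : Measure ℝᵈ) :=
    (SchwartzMap.toLpCLM ℂ ℂ 2 (volume : Measure ℝᵈ)).toLinearMap with he
  have hdense : DenseRange e := SchwartzMap.denseRange_toLpCLM (by simp)
  have hbound : ∀ g, ‖S g‖ ≤ K.toReal * ‖e g‖ := by
    intro g
    have h3 : ‖e g‖ = (eLpNorm g 2 volume).toReal := SchwartzMap.norm_toLp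
    have h4 : eLpNorm g 2 (volume : Measure ℝᵈ) ≠ ∞ := (g.eLpNorm_lt_top 2 volume).ne
    rw [h3, ← ENNReal.toReal_mul, ← toReal_enorm]
    exact ENNReal.toReal_mono (ENNReal.mul_ne_top hK h4) (hS g)
  set S' := S.extendOfNorm e
  have hS' : ∀ g, S' (e g) = S g := LinearMap.extendOfNorm_eq hdense ⟨_, hbound⟩
  set y := (InnerProductSpace.toDual ℂ (Lp ℂ 2 (volume : Measure ℝᵈ))).symm S'
  refine ⟨fun x => starRingEnd ℂ (y x), (Lp.memLp y).star, fun g => ?_⟩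
  rw [← hS', ← InnerProductSpace.toDual_symm_apply (𝕜 := ℂ), L2.inner_def]
  refine integral_congr_ae ?_
  filter_upwards [g.coeFn_toLp 2 volume] with x hx
  change inner ℂ (y x) (g.toLp 2 volume x) = _
  rw [hx, RCLike.inner_apply]

/-- A functional on Schwartz functions dominated by the `L¹` and `L²` norms is a function. -/
theorem exists_weightedMemL2_of_bound (T : 𝓢(ℝᵈ, ℂ) →ₗ[ℂ] ℂ) {M : ℝ≥0∞} (hM : M ≠ ∞)
    (hT : ∀ g : 𝓢(ℝᵈ, ℂ), ‖T g‖ₑ ≤ M * (eLpNorm g 2 volume + eLpNorm g 1 volume)) :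
    ∃ v : ℝᵈ → ℂ, WeightedMemL2 v ∧ ∀ g : 𝓢(ℝᵈ, ℂ), T g = ∫ x, g x * v x := by
  -- Multiplying by the weight turns the L¹ bound into an L² bound: Cauchy–Schwarz gives ‖wg‖₁ ≤
  -- ‖w‖₂ ‖g‖₂. So g ↦ T(wg) is bounded on L² with constant K, and the function representing it is
  -- divided by w at the end.
  set K : ℝ≥0∞ := M * (1 + eLpNorm (fun x : ℝᵈ => (decayWeight x : ℂ)) 2 volume)
  have hK : K ≠ ∞ := ENNReal.mul_ne_top hM
    (ENNReal.add_ne_top.2 ⟨ENNReal.one_ne_top, memLp_decayWeight.2.ne⟩)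
  obtain ⟨y, hy, hTy⟩ := exists_memLp_two_of_bound (T ∘ₗ decayMul.toLinearMap) hK fun g => by
    refine (hT (decayMul g)).trans ?_
    have h2 : (decayMul g : ℝᵈ → ℂ) = fun x => (decayWeight x : ℂ) * g x :=
      funext (decayMul_apply g)
    rw [h2, mul_assoc, add_mul, one_mul]
    gcongr
    · exact eLpNorm_decayWeight_mul_two_le g
    · exact eLpNorm_decayWeight_mul_one_le g.continuous.aestronglyMeasurable
  refine ⟨fun x => growWeight x * y x, ?_, fun g => ?_⟩
  · refine (memLp_congr_ae (Filter.Eventually.of_forall fun x => ?_)).1 hy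
    simp only
    rw [← mul_assoc, decayWeight_mul_growWeight, one_mul]
  · have h1 : T g = (T ∘ₗ decayMul.toLinearMap) (growMul g) := by simp [decayMul_growMul]
    rw [h1, hTy]
    refine integral_congr_ae (Filter.Eventually.of_forall fun x => ?_)
    simp only [growMul_apply]
    ring

/-- Test functions detecting the mass of a weighted square-integrable function. -/
theorem WeightedMemL2.exists_schwartz_test (hv : WeightedMemL2 v) {A : Set ℝᵈ}
    (hA : MeasurableSet A) (hAb : Bornology.IsBounded A) (hA0 : volume A ≠ 0) :
    ∃ g : 𝓢(ℝᵈ, ℂ), eLpNorm g 2 volume ≤ 2 * volume A ^ (1 / 2 : ℝ) ∧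
      eLpNorm g 1 volume ≤ 2 * volume A ∧ ∫⁻ x in A, ‖v x‖ₑ ≤ 2 * ‖∫ x, g x * v x‖ₑ := by
  have hAt : volume A ≠ ∞ := hAb.measure_lt_top.ne
  have hAint : ∫⁻ x in A, ‖v x‖ₑ ≠ ∞ := by
    have h1 := hv.locallyIntegrable.integrableOn_isCompact (Metric.isCompact_of_isClosed_isBounded
      isClosed_closure hAb.closure)
    exact (h1.mono_set subset_closure).2.ne
  rcases eq_or_ne (∫⁻ x in A, ‖v x‖ₑ) 0 with h0 | h0
  · refine ⟨0, ?_, ?_, by rw [h0]; exact zero_le⟩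
    · have : ((0 : 𝓢(ℝᵈ, ℂ)) : ℝᵈ → ℂ) = 0 := rfl
      rw [this, eLpNorm_zero]
      exact zero_le
    · have : ((0 : 𝓢(ℝᵈ, ℂ)) : ℝᵈ → ℂ) = 0 := rfl
      rw [this, eLpNorm_zero]
      exact zero_le
  set I := ∫⁻ x in A, ‖v x‖ₑ with hI
  have hvm : AEStronglyMeasurable v volume := hv.locallyIntegrable.aestronglyMeasurable
  -- The ideal test function: its pairing with v is exactly the mass of v on A. It has to be
  -- approximated by a Schwartz function.
  set sg : ℝᵈ → ℂ := A.indicator fun x => starRingEnd ℂ (v x) / ‖v x‖ with hsg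
  have hsgm : AEStronglyMeasurable sg volume := by
    refine AEStronglyMeasurable.indicator ?_ hA
    have h1 : AEMeasurable v volume := hvm.aemeasurable
    refine AEMeasurable.aestronglyMeasurable ?_
    exact (Complex.continuous_conj.measurable.comp_aemeasurable h1).div
      (Complex.measurable_ofReal.comp_aemeasurable h1.norm)
  have hsg1 : ∀ x, ‖sg x‖ₑ ≤ A.indicator 1 x := by
    intro x
    by_cases hx : x ∈ A
    · rw [hsg, indicator_of_mem hx, indicator_of_mem hx, Pi.one_apply, ← ofReal_norm,
        ← ENNReal.ofReal_one]
      refine ENNReal.ofReal_le_ofReal ?_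
      rw [norm_div, RCLike.norm_conj, Complex.norm_real, norm_norm]
      exact div_self_le_one _
    · rw [hsg, indicator_of_notMem hx]
      simp
  have hsgv : ∀ x, sg x * v x = A.indicator (fun x => (‖v x‖ : ℂ)) x := by
    intro x
    by_cases hx : x ∈ A
    · rw [hsg, indicator_of_mem hx, indicator_of_mem hx, div_mul_eq_mul_div, Complex.conj_mul']
      rcases eq_or_ne (‖v x‖ : ℂ) 0 with h | h
      · simp [h]
      · field_simp
    · rw [hsg, indicator_of_notMem hx, indicator_of_notMem hx, zero_mul]
  have hsg2 : eLpNorm sg 2 volume ≤ volume A ^ (1 / 2 : ℝ) := by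
    have h1 : eLpNorm sg 2 volume ≤ eLpNorm (A.indicator fun _ => (1 : ℝ)) 2 volume := by
      refine eLpNorm_mono_enorm fun x => (hsg1 x).trans ?_
      rw [enorm_indicator_eq_indicator_enorm]
      refine le_of_eq (congrArg (fun f => A.indicator f x) ?_)
      funext z
      simp
    refine h1.trans (le_of_eq ?_)
    rw [eLpNorm_indicator_const hA (by simp) (by simp)]
    simp
  have hsg3 : eLpNorm sg 1 volume ≤ volume A := by
    rw [eLpNorm_one_eq_lintegral_enorm]
    refine (lintegral_mono hsg1).trans (le_of_eq ?_)
    rw [lintegral_indicator_one hA]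
  obtain ⟨c, hc0, hc⟩ : ∃ c : ℝ, 0 < c ∧ ∀ x ∈ A, growWeight x ≤ c := by
    have hcont : ContinuousOn (fun x : ℝᵈ => growWeight x) (closure A) := by
      have h1 : Continuous fun x : ℝᵈ => (growWeight x : ℂ).re :=
        Complex.continuous_re.comp continuous_growWeight
      simpa only [Complex.ofReal_re] using h1.continuousOn
    obtain ⟨c, hc⟩ := (Metric.isCompact_of_isClosed_isBounded isClosed_closure
      hAb.closure).bddAbove_image hcont
    exact ⟨max c 1, by positivity, fun x hx =>
      (hc (mem_image_of_mem _ (subset_closure hx))).trans (le_max_left _ _)⟩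
  -- The approximation is made for the phase divided by the decay weight, and the result is
  -- multiplied by that weight afterwards. An L² error thus becomes small in L¹ and L² at once, and
  -- also in the pairing with v.
  set hE : ℝᵈ → ℂ := fun x => growWeight x * sg x with hhE
  have hhEm : MemLp hE 2 volume := by
    have hsgL : MemLp sg 2 volume := ⟨hsgm, hsg2.trans_lt (ENNReal.rpow_lt_top_of_nonneg
      (by norm_num) hAt)⟩
    refine MemLp.of_le_mul hsgL (c := c) (continuous_growWeight.aestronglyMeasurable.mul hsgm)
      (Filter.Eventually.of_forall fun x => ?_)
    rw [hhE, norm_mul, Complex.norm_real, Real.norm_of_nonneg (growWeight_pos x).le]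
    by_cases hx : x ∈ A
    · gcongr
      exact hc x hx
    · rw [hsg, indicator_of_notMem hx]
      simp
  set D := eLpNorm (fun x : ℝᵈ => (decayWeight x : ℂ)) 2 volume
  have hDt : D ≠ ∞ := memLp_decayWeight.2.ne
  set B := eLpNorm (fun x => (decayWeight x : ℂ) * v x) 2 volume
  have hBt : B ≠ ∞ := hv.2.ne
  -- The tolerance keeps the L² error below |A|^(1/2), the L¹ error below |A|, and the error in the
  -- pairing below half the mass I.
  obtain ⟨δ, hδ0, hδ1, hδ2, hδ3⟩ : ∃ δ : ℝ, 0 < δ ∧ ENNReal.ofReal δ ≤ volume A ^ (1 / 2 : ℝ) ∧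
      D * ENNReal.ofReal δ ≤ volume A ∧ ENNReal.ofReal δ * B ≤ I / 2 := by
    have lim : ∀ K : ℝ≥0∞, K ≠ ∞ → Filter.Tendsto (fun δ : ℝ => K * ENNReal.ofReal δ)
        (nhdsWithin 0 (Ioi 0)) (nhds 0) := by
      intro K hK
      have := ENNReal.Tendsto.const_mul (a := K) (ENNReal.continuous_ofReal.tendsto 0)
        (Or.inr hK)
      simp only [ENNReal.ofReal_zero, mul_zero] at this
      exact this.mono_left nhdsWithin_le_nhds
    have e1 := (lim 1 ENNReal.one_ne_top).eventually_le_const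
      (ENNReal.rpow_pos (p := 1 / 2) (pos_iff_ne_zero.2 hA0) hAt)
    have e2 := (lim D hDt).eventually_le_const (pos_iff_ne_zero.2 hA0)
    have e3 := (lim B hBt).eventually_le_const (ENNReal.div_pos h0 (by simp : (2 : ℝ≥0∞) ≠ ∞))
    obtain ⟨δ, ⟨⟨h1, h2⟩, h3⟩, h4⟩ := (((e1.and e2).and e3).and self_mem_nhdsWithin).exists
    exact ⟨δ, h4, by simpa using h1, h2, by rwa [mul_comm]⟩
  obtain ⟨h, hh1, hh2, hh3⟩ := hhEm.exist_eLpNorm_sub_le (by simp) (by norm_num) hδ0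
  set hs : 𝓢(ℝᵈ, ℂ) := hh1.toSchwartzMap hh2
  have hsh : ∀ x, hs x = h x := fun x => rfl
  have hhm : AEStronglyMeasurable h volume := hs.continuous.aestronglyMeasurable
  have hdm : AEStronglyMeasurable (h - hE) volume := hhm.sub hhEm.1
  have hh4 : eLpNorm (h - hE) 2 volume ≤ ENNReal.ofReal δ := by
    rwa [eLpNorm_sub_comm]
  have hg : ((decayMul hs : 𝓢(ℝᵈ, ℂ)) : ℝᵈ → ℂ) = sg + fun x => (decayWeight x : ℂ) * (h - hE) x := by
    funext x
    simp only [decayMul_apply, hsh, Pi.add_apply, Pi.sub_apply, hhE]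
    linear_combination sg x * decayWeight_mul_growWeight x
  have hdw : AEStronglyMeasurable (fun x => (decayWeight x : ℂ) * (h - hE) x) volume :=
    continuous_decayWeight.aestronglyMeasurable.mul hdm
  refine ⟨decayMul hs, ?_, ?_, ?_⟩
  · rw [hg, two_mul]
    refine (eLpNorm_add_le hsgm hdw (by norm_num)).trans (add_le_add hsg2 ?_)
    exact (eLpNorm_decayWeight_mul_two_le _).trans (hh4.trans hδ1)
  · rw [hg, two_mul]
    refine (eLpNorm_add_le hsgm hdw le_rfl).trans (add_le_add hsg3 ?_)
    refine (eLpNorm_decayWeight_mul_one_le hdm).trans (le_trans ?_ hδ2)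
    gcongr
  · have hi1 : Integrable (A.indicator fun x => (‖v x‖ : ℂ)) volume := by
      rw [integrable_indicator_iff hA]
      have : IntegrableOn v A := ⟨hvm.restrict, by
        rw [hasFiniteIntegral_iff_enorm]; exact lt_top_iff_ne_top.2 hAint⟩
      exact this.norm.ofReal
    have hi2 : Integrable (fun x => (h - hE) x * ((decayWeight x : ℂ) * v x)) volume :=
      integrable_mul_of_memLp_two ((hs.memLp 2 volume).sub hhEm) hv
    have hsplit : ∫ x, decayMul hs x * v x = (∫ x, A.indicator (fun x => (‖v x‖ : ℂ)) x) +
        ∫ x, (h - hE) x * ((decayWeight x : ℂ) * v x) := by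
      rw [← integral_add hi1 hi2]
      refine integral_congr_ae (Filter.Eventually.of_forall fun x => ?_)
      simp only
      rw [← hsgv, congrFun hg x]
      simp only [Pi.add_apply]
      ring
    have hmain : ‖∫ x, A.indicator (fun x => (‖v x‖ : ℂ)) x‖ₑ = I := by
      rw [integral_indicator hA, integral_complex_ofReal, ← ofReal_norm, Complex.norm_real,
        Real.norm_of_nonneg (integral_nonneg fun x => norm_nonneg _),
        integral_norm_eq_lintegral_enorm hvm.restrict, ENNReal.ofReal_toReal hAint]
    have herr : ‖∫ x, (h - hE) x * ((decayWeight x : ℂ) * v x)‖ₑ ≤ I / 2 := by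
      refine (enorm_integral_le_lintegral_enorm _).trans ?_
      refine le_trans ?_ hδ3
      refine le_trans ?_ (mul_le_mul_left hh4 B)
      refine le_trans (lintegral_mono fun x => ?_) (lintegral_enorm_mul_le hdm hv.1)
      exact (enorm_mul _ _).le
    have hlow : I / 2 ≤ ‖∫ x, decayMul hs x * v x‖ₑ := by
      have h1 : I ≤ ‖∫ x, decayMul hs x * v x‖ₑ + I / 2 := by
        calc I = ‖(∫ x, decayMul hs x * v x) - ∫ x, (h - hE) x * ((decayWeight x : ℂ) * v x)‖ₑ := by
              rw [hsplit, add_sub_cancel_right, hmain]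
          _ ≤ _ := (enorm_sub_le).trans (by gcongr)
      have h2 : I / 2 + I / 2 ≤ ‖∫ x, decayMul hs x * v x‖ₑ + I / 2 := by
        rwa [ENNReal.add_halves]
      exact (ENNReal.add_le_add_iff_right (ENNReal.div_ne_top hAint (by simp))).1 h2
    calc I = 2 * (I / 2) := (ENNReal.mul_div_cancel (by simp) (by simp)).symm
      _ ≤ _ := by gcongr

end Weight

end

/-! ### The Duhamel majorant -/

noncomputable section

/-- Both x ≤ λa and y ≤ λb hold with λ = (a⁻¹ + b⁻¹)(x + y), so finiteness at one point gives a
linear bound everywhere. A finite Lorentz norm thereby yields absolute convergence against every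
Schwartz function. -/
theorem exists_le_mul_add_of_homogeneous {Ψ : ℝ≥0∞ → ℝ≥0∞ → ℝ≥0∞}
    (hmono : ∀ {x x' y y'}, x ≤ x' → y ≤ y' → Ψ x y ≤ Ψ x' y')
    (hhom : ∀ c x y, c ≠ ∞ → Ψ (c * x) (c * y) = c * Ψ x y) {a b : ℝ≥0∞} (ha : a ≠ 0) (hat : a ≠ ∞)
    (hb : b ≠ 0) (hbt : b ≠ ∞) (hfin : Ψ a b ≠ ∞) :
    ∃ M : ℝ≥0∞, M ≠ ∞ ∧ ∀ x y, x ≠ ∞ → y ≠ ∞ → Ψ x y ≤ M * (x + y) := by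
  have hS : a⁻¹ + b⁻¹ ≠ ∞ := ENNReal.add_ne_top.2 ⟨ENNReal.inv_ne_top.2 ha, ENNReal.inv_ne_top.2 hb⟩
  refine ⟨(a⁻¹ + b⁻¹) * Ψ a b, ENNReal.mul_ne_top hS hfin, fun x y hx hy => ?_⟩
  have h1 : x ≤ (a⁻¹ + b⁻¹) * (x + y) * a := by
    calc x = a⁻¹ * x * a := by
          rw [mul_comm, ← mul_assoc, ENNReal.mul_inv_cancel ha hat, one_mul]
      _ ≤ _ := by gcongr <;> exact le_self_add
  have h2 : y ≤ (a⁻¹ + b⁻¹) * (x + y) * b := by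
    calc y = b⁻¹ * y * b := by
          rw [mul_comm, ← mul_assoc, ENNReal.mul_inv_cancel hb hbt, one_mul]
      _ ≤ _ := by gcongr <;> exact le_add_self
  refine (hmono h1 h2).trans (le_of_eq ?_)
  rw [hhom _ _ _ (ENNReal.mul_ne_top hS (ENNReal.add_ne_top.2 ⟨hx, hy⟩))]
  ring

theorem exists_pos_lt_top_of_eLpNorm_lt_top {r : ℝ≥0∞} {f : ℝ → ℝ≥0∞} (hf : Measurable f)
    (hr : r ≠ 0) (h : eLpNorm f r dilationMeasure < ∞) : ∃ b : ℝ, 0 < b ∧ f b < ∞ := by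
  have h1 := (ae_lt_top_of_eLpNorm_lt_top hf hr h).and ae_dilationMeasure_pos
  have : (ae dilationMeasure).NeBot := by
    rw [ae_neBot, dilationMeasure_eq_map_exp]
    exact (Measure.map_ne_zero_iff Real.measurable_exp.aemeasurable).2 (NeZero.ne _)
  obtain ⟨b, hb1, hb2⟩ := h1.exists
  exact ⟨b, hb2, hb1⟩

theorem measurable_layerBound_prod {α β : Type*} [MeasurableSpace α] [MeasurableSpace β]
    {μ : Measure α} [SFinite μ] {H : β → α → ℝ≥0∞} (hH : Measurable (Function.uncurry H))
    {x y : β → ℝ≥0∞} (hx : Measurable x) (hy : Measurable y) :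
    Measurable fun s => layerBound μ (H s) (x s) (y s) := by
  have hm : Measurable fun z : β × ℝ => μ {a | ENNReal.ofReal z.2 < H z.1 a} := by
    have hset : MeasurableSet {w : (β × ℝ) × α | ENNReal.ofReal w.1.2 < H w.1.1 w.2} :=
      measurableSet_lt (ENNReal.measurable_ofReal.comp (by fun_prop))
        (hH.comp ((measurable_fst.comp measurable_fst).prodMk measurable_snd))
    exact measurable_measure_prodMk_left hset
  exact Measurable.lintegral_prod_right' (((hm.pow_const _).mul (hx.comp measurable_fst)).min
    (hm.mul (hy.comp measurable_fst)))

/-- The constant in the dispersive estimate. -/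
def dispersiveConst (d : ℕ) (τ : ℝ) : ℝ := (4 * Real.pi * |τ|) ^ (-(d / 2 : ℝ))

/-- Time-integrated majorant of Duhamel pairings. -/
def duhamelBound {d : ℕ} (J : Set ℝ) (H : ℝ → EuclideanSpace ℝ (Fin d) → ℝ≥0∞) (t : ℝ)
    (x y : ℝ≥0∞) : ℝ≥0∞ :=
  ∫⁻ s in J, layerBound volume (H s) x (ENNReal.ofReal (dispersiveConst d (t - s)) * y)

section DuhamelBound

variable {d : ℕ}

local notation "ℝᵈ" => EuclideanSpace ℝ (Fin d)

variable {J : Set ℝ} {H : ℝ → EuclideanSpace ℝ (Fin d) → ℝ≥0∞} {t : ℝ}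

theorem dispersiveConst_pos {τ : ℝ} (hτ : τ ≠ 0) : 0 < dispersiveConst d τ := by
  have := abs_pos.2 hτ
  unfold dispersiveConst
  positivity

theorem ae_restrict_ne (t : ℝ) : ∀ᵐ s ∂(volume.restrict J), s ≠ t :=
  ae_restrict_of_ae (by simp [ae_iff])

theorem measurable_dispersiveConst (t : ℝ) :
    Measurable fun s => ENNReal.ofReal (dispersiveConst d (t - s)) := by
  unfold dispersiveConst
  fun_prop

theorem duhamelBound_mono {x x' y y' : ℝ≥0∞} (hx : x ≤ x') (hy : y ≤ y') :
    duhamelBound J H t x y ≤ duhamelBound J H t x' y' :=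
  lintegral_mono fun _ => layerBound_mono hx (mul_le_mul_right hy _)

theorem duhamelBound_mul {c : ℝ≥0∞} (hc : c ≠ ∞) (x y : ℝ≥0∞) :
    duhamelBound J H t (c * x) (c * y) = c * duhamelBound J H t x y := by
  rw [duhamelBound, duhamelBound, ← lintegral_const_mul' _ _ hc]
  refine lintegral_congr fun s => ?_
  rw [mul_left_comm, layerBound_mul hc]

/-- Unitarity supplies the L² argument of the layer bound and the dispersive estimate the L^∞
argument. -/
theorem lintegral_enorm_schwartzFlow_le {h : ℝᵈ → ℝ≥0∞} (hh : Measurable h) {τ : ℝ} (hτ : τ ≠ 0)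
    (g : 𝓢(ℝᵈ, ℂ)) : ∫⁻ x, h x * ‖schwartzFlow τ g x‖ₑ ≤
      layerBound volume h (eLpNorm g 2 volume)
        (ENNReal.ofReal (dispersiveConst d τ) * eLpNorm g 1 volume) := by
  refine lintegral_mul_le_layerBound hh (schwartzFlow τ g).continuous.measurable.enorm ?_ ?_
  · have h1 := eLpNorm_schwartzFlow_two τ g
    rw [← h1]
    simp [eLpNorm_eq_lintegral_rpow_enorm_toReal]
  · intro x
    rw [← ofReal_norm, eLpNorm_one_eq_lintegral_enorm,
      ← ofReal_integral_norm_eq_lintegral_enorm g.integrable, ← ENNReal.ofReal_mul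
        (dispersiveConst_pos hτ).le]
    exact ENNReal.ofReal_le_ofReal (norm_schwartzFlow_le hτ g x)

theorem setLIntegral_schwartzFlow_le_duhamelBound (hH : Measurable (Function.uncurry H))
    (g : 𝓢(ℝᵈ, ℂ)) : ∫⁻ s in J, ∫⁻ x, H s x * ‖schwartzFlow (t - s) g x‖ₑ ≤
      duhamelBound J H t (eLpNorm g 2 volume) (eLpNorm g 1 volume) := by
  refine lintegral_mono_ae ?_
  filter_upwards [ae_restrict_ne t] with s hs
  exact lintegral_enorm_schwartzFlow_le (hH.comp measurable_prodMk_left)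
    (sub_ne_zero.2 (Ne.symm hs)) g

theorem measurable_rpow_mul_duhamelBound (hH : Measurable (Function.uncurry H)) (x : ℝ) :
    Measurable fun b : ℝ => ENNReal.ofReal b ^ x *
      duhamelBound J H t (ENNReal.ofReal b ^ (1 / 2 : ℝ)) (ENNReal.ofReal b) := by
  refine (ENNReal.measurable_ofReal.pow_const _).mul ?_
  refine Measurable.lintegral_prod_right' (f := fun z : ℝ × ℝ => layerBound volume (H z.2)
    (ENNReal.ofReal z.1 ^ (1 / 2 : ℝ)) (ENNReal.ofReal (dispersiveConst d (t - z.2)) *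
    ENNReal.ofReal z.1)) ?_
  exact measurable_layerBound_prod (H := fun z : ℝ × ℝ => H z.2)
    (hH.comp ((measurable_snd.comp measurable_fst).prodMk measurable_snd))
    ((ENNReal.measurable_ofReal.comp measurable_fst).pow_const _)
    (((measurable_dispersiveConst t).comp measurable_snd).mul
      (ENNReal.measurable_ofReal.comp measurable_fst))

/-- Minkowski's inequality, using r ≥ 1, moves the norm in b inside the time integral, where the
fixed-time interpolation applies. Admissibility turns the power 1 - 2/q of the dispersive constant
into (4π|t-s|)^(-2/p), and the factor 4π > 1 is discarded. -/
theorem exists_eLpNorm_duhamelBound_le (d : ℕ) {p q : ℝ} (hp : 2 < p) (hq : 2 < q)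
    (hpq : 2 / p + (d : ℝ) / q = (d : ℝ) / 2) {r : ℝ≥0∞} (hr : 1 ≤ r) :
    ∃ C : ℝ≥0, ∀ (J : Set ℝ) (H : ℝ → EuclideanSpace ℝ (Fin d) → ℝ≥0∞)
      (_ : Measurable (Function.uncurry H)) (t : ℝ),
      eLpNorm (fun b : ℝ => ENNReal.ofReal b ^ (1 / q - 1) *
        duhamelBound J H t (ENNReal.ofReal b ^ (1 / 2 : ℝ)) (ENNReal.ofReal b)) r dilationMeasure ≤
      C * ∫⁻ s in J, ENNReal.ofReal |t - s| ^ (-(2 / p)) *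
        lorentzNorm q.conjExponent r volume (H s) := by
  have hr0 : r ≠ 0 := (one_pos.trans_le hr).ne'
  obtain ⟨C, hC⟩ := exists_eLpNorm_layerBound_le hq hr0
  refine ⟨C, fun J H hH t => ?_⟩
  have hjoint : Measurable (Function.uncurry fun s b : ℝ => ENNReal.ofReal b ^ (1 / q - 1) *
      layerBound volume (H s) (ENNReal.ofReal b ^ (1 / 2 : ℝ))
        (ENNReal.ofReal (dispersiveConst d (t - s)) * ENNReal.ofReal b)) := by
    refine ((ENNReal.measurable_ofReal.comp measurable_snd).pow_const _).mul ?_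
    exact measurable_layerBound_prod (H := fun z : ℝ × ℝ => H z.1)
      (hH.comp ((measurable_fst.comp measurable_fst).prodMk measurable_snd))
      ((ENNReal.measurable_ofReal.comp measurable_snd).pow_const _)
      (((measurable_dispersiveConst t).comp measurable_fst).mul
        (ENNReal.measurable_ofReal.comp measurable_snd))
  calc _ = eLpNorm (fun b : ℝ => ∫⁻ s in J, ENNReal.ofReal b ^ (1 / q - 1) *
      layerBound volume (H s) (ENNReal.ofReal b ^ (1 / 2 : ℝ))
        (ENNReal.ofReal (dispersiveConst d (t - s)) * ENNReal.ofReal b)) r dilationMeasure := by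
        refine congrArg (fun f => eLpNorm f r dilationMeasure) (funext fun b => ?_)
        rw [duhamelBound, ← lintegral_const_mul]
        exact measurable_layerBound_prod hH measurable_const
          ((measurable_dispersiveConst t).mul measurable_const)
    _ ≤ _ := eLpNorm_lintegral_le hjoint hr
    _ ≤ ∫⁻ s in J, C * (ENNReal.ofReal |t - s| ^ (-(2 / p)) *
        lorentzNorm q.conjExponent r volume (H s)) := by
        refine lintegral_mono_ae ?_
        filter_upwards [ae_restrict_ne t] with s hs
        have hts : t - s ≠ 0 := sub_ne_zero.2 (Ne.symm hs)
        have habs : 0 < |t - s| := abs_pos.2 hts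
        refine (hC volume (H s) _ (dispersiveConst_pos hts)).trans ?_
        gcongr
        have hqi : 2 / q < 1 := (div_lt_one (by linarith)).2 hq
        rw [ENNReal.ofReal_rpow_of_pos (dispersiveConst_pos hts), ENNReal.ofReal_rpow_of_pos habs]
        refine ENNReal.ofReal_le_ofReal ?_
        rw [dispersiveConst, ← Real.rpow_mul (by positivity)]
        have hexp : -(d / 2 : ℝ) * (1 - 2 / q) = -(2 / p) := by
          have : 2 / p = d / 2 - d / q := by linarith
          rw [this]
          ring
        rw [hexp]
        refine Real.rpow_le_rpow_of_nonpos habs ?_ ?_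
        · have := Real.pi_gt_three
          nlinarith
        · have : 0 < 2 / p := by positivity
          linarith
    _ = _ := lintegral_const_mul' _ _ ENNReal.coe_ne_top

/-- The `L^{q,r}` bound for functions dominated by Duhamel pairings. -/
theorem lorentzNorm_le_eLpNorm_duhamelBound {q : ℝ} (hq : 0 < q) {r : ℝ≥0∞} (hr : r ≠ 0)
    (hH : Measurable (Function.uncurry H)) {v : ℝᵈ → ℂ} (hv : WeightedMemL2 v)
    (hvH : ∀ g : 𝓢(ℝᵈ, ℂ), ‖∫ x, g x * v x‖ₑ ≤
      ∫⁻ s in J, ∫⁻ x, H s x * ‖schwartzFlow (t - s) g x‖ₑ) :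
    lorentzNorm q r volume (fun x => ‖v x‖ₑ) ≤ 4 * eLpNorm (fun b : ℝ =>
      ENNReal.ofReal b ^ (1 / q - 1) *
        duhamelBound J H t (ENNReal.ofReal b ^ (1 / 2 : ℝ)) (ENNReal.ofReal b)) r
      dilationMeasure := by
  have hvm : AEStronglyMeasurable v volume := hv.locallyIntegrable.aestronglyMeasurable
  have hcongr : lorentzNorm q r volume (fun x => ‖v x‖ₑ) =
      lorentzNorm q r volume (fun x => ‖hvm.mk v x‖ₑ) := by
    refine lorentzNorm_congr_ae hq ?_
    filter_upwards [hvm.ae_eq_mk] with x hx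
    rw [← hx]
  have hball : ∀ A : Set ℝᵈ, MeasurableSet A → Bornology.IsBounded A → volume A ≠ 0 →
      ∫⁻ x in A, ‖hvm.mk v x‖ₑ ≤
        4 * duhamelBound J H t (volume A ^ (1 / 2 : ℝ)) (volume A) := by
    intro A hA hAb hA0
    obtain ⟨g, hg1, hg2, hg3⟩ := hv.exists_schwartz_test hA hAb hA0
    have e1 : ∫⁻ x in A, ‖hvm.mk v x‖ₑ = ∫⁻ x in A, ‖v x‖ₑ := by
      refine lintegral_congr_ae (ae_restrict_of_ae ?_)
      filter_upwards [hvm.ae_eq_mk] with x hx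
      rw [← hx]
    rw [e1]
    refine hg3.trans ?_
    -- The final constant 4 is the test function's factor 2 outside times the factor 2 in both of
    -- its norms, taken out by homogeneity.
    calc 2 * ‖∫ x, g x * v x‖ₑ
        ≤ 2 * duhamelBound J H t (2 * volume A ^ (1 / 2 : ℝ)) (2 * volume A) := by
          gcongr
          exact (hvH g).trans ((setLIntegral_schwartzFlow_le_duhamelBound hH g).trans
            (duhamelBound_mono hg1 hg2))
      _ = _ := by
          rw [duhamelBound_mul (by simp), ← mul_assoc]
          norm_num
  have key : ∀ b : ℝ, 0 < b → rearr volume (fun x => ‖hvm.mk v x‖ₑ) (ENNReal.ofReal b) ≤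
      4 * ((ENNReal.ofReal b)⁻¹ *
        duhamelBound J H t (ENNReal.ofReal b ^ (1 / 2 : ℝ)) (ENNReal.ofReal b)) := by
    intro b hb
    refine le_of_forall_lt fun l hl => ?_
    obtain ⟨l', hl1, hl2⟩ := exists_between hl
    refine hl1.trans_le ?_
    have hlm := lt_rearr_iff.1 hl2
    set A₀ : Set ℝᵈ := {x | l' < ‖hvm.mk v x‖ₑ}
    have hA₀ : MeasurableSet A₀ :=
      measurableSet_lt measurable_const hvm.stronglyMeasurable_mk.measurable.enorm
    -- The test functions exist only for bounded sets, so the superlevel set is exhausted by its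
    -- intersections with balls.
    have hU : A₀ = ⋃ n : ℕ, A₀ ∩ Metric.ball 0 n := by
      rw [← inter_iUnion, Metric.iUnion_ball_nat, inter_univ]
    have hmono : Monotone fun n : ℕ => A₀ ∩ Metric.ball (0 : ℝᵈ) n := fun m n hmn =>
      inter_subset_inter_right _ (Metric.ball_subset_ball (by exact_mod_cast hmn))
    rw [hU, hmono.measure_iUnion] at hlm
    obtain ⟨n, hn⟩ := lt_iSup_iff.1 hlm
    set A := A₀ ∩ Metric.ball (0 : ℝᵈ) n
    have hA : MeasurableSet A := hA₀.inter measurableSet_ball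
    have hAb : Bornology.IsBounded A := Metric.isBounded_ball.subset inter_subset_right
    have hA0 : volume A ≠ 0 := (bot_lt_of_lt hn).ne'
    have hAt : volume A ≠ ∞ := hAb.measure_lt_top.ne
    have h1 : l' * volume A ≤ 4 * duhamelBound J H t (volume A ^ (1 / 2 : ℝ)) (volume A) := by
      refine le_trans ?_ (hball A hA hAb hA0)
      rw [← setLIntegral_const]
      exact setLIntegral_mono hvm.stronglyMeasurable_mk.measurable.enorm
        fun x hx => (show l' < _ from hx.1).le
    -- By homogeneity the average depends on c only through c^(-1/2), hence decreases in c; this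
    -- replaces |A| by the smaller b.
    have h2 : ∀ c : ℝ≥0∞, c ≠ 0 → c ≠ ∞ → c⁻¹ * duhamelBound J H t (c ^ (1 / 2 : ℝ)) c =
        duhamelBound J H t (c ^ (-(1 / 2) : ℝ)) 1 := by
      intro c h0 ht
      rw [← duhamelBound_mul (ENNReal.inv_ne_top.2 h0), ENNReal.inv_mul_cancel h0 ht,
        ← ENNReal.rpow_neg_one, ← ENNReal.rpow_add _ _ h0 ht]
      norm_num
    have hb0 : ENNReal.ofReal b ≠ 0 := by simpa using hb
    calc l' ≤ 4 * ((volume A)⁻¹ * duhamelBound J H t (volume A ^ (1 / 2 : ℝ)) (volume A)) := by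
          refine (ENNReal.mul_le_mul_iff_left hA0 hAt).1 (h1.trans (le_of_eq ?_))
          rw [mul_assoc 4, mul_right_comm _ _ (volume A), ENNReal.inv_mul_cancel hA0 hAt, one_mul]
      _ ≤ _ := by
          rw [h2 _ hA0 hAt, h2 _ hb0 ENNReal.ofReal_ne_top]
          refine mul_le_mul_right (duhamelBound_mono ?_ le_rfl) _
          rw [ENNReal.rpow_neg, ENNReal.rpow_neg]
          exact ENNReal.inv_le_inv.2 (ENNReal.rpow_le_rpow hn.le (by norm_num))
  rw [hcongr]
  refine (lorentzNorm_le_of_rearr_le hq hr key).trans ?_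
  rw [← eLpNorm_const_mul_ennreal (measurable_rpow_mul_duhamelBound hH _) hr]
  refine eLpNorm_mono_enorm_ae ?_
  filter_upwards [ae_dilationMeasure_pos] with b hb
  simp only [enorm_eq_self]
  refine le_of_eq ?_
  rw [ENNReal.rpow_sub _ _ (by simpa using hb) ENNReal.ofReal_ne_top, ENNReal.rpow_one]
  simp only [ENNReal.div_eq_inv_mul]
  ring

theorem exists_duhamelBound_le_mul_add {q : ℝ} {r : ℝ≥0∞} (hr : r ≠ 0)
    (hH : Measurable (Function.uncurry H))
    (hfin : eLpNorm (fun b : ℝ => ENNReal.ofReal b ^ (1 / q - 1) *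
        duhamelBound J H t (ENNReal.ofReal b ^ (1 / 2 : ℝ)) (ENNReal.ofReal b)) r
      dilationMeasure < ∞) :
    ∃ M : ℝ≥0∞, M ≠ ∞ ∧ ∀ x y, x ≠ ∞ → y ≠ ∞ → duhamelBound J H t x y ≤ M * (x + y) := by
  obtain ⟨b, hb, hbfin⟩ := exists_pos_lt_top_of_eLpNorm_lt_top
    (measurable_rpow_mul_duhamelBound hH _) hr hfin
  have hb0 : 0 < ENNReal.ofReal b := by simpa using hb
  refine exists_le_mul_add_of_homogeneous duhamelBound_mono
    (fun c x y hc => duhamelBound_mul hc x y) (a := ENNReal.ofReal b ^ (1 / 2 : ℝ))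
    (b := ENNReal.ofReal b) (ENNReal.rpow_pos hb0 ENNReal.ofReal_ne_top).ne'
    (ENNReal.rpow_ne_top_of_nonneg (by norm_num) ENNReal.ofReal_ne_top) hb0.ne'
    ENNReal.ofReal_ne_top fun htop => ?_
  rw [htop, ENNReal.mul_top (ENNReal.rpow_pos hb0 ENNReal.ofReal_ne_top).ne'] at hbfin
  exact lt_irrefl _ hbfin

end DuhamelBound

end

/-! ### Joint measurability and tempered distributions -/

noncomputable section

theorem measurable_eLpNorm_prodMk_left {α β : Type*} [MeasurableSpace α] [MeasurableSpace β]
    {ν : Measure α} [SFinite ν] {G : β → α → ℝ≥0∞} (hG : Measurable (Function.uncurry G))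
    (r : ℝ≥0∞) : Measurable fun s => eLpNorm (G s) r ν := by
  rcases eq_or_ne r 0 with rfl | hr
  · simp
  rcases eq_or_ne r ∞ with rfl | hrt
  · simp only [eLpNorm_exponent_top]
    refine measurable_of_Iic fun c => ?_
    -- Sublevel sets of the essential supremum are described by the vanishing of a measure, which is
    -- measurable in the parameter.
    have : (fun s => eLpNormEssSup (G s) ν) ⁻¹' Iic c = {s | ν {b | c < G s b} = 0} := by
      ext s
      rw [mem_preimage, mem_Iic, mem_ofPred_eq]
      constructor
      · intro h
        refine measure_mono_null (fun b hb => ?_) (meas_eLpNormEssSup_lt (f := G s) (μ := ν))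
        exact h.trans_lt (by exact hb)
      · intro h
        refine eLpNormEssSup_le_of_ae_enorm_bound ?_
        simpa [ae_iff] using h
    rw [this]
    have hset : MeasurableSet {z : β × α | c < G z.1 z.2} := measurableSet_lt measurable_const hG
    exact (measurable_measure_prodMk_left hset) (measurableSet_singleton 0)
  · simp only [eLpNorm_eq_lintegral_rpow_enorm_toReal hr hrt, enorm_eq_self]
    exact (Measurable.lintegral_prod_right' (hG.pow_const r.toReal)).pow_const _

theorem measurable_lorentzNorm_prodMk_left {α β : Type*} [MeasurableSpace α] [MeasurableSpace β]
    {μ : Measure α} [SFinite μ] {H : β → α → ℝ≥0∞} (hH : Measurable (Function.uncurry H))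
    (p : ℝ) (r : ℝ≥0∞) : Measurable fun s => lorentzNorm p r μ (H s) := by
  have hset : MeasurableSet {w : (β × ℝ) × α | ENNReal.ofReal w.1.2 < H w.1.1 w.2} :=
    measurableSet_lt (ENNReal.measurable_ofReal.comp (by fun_prop))
      (hH.comp ((measurable_fst.comp measurable_fst).prodMk measurable_snd))
  have hm : Measurable fun z : β × ℝ => μ {a | ENNReal.ofReal z.2 < H z.1 a} :=
    measurable_measure_prodMk_left hset
  refine Measurable.const_mul ?_ _
  exact measurable_eLpNorm_prodMk_left ((ENNReal.measurable_ofReal.comp measurable_snd).mul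
    (hm.pow_const _)) r

section Tempered

variable {d : ℕ}

local notation "ℝᵈ" => EuclideanSpace ℝ (Fin d)

theorem IsFunction.congr_ae {T : 𝓢'(ℝᵈ, ℂ)} {f f' : ℝᵈ → ℂ} (h : IsFunction T f)
    (hff' : f =ᵐ[volume] f') : IsFunction T f' := by
  intro g
  have h1 : (fun x => g x * f x) =ᵐ[volume] fun x => g x * f' x := by
    filter_upwards [hff'] with x hx
    rw [hx]
  exact ⟨(h g).1.congr h1, (h g).2.trans (integral_congr_ae h1)⟩

theorem toDistribution_apply {f : ℝᵈ → ℂ} (h : ∃ T, IsFunction T f) (g : 𝓢(ℝᵈ, ℂ)) :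
    toDistribution f g = ∫ x, g x * f x := by
  rw [toDistribution, dif_pos h]
  exact (h.choose_spec g).2

theorem exists_isFunction_of_lintegral_le {f : ℝᵈ → ℂ} (hf : AEStronglyMeasurable f volume)
    {M : ℝ≥0∞} (hM : M ≠ ∞) (h : ∀ g : 𝓢(ℝᵈ, ℂ), ∫⁻ x, ‖f x‖ₑ * ‖g x‖ₑ ≤
      M * (eLpNorm g 2 volume + eLpNorm g ∞ volume)) : ∃ T, IsFunction T f := by
  have hint : ∀ g : 𝓢(ℝᵈ, ℂ), Integrable fun x => g x * f x := by
    intro g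
    refine ⟨g.continuous.aestronglyMeasurable.mul hf, ?_⟩
    rw [hasFiniteIntegral_iff_enorm]
    simp only [enorm_mul, mul_comm ‖g _‖ₑ]
    exact (h g).trans_lt (ENNReal.mul_lt_top hM.lt_top (ENNReal.add_lt_top.2
      ⟨g.eLpNorm_lt_top 2 volume, g.eLpNorm_lt_top ∞ volume⟩))
  set T : 𝓢(ℝᵈ, ℂ) →ₗ[ℂ] ℂ :=
    { toFun := fun g => ∫ x, g x * f x
      map_add' := fun g g' => by
        rw [← integral_add (hint g) (hint g')]
        exact integral_congr_ae (Filter.Eventually.of_forall fun x => add_mul _ _ _)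
      map_smul' := fun c g => by
        rw [RingHom.id_apply, smul_eq_mul, ← integral_const_mul]
        exact integral_congr_ae (Filter.Eventually.of_forall fun x => mul_assoc _ _ _) } with hT
  have hbound : ∀ g, ‖T g‖ ≤ M.toReal * (‖g.toLp 2 volume‖ + ‖g.toLp ∞ volume‖) := by
    intro g
    rw [SchwartzMap.norm_toLp, SchwartzMap.norm_toLp, ← ENNReal.toReal_add
      (g.eLpNorm_lt_top 2 volume).ne (g.eLpNorm_lt_top ∞ volume).ne, ← ENNReal.toReal_mul,
      ← toReal_enorm]
    refine ENNReal.toReal_mono (ENNReal.mul_ne_top hM (ENNReal.add_lt_top.2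
      ⟨g.eLpNorm_lt_top 2 volume, g.eLpNorm_lt_top ∞ volume⟩).ne) (le_trans ?_ (h g))
    refine (enorm_integral_le_lintegral_enorm _).trans (le_of_eq ?_)
    simp only [enorm_mul, mul_comm ‖g _‖ₑ]
  have hcont : Continuous T := by
    refine continuous_of_continuousAt_zero T ?_
    have hc : Continuous fun g : 𝓢(ℝᵈ, ℂ) =>
        M.toReal * (‖g.toLp 2 volume‖ + ‖g.toLp ∞ volume‖) := by
      have h2 : Continuous fun g : 𝓢(ℝᵈ, ℂ) => ‖g.toLp 2 volume‖ :=
        (SchwartzMap.toLpCLM ℂ ℂ 2 (volume : Measure ℝᵈ)).continuous.norm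
      have h3 : Continuous fun g : 𝓢(ℝᵈ, ℂ) => ‖g.toLp ∞ volume‖ :=
        (SchwartzMap.toLpCLM ℂ ℂ ∞ (volume : Measure ℝᵈ)).continuous.norm
      exact continuous_const.mul (h2.add h3)
    have h0 := hc.tendsto 0
    rw [ContinuousAt, map_zero]
    refine squeeze_zero_norm hbound ?_
    convert h0 using 2
    rw [show (0 : 𝓢(ℝᵈ, ℂ)).toLp 2 volume = 0 from
      (SchwartzMap.toLpCLM ℂ ℂ 2 (volume : Measure ℝᵈ)).map_zero,
      show (0 : 𝓢(ℝᵈ, ℂ)).toLp ∞ volume = 0 from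
      (SchwartzMap.toLpCLM ℂ ℂ ∞ (volume : Measure ℝᵈ)).map_zero]
    simp
  refine ⟨ContinuousLinearMap.toPointwiseConvergenceCLM _ _ _ _ ⟨T, hcont⟩, fun g => ⟨hint g, rfl⟩⟩

/-- Functions of finite `L^{q',r}` quasinorm, `2 < q`, are tempered distributions. -/
theorem exists_isFunction_of_lorentzNorm_lt_top {q : ℝ} (hq : 2 < q) {r : ℝ≥0∞} (hr : r ≠ 0)
    {f : ℝᵈ → ℂ} (hf : Measurable f)
    (hfin : lorentzNorm q.conjExponent r volume (fun x => ‖f x‖ₑ) < ∞) :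
    ∃ T, IsFunction T f := by
  obtain ⟨C, hC⟩ := exists_eLpNorm_layerBound_le hq hr
  -- With D = 1 the layer bound controls pairings by the L² and L^∞ norms of the Schwartz function
  -- alone.
  have h1 := hC (volume : Measure ℝᵈ) (fun x => ‖f x‖ₑ) 1 one_pos
  have hm : Measurable fun b : ℝ => ENNReal.ofReal b ^ (1 / q - 1) *
      layerBound (volume : Measure ℝᵈ) (fun x => ‖f x‖ₑ) (ENNReal.ofReal b ^ (1 / 2 : ℝ))
        (ENNReal.ofReal 1 * ENNReal.ofReal b) :=
    (ENNReal.measurable_ofReal.pow_const _).mul (measurable_layerBound_prod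
      (H := fun _ : ℝ => fun x : ℝᵈ => ‖f x‖ₑ) (hf.enorm.comp measurable_snd)
      (ENNReal.measurable_ofReal.pow_const _) (ENNReal.measurable_ofReal.const_mul _))
  obtain ⟨b, hb, hbfin⟩ := exists_pos_lt_top_of_eLpNorm_lt_top hm hr (h1.trans_lt (by
    refine ENNReal.mul_lt_top ENNReal.coe_lt_top (ENNReal.mul_lt_top ?_ hfin)
    simp))
  have hb0 : 0 < ENNReal.ofReal b := by simpa using hb
  obtain ⟨M, hM, hMb⟩ := exists_le_mul_add_of_homogeneous
    (Ψ := layerBound (volume : Measure ℝᵈ) fun x => ‖f x‖ₑ) layerBound_mono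
    (fun c x y hc => layerBound_mul hc x y) (a := ENNReal.ofReal b ^ (1 / 2 : ℝ))
    (b := ENNReal.ofReal 1 * ENNReal.ofReal b) (ENNReal.rpow_pos hb0 ENNReal.ofReal_ne_top).ne'
    (ENNReal.rpow_ne_top_of_nonneg (by norm_num) ENNReal.ofReal_ne_top) (by simpa using hb)
    (by simp) fun htop => by
      rw [htop, ENNReal.mul_top (ENNReal.rpow_pos hb0 ENNReal.ofReal_ne_top).ne'] at hbfin
      exact lt_irrefl _ hbfin
  refine exists_isFunction_of_lintegral_le hf.aestronglyMeasurable hM fun g => ?_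
  refine le_trans ?_ (hMb _ _ (g.eLpNorm_lt_top 2 volume).ne (g.eLpNorm_lt_top ∞ volume).ne)
  set S := eLpNorm g ∞ (volume : Measure ℝᵈ) with hS
  refine lintegral_mul_le_layerBound hf.enorm g.continuous.measurable.enorm ?_ ?_
  · simp [eLpNorm_eq_lintegral_rpow_enorm_toReal]
  · intro x
    -- For a continuous function the essential supremum bounds every value, because nonempty open
    -- sets have positive measure.
    refine le_of_not_gt fun hlt => ?_
    have hopen : IsOpen {x | S < ‖g x‖ₑ} := isOpen_lt continuous_const g.continuous.enorm
    refine (hopen.measure_pos volume ⟨x, hlt⟩).ne' ?_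
    rw [hS, eLpNorm_exponent_top]
    exact meas_eLpNormEssSup_lt

/-- A jointly measurable version of a family of functions whose Schwartz pairings are
measurable. -/
theorem exists_stronglyMeasurable_uncurry {v : ℝ → ℝᵈ → ℂ}
    (hv : ∀ t, LocallyIntegrable (v t) volume)
    (hm : ∀ g : 𝓢(ℝᵈ, ℂ), StronglyMeasurable fun t => ∫ x, g x * v t x) :
    ∃ G : ℝ → ℝᵈ → ℂ, StronglyMeasurable (Function.uncurry G) ∧ ∀ t, G t =ᵐ[volume] v t := by
  -- Each mollification is continuous in x and, being a Schwartz pairing, measurable in t, hence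
  -- jointly measurable. By Lebesgue differentiation the mollifications converge to v t at almost
  -- every x, so their limit is the desired version.
  open Convolution in
  set φ : ℕ → ContDiffBump (0 : ℝᵈ) := fun n =>
    ⟨1 / (n + 1), 2 / (n + 1), by positivity, by gcongr; norm_num⟩ with hφ
  have hrout : ∀ n, (φ n).rOut = 2 / (n + 1) := fun n => rfl
  have hrin : ∀ n, (φ n).rIn = 1 / (n + 1) := fun n => rfl
  set Gn : ℕ → ℝ → ℝᵈ → ℂ := fun n t =>
    ((φ n).normed volume ⋆[ContinuousLinearMap.lsmul ℝ ℝ, volume] v t) with hGn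
  have hGncont : ∀ n t, Continuous (Gn n t) := fun n t =>
    (φ n).hasCompactSupport_normed.continuous_convolution_left _ (φ n).continuous_normed (hv t)
  have hGnmeas : ∀ n x, StronglyMeasurable fun t => Gn n t x := by
    intro n x
    set η : ℝᵈ → ℂ := fun y => ((φ n).normed volume (x - y) : ℂ) with hη
    have hη1 : HasCompactSupport η := by
      have h1 : HasCompactSupport fun y => (φ n).normed volume (x - y) :=
        (φ n).hasCompactSupport_normed.comp_homeomorph (Homeomorph.subLeft x)
      exact h1.comp_left (g := fun y : ℝ => (y : ℂ)) Complex.ofReal_zero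
    have hη2 : ContDiff ℝ ((⊤ : ℕ∞) : WithTop ℕ∞) η :=
      Complex.ofRealCLM.contDiff.comp ((φ n).contDiff_normed.comp (contDiff_const.sub contDiff_id))
    have heq : (fun t => Gn n t x) = fun t => ∫ y, hη1.toSchwartzMap hη2 y * v t y := by
      funext t
      simp only [hGn, convolution_eq_swap]
      refine integral_congr_ae (Filter.Eventually.of_forall fun y => ?_)
      simp only [ContinuousLinearMap.lsmul_apply, Complex.real_smul]
      rfl
    rw [heq]
    exact hm _
  have hGnjoint : ∀ n, StronglyMeasurable (Function.uncurry (Gn n)) := by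
    intro n
    have := stronglyMeasurable_uncurry_of_continuous_of_stronglyMeasurable
      (u := fun x t => Gn n t x) (fun t => hGncont n t) (hGnmeas n)
    exact this.comp_measurable measurable_swap
  refine ⟨fun t x => Filter.limUnder Filter.atTop fun n => Gn n t x,
    StronglyMeasurable.limUnder (l := Filter.atTop) hGnjoint, fun t => ?_⟩
  have hlim := ContDiffBump.ae_convolution_tendsto_right_of_locallyIntegrable (φ := φ) (K := 2)
    (l := Filter.atTop) (μ := (volume : Measure ℝᵈ)) (g := v t) ?_ ?_ (hv t)
  · filter_upwards [hlim] with x hx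
    exact hx.limUnder_eq
  · simp only [hrout]
    have h := (tendsto_one_div_add_atTop_nhds_zero_nat (𝕜 := ℝ)).const_mul 2
    simpa [mul_one_div, div_eq_mul_inv] using h
  · refine Filter.Eventually.of_forall fun n => ?_
    rw [hrout, hrin]
    apply le_of_eq
    ring

end Tempered

end

/-! ### The retarded estimate -/

noncomputable section

section Duhamel

variable {d : ℕ}

local notation "ℝᵈ" => EuclideanSpace ℝ (Fin d)

theorem schwartzFlow_add_apply (τ : ℝ) (u v : 𝓢(ℝᵈ, ℂ)) (x : ℝᵈ) :
    schwartzFlow τ (u + v) x = schwartzFlow τ u x + schwartzFlow τ v x := by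
  simp [schwartzFlow]

theorem schwartzFlow_smul_apply (τ : ℝ) (c : ℂ) (u : 𝓢(ℝᵈ, ℂ)) (x : ℝᵈ) :
    schwartzFlow τ (c • u) x = c * schwartzFlow τ u x := by
  simp [schwartzFlow, FourierTransform.fourier_smul, FourierTransform.fourierInv_smul]

/-- The `L^{q',r}` norms of a forcing term, integrated against the kernel `|t - s|^{-2/p}`. -/
def forcingPotential (p q : ℝ) (r : ℝ≥0∞) (J : Set ℝ) (H : ℝ → EuclideanSpace ℝ (Fin d) → ℝ≥0∞)
    (t : ℝ) : ℝ≥0∞ :=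
  ∫⁻ s in J, ENNReal.ofReal |t - s| ^ (-(2 / p)) * lorentzNorm q.conjExponent r volume (H s)

theorem measurable_forcingPotential (p q : ℝ) (r : ℝ≥0∞) (J : Set ℝ) {H : ℝ → ℝᵈ → ℝ≥0∞}
    (hH : Measurable (Function.uncurry H)) : Measurable (forcingPotential p q r J H) := by
  refine Measurable.lintegral_prod_right' (f := fun z : ℝ × ℝ =>
    ENNReal.ofReal |z.1 - z.2| ^ (-(2 / p)) * lorentzNorm q.conjExponent r volume (H z.2)) ?_
  exact (Measurable.pow_const (by fun_prop) _).mul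
    ((measurable_lorentzNorm_prodMk_left hH _ _).comp measurable_snd)

/-- The fixed-time estimate in the form used for both conclusions: only domination of the pairings
by the absolute Duhamel integral over J is required, not a formula for v. -/
theorem exists_lorentzNorm_le_forcingPotential (d : ℕ) {p q : ℝ} (hp : 2 < p) (hq : 2 < q)
    (hpq : 2 / p + (d : ℝ) / q = (d : ℝ) / 2) {r : ℝ≥0∞} (hr : 1 ≤ r) :
    ∃ C : ℝ≥0, ∀ (J : Set ℝ) (H : ℝ → EuclideanSpace ℝ (Fin d) → ℝ≥0∞)
      (_ : Measurable (Function.uncurry H)) (t : ℝ) (v : EuclideanSpace ℝ (Fin d) → ℂ)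
      (_ : WeightedMemL2 v) (_ : ∀ g : 𝓢(EuclideanSpace ℝ (Fin d), ℂ), ‖∫ x, g x * v x‖ₑ ≤
        ∫⁻ s in J, ∫⁻ x, H s x * ‖schwartzFlow (t - s) g x‖ₑ),
      lorentzNorm q r volume (fun x => ‖v x‖ₑ) ≤ C * forcingPotential p q r J H t := by
  obtain ⟨C, hC⟩ := exists_eLpNorm_duhamelBound_le d hp hq hpq hr
  refine ⟨4 * C, fun J H hH t v hv hvH => ?_⟩
  refine (lorentzNorm_le_eLpNorm_duhamelBound (by linarith) (one_pos.trans_le hr).ne' hH hv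
    hvH).trans ?_
  push_cast
  rw [mul_assoc]
  gcongr
  exact hC J H hH t

theorem exists_lorentzNorm_forcingPotential_le {p : ℝ} (hp : 2 < p) {θ : ℝ≥0∞} (hθ : θ ≠ 0) :
    ∃ C : ℝ≥0, ∀ (q : ℝ) (r : ℝ≥0∞) (J : Set ℝ) (_ : MeasurableSet J) {d : ℕ}
      (H : ℝ → EuclideanSpace ℝ (Fin d) → ℝ≥0∞) (_ : Measurable (Function.uncurry H)),
      lorentzNorm p θ (volume.restrict J) (forcingPotential p q r J H) ≤
        C * lorentzNorm p.conjExponent θ (volume.restrict J)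
          (fun s => lorentzNorm q.conjExponent r volume (H s)) := by
  obtain ⟨C, hC⟩ := exists_lorentzNorm_rieszPotential_le hp hθ
  exact ⟨C, fun q r J hJ d H hH => hC J hJ _ (measurable_lorentzNorm_prodMk_left hH _ _)⟩

section Pairing

variable {p q : ℝ} {r : ℝ≥0∞} {J : Set ℝ} {F : ℝ → EuclideanSpace ℝ (Fin d) → ℂ} {t : ℝ}

theorem measurable_enorm_uncurry (hF : Measurable (Function.uncurry F)) :
    Measurable (Function.uncurry fun s x => ‖F s x‖ₑ) := hF.enorm

theorem measurable_schwartzFlow_mul (hF : Measurable (Function.uncurry F)) (t : ℝ)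
    (g : 𝓢(ℝᵈ, ℂ)) :
    Measurable fun z : ℝ × ℝᵈ => schwartzFlow (t - z.1) g z.2 * F z.1 z.2 :=
  ((continuous_schwartzFlow g).comp (by fun_prop :
    Continuous fun z : ℝ × ℝᵈ => (t - z.1, z.2))).measurable.mul hF

theorem lintegral_enorm_schwartzFlow_mul (hF : Measurable (Function.uncurry F)) (t : ℝ)
    (g : 𝓢(ℝᵈ, ℂ)) (A : Set ℝ) :
    ∫⁻ z, ‖schwartzFlow (t - z.1) g z.2 * F z.1 z.2‖ₑ ∂((volume.restrict A).prod volume) =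
      ∫⁻ s in A, ∫⁻ x, ‖F s x‖ₑ * ‖schwartzFlow (t - s) g x‖ₑ := by
  rw [lintegral_prod _ (measurable_schwartzFlow_mul hF t g).enorm.aemeasurable]
  simp only [enorm_mul, mul_comm]

/-- Finiteness of the potential at t bounds the majorant at one pair of arguments, hence linearly in
the L¹ and L² norms. -/
theorem exists_duhamelBound_le_of_forcingPotential (hp : 2 < p) (hq : 2 < q)
    (hpq : 2 / p + (d : ℝ) / q = (d : ℝ) / 2) (hr : 1 ≤ r) (hF : Measurable (Function.uncurry F))
    (ht : forcingPotential p q r J (fun s x => ‖F s x‖ₑ) t < ∞) :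
    ∃ M : ℝ≥0∞, M ≠ ∞ ∧ ∀ g : 𝓢(ℝᵈ, ℂ),
      ∫⁻ s in J, ∫⁻ x, ‖F s x‖ₑ * ‖schwartzFlow (t - s) g x‖ₑ ≤
        M * (eLpNorm g 2 volume + eLpNorm g 1 volume) := by
  obtain ⟨C, hC⟩ := exists_eLpNorm_duhamelBound_le d hp hq hpq hr
  obtain ⟨M, hM, hMb⟩ := exists_duhamelBound_le_mul_add (q := q) (r := r)
    (one_pos.trans_le hr).ne' (measurable_enorm_uncurry hF) (J := J) (t := t)
    ((hC J _ (measurable_enorm_uncurry hF) t).trans_lt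
      (ENNReal.mul_lt_top ENNReal.coe_lt_top ht))
  exact ⟨M, hM, fun g => (setLIntegral_schwartzFlow_le_duhamelBound
    (measurable_enorm_uncurry hF) g).trans
      (hMb _ _ (g.eLpNorm_lt_top 2 volume).ne (g.eLpNorm_lt_top 1 volume).ne)⟩

theorem integrable_schwartzFlow_mul (hp : 2 < p) (hq : 2 < q)
    (hpq : 2 / p + (d : ℝ) / q = (d : ℝ) / 2) (hr : 1 ≤ r) (hF : Measurable (Function.uncurry F))
    (ht : forcingPotential p q r J (fun s x => ‖F s x‖ₑ) t < ∞) {A : Set ℝ} (hA : A ⊆ J)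
    (g : 𝓢(ℝᵈ, ℂ)) : Integrable (fun z : ℝ × ℝᵈ => schwartzFlow (t - z.1) g z.2 * F z.1 z.2)
      ((volume.restrict A).prod volume) := by
  obtain ⟨M, hM, hMb⟩ := exists_duhamelBound_le_of_forcingPotential hp hq hpq hr hF ht
  refine ⟨(measurable_schwartzFlow_mul hF t g).aestronglyMeasurable, ?_⟩
  rw [hasFiniteIntegral_iff_enorm, lintegral_enorm_schwartzFlow_mul hF]
  refine (lintegral_mono_set hA).trans_lt ((hMb g).trans_lt (ENNReal.mul_lt_top hM.lt_top ?_))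
  exact ENNReal.add_lt_top.2 ⟨g.eLpNorm_lt_top 2 volume, g.eLpNorm_lt_top 1 volume⟩

/-- The Duhamel integral over `A` at time `t`, as a function. -/
theorem exists_weightedMemL2_duhamel (hp : 2 < p) (hq : 2 < q)
    (hpq : 2 / p + (d : ℝ) / q = (d : ℝ) / 2) (hr : 1 ≤ r) (hF : Measurable (Function.uncurry F))
    (ht : forcingPotential p q r J (fun s x => ‖F s x‖ₑ) t < ∞) {A : Set ℝ} (hA : A ⊆ J) :
    ∃ v : ℝᵈ → ℂ, WeightedMemL2 v ∧ ∀ g : 𝓢(ℝᵈ, ℂ), ∫ x, g x * v x =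
      ∫ z, schwartzFlow (t - z.1) g z.2 * F z.1 z.2 ∂((volume.restrict A).prod volume) := by
  have hint := integrable_schwartzFlow_mul hp hq hpq hr hF ht hA
  obtain ⟨M, hM, hMb⟩ := exists_duhamelBound_le_of_forcingPotential hp hq hpq hr hF ht
  set T : 𝓢(ℝᵈ, ℂ) →ₗ[ℂ] ℂ :=
    { toFun := fun g => ∫ z, schwartzFlow (t - z.1) g z.2 * F z.1 z.2
        ∂((volume.restrict A).prod volume)
      map_add' := fun g g' => by
        rw [← integral_add (hint g) (hint g')]
        refine integral_congr_ae (Filter.Eventually.of_forall fun z => ?_)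
        simp only [schwartzFlow_add_apply, add_mul]
      map_smul' := fun c g => by
        rw [RingHom.id_apply, smul_eq_mul, ← integral_const_mul]
        refine integral_congr_ae (Filter.Eventually.of_forall fun z => ?_)
        simp only [schwartzFlow_smul_apply, mul_assoc] }
  obtain ⟨v, hv, hTv⟩ := exists_weightedMemL2_of_bound T hM fun g => by
    refine le_trans ?_ (hMb g)
    refine (enorm_integral_le_lintegral_enorm _).trans ?_
    rw [lintegral_enorm_schwartzFlow_mul hF]
    exact lintegral_mono_set hA
  exact ⟨v, hv, fun g => (hTv g).symm⟩

/-- Fubini separates the space-time pairing into the s-integral of the distributional pairings. The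
forcing may be changed on null sets in x for almost every s, so a measurable representative can be
used in the estimates. -/
theorem isDuhamelIntegral_of_integral_eq {F' : ℝ → ℝᵈ → ℂ} {A : Set ℝ} {v : ℝᵈ → ℂ}
    (hv : WeightedMemL2 v)
    (htemp : ∀ᵐ s ∂(volume.restrict A), ∃ T, IsFunction T (F s))
    (hFF' : ∀ᵐ s ∂(volume.restrict A), F s =ᵐ[volume] F' s)
    (hint : ∀ g : 𝓢(ℝᵈ, ℂ), Integrable (fun z : ℝ × ℝᵈ =>
      schwartzFlow (t - z.1) g z.2 * F z.1 z.2) ((volume.restrict A).prod volume))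
    (heq : ∀ g : 𝓢(ℝᵈ, ℂ), ∫ x, g x * v x =
      ∫ z, schwartzFlow (t - z.1) g z.2 * F z.1 z.2 ∂((volume.restrict A).prod volume)) :
    IsDuhamelIntegral A t F' v := by
  have htemp' : ∀ᵐ s ∂(volume.restrict A), ∃ T, IsFunction T (F' s) := by
    filter_upwards [htemp, hFF'] with s ⟨T, hT⟩ hs
    exact ⟨T, hT.congr_ae hs⟩
  have hpair : ∀ g : 𝓢(ℝᵈ, ℂ), (fun s => ∫ x, schwartzFlow (t - s) g x * F s x)
      =ᵐ[volume.restrict A] fun s => freeFlow (t - s) (toDistribution (F' s)) g := by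
    intro g
    filter_upwards [htemp', hFF'] with s hs1 hs2
    rw [freeFlow_apply, toDistribution_apply hs1]
    refine integral_congr_ae ?_
    filter_upwards [hs2] with x hx
    rw [hx]
  refine ⟨htemp', fun g => (hint g).integral_prod_left.congr (hpair g), hv.integrable_mul,
    fun g => ?_⟩
  rw [heq g, integral_prod _ (hint g)]
  exact integral_congr_ae (hpair g)

end Pairing

/-- Retarded Strichartz estimates in Lorentz spaces. -/
theorem exists_retarded_lorentz_strichartz (d : ℕ) {p q : ℝ} (hp : 2 < p) (hq : 2 < q)
    (hpq : 2 / p + (d : ℝ) / q = (d : ℝ) / 2) {θ φ : ℝ≥0∞} (hθ : 0 < θ) (hφ : 1 ≤ φ) :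
    ∃ C : ℝ≥0, ∀ J : Set ℝ, J.OrdConnected →
      ∀ I : ℝ → Set ℝ, (∀ t ∈ J, (I t).OrdConnected ∧ I t ⊆ J) →
      ∀ F : ℝ → EuclideanSpace ℝ (Fin d) → ℂ,
        AEStronglyMeasurable (Function.uncurry F) ((volume.restrict J).prod volume) →
        mixedLorentzNorm p.conjExponent θ q.conjExponent φ J F < ∞ →
        ∃ G : ℝ → EuclideanSpace ℝ (Fin d) → ℂ,
          (MeasurableSet {z : ℝ × ℝ | z.1 ∈ J ∧ z.2 ∈ I z.1} →
            AEStronglyMeasurable (Function.uncurry G) ((volume.restrict J).prod volume)) ∧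
          (∀ᵐ t ∂(volume.restrict J), IsDuhamelIntegral (I t) t F (G t)) ∧
          mixedLorentzNorm p θ q φ J G ≤
            C * mixedLorentzNorm p.conjExponent θ q.conjExponent φ J F := by
  classical
  obtain ⟨C₁, hC₁⟩ := exists_lorentzNorm_le_forcingPotential d hp hq hpq hφ
  obtain ⟨C₂, hC₂⟩ := exists_lorentzNorm_forcingPotential_le hp hθ.ne'
  refine ⟨C₁ * C₂, fun J hJ I hI F₀ hF₀ hfin₀ => ?_⟩
  have hp0 : 0 < p := by linarith
  have hq0 : 0 < q := by linarith
  have hp'0 : 0 < p.conjExponent := (Real.HolderConjugate.conjExponent (by linarith)).symm.pos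
  have hq'0 : 0 < q.conjExponent := (Real.HolderConjugate.conjExponent (by linarith)).symm.pos
  have hJm := hJ.measurableSet
  -- A genuinely measurable representative, equal to the given forcing in almost every time slice.
  set F : ℝ → EuclideanSpace ℝ (Fin d) → ℂ := fun s x => hF₀.mk _ (s, x) with hFdef
  have hF : Measurable (Function.uncurry F) := hF₀.stronglyMeasurable_mk.measurable
  have hFF₀ : ∀ᵐ s ∂(volume.restrict J), F s =ᵐ[volume] F₀ s := by
    filter_upwards [Measure.ae_ae_of_ae_prod hF₀.ae_eq_mk] with s hs
    filter_upwards [hs] with x hx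
    exact hx.symm
  have hnorm : mixedLorentzNorm p.conjExponent θ q.conjExponent φ J F₀ =
      lorentzNorm p.conjExponent θ (volume.restrict J)
        (fun s => lorentzNorm q.conjExponent φ volume fun x => ‖F s x‖ₑ) := by
    refine lorentzNorm_congr_ae hp'0 ?_
    filter_upwards [hFF₀] with s hs
    refine lorentzNorm_congr_ae hq'0 ?_
    filter_upwards [hs] with x hx
    rw [hx]
  rw [hnorm] at hfin₀ ⊢
  set U := forcingPotential p q φ J (fun s x => ‖F s x‖ₑ) with hU
  have hUm : Measurable U := measurable_forcingPotential p q φ J (measurable_enorm_uncurry hF)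
  have hUle := hC₂ q φ J hJm _ (measurable_enorm_uncurry hF)
  have hUfin : ∀ᵐ t ∂(volume.restrict J), U t < ∞ :=
    ae_lt_top_of_lorentzNorm_lt_top hp0 hθ.ne'
      (hUle.trans_lt (ENNReal.mul_lt_top ENNReal.coe_lt_top hfin₀))
  have htemp : ∀ᵐ s ∂(volume.restrict J), ∃ T, IsFunction T (F s) := by
    filter_upwards [ae_lt_top_of_lorentzNorm_lt_top hp'0 hθ.ne' hfin₀] with s hs
    exact exists_isFunction_of_lorentzNorm_lt_top hq (one_pos.trans_le hφ).ne'
      (hF.comp measurable_prodMk_left) hs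
  -- The good times, of full measure in J. At all other times the solution is set to zero, which
  -- keeps its Schwartz pairings measurable in t.
  set S : Set ℝ := {t | t ∈ J ∧ U t < ∞} with hS
  have hSm : MeasurableSet S := hJm.inter (measurableSet_lt hUm measurable_const)
  have hex : ∀ t, ∃ v : EuclideanSpace ℝ (Fin d) → ℂ, WeightedMemL2 v ∧
      (t ∈ S → ∀ g : 𝓢(EuclideanSpace ℝ (Fin d), ℂ), ∫ x, g x * v x =
        ∫ z, schwartzFlow (t - z.1) g z.2 * F z.1 z.2 ∂((volume.restrict (I t)).prod volume)) ∧
      (t ∉ S → v = 0) := by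
    intro t
    by_cases ht : t ∈ S
    · obtain ⟨v, hv, hvg⟩ := exists_weightedMemL2_duhamel hp hq hpq hφ hF ht.2 (hI t ht.1).2
      exact ⟨v, hv, fun _ => hvg, fun h => absurd ht h⟩
    · exact ⟨0, (MemLp.zero (p := 2)).weightedMemL2, fun h => absurd h ht, fun _ => rfl⟩
  choose v hv hvg hv0 using hex
  have hae : ∀ᵐ t ∂(volume.restrict J), t ∈ S := by
    filter_upwards [hUfin, ae_restrict_mem hJm] with t h1 h2 using ⟨h2, h1⟩
  obtain ⟨G, hGm, hGv⟩ : ∃ G : ℝ → EuclideanSpace ℝ (Fin d) → ℂ,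
      (MeasurableSet {z : ℝ × ℝ | z.1 ∈ J ∧ z.2 ∈ I z.1} →
        AEStronglyMeasurable (Function.uncurry G) ((volume.restrict J).prod volume)) ∧
      ∀ t, G t =ᵐ[volume] v t := by
    -- A jointly measurable version is built only when the domain of integration is measurable;
    -- otherwise the pointwise choice of v is kept.
    by_cases hD : MeasurableSet {z : ℝ × ℝ | z.1 ∈ J ∧ z.2 ∈ I z.1}
    · obtain ⟨G, hG1, hG2⟩ := exists_stronglyMeasurable_uncurry
        (fun t => (hv t).locallyIntegrable) fun g => by
          set D : Set (ℝ × ℝ) := {z : ℝ × ℝ | z.1 ∈ J ∧ z.2 ∈ I z.1} with hDdef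
          have heq : (fun t => ∫ x, g x * v t x) = S.indicator fun t =>
              ∫ z : ℝ × EuclideanSpace ℝ (Fin d), {w : ℝ × (ℝ × EuclideanSpace ℝ (Fin d)) |
                (w.1, w.2.1) ∈ D}.indicator (fun w => schwartzFlow (w.1 - w.2.1) g w.2.2 *
                  F w.2.1 w.2.2) (t, z) := by
            funext t
            by_cases ht : t ∈ S
            · rw [indicator_of_mem ht, hvg t ht g]
              have hprod : (volume.restrict (I t)).prod
                  (volume : Measure (EuclideanSpace ℝ (Fin d))) =
                  (volume : Measure (ℝ × EuclideanSpace ℝ (Fin d))).restrict (I t ×ˢ univ) := by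
                rw [Measure.volume_eq_prod, ← Measure.prod_restrict, Measure.restrict_univ]
              rw [hprod, ← integral_indicator ((hI t ht.1).1.measurableSet.prod MeasurableSet.univ)]
              refine integral_congr_ae (Filter.Eventually.of_forall fun z => ?_)
              simp only [indicator_apply, mem_prod, mem_univ, and_true, mem_ofPred_eq, hDdef, ht.1,
                true_and]
            · rw [indicator_of_notMem ht, hv0 t ht]
              simp
          rw [heq]
          refine StronglyMeasurable.indicator ?_ hSm
          refine StronglyMeasurable.integral_prod_right' (Measurable.stronglyMeasurable ?_)
          refine Measurable.indicator ?_ ?_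
          · refine Measurable.mul ?_ (hF.comp measurable_snd)
            exact ((continuous_schwartzFlow g).comp (by fun_prop : Continuous
              fun w : ℝ × (ℝ × EuclideanSpace ℝ (Fin d)) => (w.1 - w.2.1, w.2.2))).measurable
          · exact (by fun_prop : Measurable
              fun w : ℝ × (ℝ × EuclideanSpace ℝ (Fin d)) => (w.1, w.2.1)) hD
      exact ⟨G, fun _ => hG1.aestronglyMeasurable, hG2⟩
    · exact ⟨v, fun h => absurd h hD, fun t => ae_eq_rfl⟩
  have hGw : ∀ t, WeightedMemL2 (G t) := fun t => (hv t).congr_ae (hGv t).symm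
  have hGg : ∀ t ∈ S, ∀ g : 𝓢(EuclideanSpace ℝ (Fin d), ℂ), ∫ x, g x * G t x =
      ∫ z, schwartzFlow (t - z.1) g z.2 * F z.1 z.2 ∂((volume.restrict (I t)).prod volume) := by
    intro t ht g
    rw [← hvg t ht g]
    refine integral_congr_ae ?_
    filter_upwards [hGv t] with x hx
    rw [hx]
  refine ⟨G, hGm, ?_, ?_⟩
  · filter_upwards [hae] with t ht
    have hsub := (hI t ht.1).2
    exact isDuhamelIntegral_of_integral_eq (hGw t) (ae_restrict_of_ae_restrict_of_subset hsub htemp)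
      (ae_restrict_of_ae_restrict_of_subset hsub hFF₀)
      (integrable_schwartzFlow_mul hp hq hpq hφ hF ht.2 hsub) (hGg t ht)
  -- Monotonicity of the Lorentz quasinorm needs no measurability, so this pointwise bound suffices
  -- for arbitrary families I(t).
  · have hpt : ∀ᵐ t ∂(volume.restrict J),
        lorentzNorm q φ volume (fun x => ‖G t x‖ₑ) ≤ C₁ * U t := by
      filter_upwards [hae] with t ht
      refine hC₁ J _ (measurable_enorm_uncurry hF) t _ (hGw t) fun g => ?_
      rw [hGg t ht g]
      refine (enorm_integral_le_lintegral_enorm _).trans ?_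
      rw [lintegral_enorm_schwartzFlow_mul hF]
      exact lintegral_mono_set (hI t ht.1).2
    refine (lorentzNorm_mono_ae hp0 hpt).trans ?_
    refine (lorentzNorm_const_mul_le hp0 hθ.ne' _).trans ?_
    push_cast
    rw [mul_assoc]
    gcongr

end Duhamel

end

/-! ### Hölder's inequality and duality in Lorentz spaces -/

noncomputable section

theorem lintegral_eq_setLIntegral_dilationMeasure (f : ℝ → ℝ≥0∞) :
    ∫⁻ b in Ioi (0 : ℝ), f b = ∫⁻ b, ENNReal.ofReal b * f b ∂dilationMeasure := by
  rw [lintegral_dilationMeasure]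
  refine setLIntegral_congr_fun measurableSet_Ioi fun b hb => ?_
  have hb : 0 < b := hb
  rw [← mul_assoc, ← ENNReal.ofReal_mul (by positivity), one_div_mul_cancel hb.ne',
    ENNReal.ofReal_one, one_mul]

theorem lintegral_mul_le_eLpNorm_two {α : Type*} [MeasurableSpace α] {μ : Measure α}
    {f g : α → ℝ≥0∞} (hf : AEMeasurable f μ) (hg : AEMeasurable g μ) :
    ∫⁻ x, f x * g x ∂μ ≤ eLpNorm f 2 μ * eLpNorm g 2 μ := by
  have h := ENNReal.lintegral_mul_le_Lp_mul_Lq μ Real.HolderConjugate.two_two hf hg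
  simpa [eLpNorm_eq_lintegral_rpow_enorm_toReal] using h

section Rearrangement

variable {α : Type*} [MeasurableSpace α] {μ : Measure α}

/-- At level l, the measure of A ∩ {k > l} is at most both μ(A) and μ{k > l}. The minimum of the two
is an integral over b of a product of indicators, and integrating over l turns the second indicator
into k*(b). -/
theorem setLIntegral_le_setLIntegral_rearr [SFinite μ] {k : α → ℝ≥0∞} (hk : Measurable k)
    (A : Set α) : ∫⁻ x in A, k x ∂μ ≤
      ∫⁻ b in Ioi (0 : ℝ), {b | ENNReal.ofReal b < μ A}.indicator
        (fun b => rearr μ k (ENNReal.ofReal b)) b := by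
  have h1 : ∫⁻ x in A, k x ∂μ = ∫⁻ l in Ioi (0 : ℝ), (μ.restrict A) {x | ENNReal.ofReal l < k x} := by
    have := lintegral_mul_eq_lintegral_lt (μ := μ.restrict A) hk measurable_one
    simpa using this
  have h2 : ∀ l : ℝ, (μ.restrict A) {x | ENNReal.ofReal l < k x} ≤
      ∫⁻ b in Ioi (0 : ℝ), {b | ENNReal.ofReal b < μ A}.indicator 1 b *
        {b | ENNReal.ofReal l < rearr μ k (ENNReal.ofReal b)}.indicator 1 b := by
    intro l
    rw [Measure.restrict_apply (measurableSet_lt measurable_const hk),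
      ← lintegral_Ioi_indicator_lt (μ _)]
    refine lintegral_mono fun b => ?_
    by_cases hb : ENNReal.ofReal b < μ ({x | ENNReal.ofReal l < k x} ∩ A)
    · rw [indicator_of_mem (by exact hb), indicator_of_mem, indicator_of_mem]
      · simp
      · exact lt_rearr_iff.2 (hb.trans_le (measure_mono inter_subset_left))
      · exact hb.trans_le (measure_mono inter_subset_right)
    · rw [indicator_of_notMem (by exact hb)]
      exact zero_le
  have hm1 : Measurable fun b : ℝ => rearr μ k (ENNReal.ofReal b) :=
    measurable_rearr.comp ENNReal.measurable_ofReal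
  have hm2 : MeasurableSet {b : ℝ | ENNReal.ofReal b < μ A} :=
    measurableSet_lt ENNReal.measurable_ofReal measurable_const
  rw [h1]
  refine (lintegral_mono h2).trans ?_
  have hjoint : Measurable fun z : ℝ × ℝ => {b | ENNReal.ofReal b < μ A}.indicator (1 : ℝ → ℝ≥0∞) z.2 *
      {b | ENNReal.ofReal z.1 < rearr μ k (ENNReal.ofReal b)}.indicator 1 z.2 := by
    refine ((measurable_one.indicator hm2).comp measurable_snd).mul ?_
    exact measurable_one.indicator (measurableSet_lt
      (ENNReal.measurable_ofReal.comp measurable_fst) (hm1.comp measurable_snd))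
  rw [lintegral_lintegral_swap hjoint.aemeasurable]
  refine lintegral_mono fun b => ?_
  rw [lintegral_const_mul]
  · have h3 := lintegral_Ioi_indicator_lt (rearr μ k (ENNReal.ofReal b))
    have h4 : ∀ l : ℝ, {b | ENNReal.ofReal l < rearr μ k (ENNReal.ofReal b)}.indicator
        (1 : ℝ → ℝ≥0∞) b =
        {l | ENNReal.ofReal l < rearr μ k (ENNReal.ofReal b)}.indicator 1 l := fun l => rfl
    simp only [h4]
    rw [h3]
    by_cases hb : b ∈ {b | ENNReal.ofReal b < μ A}
    · simp [indicator_of_mem hb]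
    · simp [indicator_of_notMem hb]
  · exact measurable_one.indicator (measurableSet_lt ENNReal.measurable_ofReal measurable_const)

/-- The Hardy–Littlewood rearrangement inequality. -/
theorem lintegral_mul_le_setLIntegral_rearr [SFinite μ] {h k : α → ℝ≥0∞} (hh : Measurable h)
    (hk : Measurable k) : ∫⁻ x, h x * k x ∂μ ≤
      ∫⁻ b in Ioi (0 : ℝ), rearr μ h (ENNReal.ofReal b) * rearr μ k (ENNReal.ofReal b) := by
  have hm : ∀ h : α → ℝ≥0∞, Measurable fun b : ℝ => rearr μ h (ENNReal.ofReal b) := fun h =>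
    measurable_rearr.comp ENNReal.measurable_ofReal
  rw [lintegral_mul_eq_lintegral_lt hh hk]
  refine (lintegral_mono fun l => setLIntegral_le_setLIntegral_rearr hk _).trans ?_
  have h1 : ∀ l b : ℝ, {b | ENNReal.ofReal b < μ {x | ENNReal.ofReal l < h x}}.indicator
      (fun b => rearr μ k (ENNReal.ofReal b)) b =
      {l | ENNReal.ofReal l < rearr μ h (ENNReal.ofReal b)}.indicator 1 l *
        rearr μ k (ENNReal.ofReal b) := by
    intro l b
    by_cases hb : ENNReal.ofReal b < μ {x | ENNReal.ofReal l < h x}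
    · rw [indicator_of_mem (by exact hb), indicator_of_mem (by exact lt_rearr_iff.2 hb)]
      simp
    · rw [indicator_of_notMem (by exact hb), indicator_of_notMem (by
        exact fun hl => hb (lt_rearr_iff.1 hl)), zero_mul]
  simp only [h1]
  have hjoint : Measurable fun z : ℝ × ℝ =>
      {l | ENNReal.ofReal l < rearr μ h (ENNReal.ofReal z.2)}.indicator (1 : ℝ → ℝ≥0∞) z.1 *
        rearr μ k (ENNReal.ofReal z.2) := by
    refine Measurable.mul ?_ ((hm k).comp measurable_snd)
    exact measurable_one.indicator (measurableSet_lt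
      (ENNReal.measurable_ofReal.comp measurable_fst) ((hm h).comp measurable_snd))
  rw [lintegral_lintegral_swap hjoint.aemeasurable]
  refine lintegral_mono fun b => ?_
  rw [lintegral_mul_const, lintegral_Ioi_indicator_lt]
  exact measurable_one.indicator (measurableSet_lt ENNReal.measurable_ofReal measurable_const)

/-- Hölder's inequality in Lorentz spaces. -/
theorem lintegral_mul_le_lorentzNorm [SFinite μ] {q : ℝ} (hq : 1 < q) {h k : α → ℝ≥0∞}
    (hh : Measurable h) (hk : Measurable k) :
    ∫⁻ x, h x * k x ∂μ ≤ lorentzNorm q 2 μ h * lorentzNorm q.conjExponent 2 μ k := by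
  have hc := Real.HolderConjugate.conjExponent hq
  rw [lorentzNorm_eq_eLpNorm_rearr hc.pos (by simp),
    lorentzNorm_eq_eLpNorm_rearr hc.symm.pos (by simp)]
  refine le_trans ?_ (lintegral_mul_le_eLpNorm_two (measurable_rpow_mul_rearr _).aemeasurable
    (measurable_rpow_mul_rearr _).aemeasurable)
  refine (lintegral_mul_le_setLIntegral_rearr hh hk).trans ?_
  rw [lintegral_eq_setLIntegral_dilationMeasure]
  refine lintegral_mono_ae ?_
  filter_upwards [ae_dilationMeasure_pos] with b hb
  have h1 : ENNReal.ofReal b = ENNReal.ofReal b ^ (1 / q) * ENNReal.ofReal b ^ (1 / q.conjExponent) := by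
    rw [← ENNReal.rpow_add _ _ (by simpa using hb) ENNReal.ofReal_ne_top, one_div, one_div,
      hc.inv_add_inv_eq_one, ENNReal.rpow_one]
  nth_rewrite 1 [h1]
  apply le_of_eq
  ring

theorem rearr_iSup_le {h : ℕ → α → ℝ≥0∞} (hmono : Monotone h) (b : ℝ≥0∞) :
    rearr μ (fun x => ⨆ k, h k x) b ≤ ⨆ k, rearr μ (h k) b := by
  refine le_of_forall_lt fun l hl => ?_
  rw [lt_rearr_iff] at hl
  have hU : {x | l < ⨆ k, h k x} = ⋃ k, {x | l < h k x} := by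
    ext x
    simp [lt_iSup_iff]
  have hmonoU : Monotone fun k => {x | l < h k x} := fun i j hij x hx =>
    lt_of_lt_of_le (by exact hx) (hmono hij x)
  rw [hU, hmonoU.measure_iUnion, lt_iSup_iff] at hl
  obtain ⟨k, hk⟩ := hl
  exact (lt_rearr_iff.2 hk).trans_le (le_iSup (fun k => rearr μ (h k) b) k)

theorem rearr_mono {h h' : α → ℝ≥0∞} (hh : h ≤ h') (b : ℝ≥0∞) : rearr μ h b ≤ rearr μ h' b :=
  le_of_forall_lt fun _ hl => lt_rearr_iff.2 ((lt_rearr_iff.1 hl).trans_le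
    (measure_mono fun x hx => lt_of_lt_of_le hx (hh x)))

theorem eLpNorm_iSup_le {ν : Measure α} {r : ℝ≥0∞} (h0 : r ≠ 0) (ht : r ≠ ∞)
    {f : ℕ → α → ℝ≥0∞} (hf : ∀ k, Measurable (f k)) (hmono : Monotone f) {C : ℝ≥0∞}
    (hC : ∀ k, eLpNorm (f k) r ν ≤ C) : eLpNorm (fun x => ⨆ k, f k x) r ν ≤ C := by
  have hr := ENNReal.toReal_pos h0 ht
  simp only [eLpNorm_eq_lintegral_rpow_enorm_toReal h0 ht, enorm_eq_self, one_div,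
    ENNReal.rpow_inv_le_iff hr] at hC ⊢
  have h1 : ∀ x, (⨆ k, f k x) ^ r.toReal = ⨆ k, f k x ^ r.toReal := fun x =>
    (ENNReal.orderIsoRpow r.toReal hr).map_iSup fun k => f k x
  simp only [h1]
  rw [lintegral_iSup (fun k => (hf k).pow_const _) fun i j hij x =>
    ENNReal.rpow_le_rpow (hmono hij x) hr.le]
  exact iSup_le hC

/-- Monotone convergence in Lorentz spaces. -/
theorem lorentzNorm_iSup_le {p : ℝ} (hp : 0 < p) {r : ℝ≥0∞} (h0 : r ≠ 0) (ht : r ≠ ∞)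
    {h : ℕ → α → ℝ≥0∞} (hmono : Monotone h) {C : ℝ≥0∞}
    (hC : ∀ k, lorentzNorm p r μ (h k) ≤ C) : lorentzNorm p r μ (fun x => ⨆ k, h k x) ≤ C := by
  refine (lorentzNorm_le_of_rearr_le hp h0 fun b _ => rearr_iSup_le hmono _).trans ?_
  simp only [ENNReal.mul_iSup]
  refine eLpNorm_iSup_le h0 ht (fun k => measurable_rpow_mul_rearr _)
    (fun i j hij b => mul_le_mul_right (rearr_mono (hmono hij) _) _) fun k => ?_
  rw [← lorentzNorm_eq_eLpNorm_rearr hp h0]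
  exact hC k

/-- The function dual to `h` in the pairing of `L^{q,2}` with `L^{q',2}`. -/
def lorentzDual (q : ℝ) (μ : Measure α) (h : α → ℝ≥0∞) (x : α) : ℝ≥0∞ :=
  ∫⁻ l in Ioi (0 : ℝ), {l | ENNReal.ofReal l < h x}.indicator
    (fun l => μ {y | ENNReal.ofReal l < h y} ^ (2 / q - 1)) l

theorem measurable_lorentzDual {β : Type*} [MeasurableSpace β] [SFinite μ] (q : ℝ)
    {H : β → α → ℝ≥0∞} (hH : Measurable (Function.uncurry H)) :
    Measurable (Function.uncurry fun s => lorentzDual q μ (H s)) := by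
  have hset : MeasurableSet {w : (β × ℝ) × α | ENNReal.ofReal w.1.2 < H w.1.1 w.2} :=
    measurableSet_lt (ENNReal.measurable_ofReal.comp (by fun_prop))
      (hH.comp ((measurable_fst.comp measurable_fst).prodMk measurable_snd))
  have hm : Measurable fun z : β × ℝ => μ {a | ENNReal.ofReal z.2 < H z.1 a} :=
    measurable_measure_prodMk_left hset
  have hjoint : Measurable fun w : (β × α) × ℝ =>
      {w : (β × α) × ℝ | ENNReal.ofReal w.2 < H w.1.1 w.1.2}.indicator
        (fun w => μ {y | ENNReal.ofReal w.2 < H w.1.1 y} ^ (2 / q - 1)) w := by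
    refine Measurable.indicator (Measurable.pow_const ?_ _)
      (measurableSet_lt (ENNReal.measurable_ofReal.comp measurable_snd)
        (hH.comp measurable_fst))
    exact hm.comp ((measurable_fst.comp measurable_fst).prodMk measurable_snd)
  exact Measurable.lintegral_prod_right' hjoint

/-- Outside {h > h*(b)}, a set of measure at most b, every level l < h(x) lies below h*(b) and so
has distribution function above b. The exponent 2/q - 1 is negative, hence the integrand is at most
b^(2/q-1) on an interval of length at most h*(b). -/
theorem rearr_lorentzDual_le {q : ℝ} (hq : 2 < q) {h : α → ℝ≥0∞} (b : ℝ≥0∞) :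
    rearr μ (lorentzDual q μ h) b ≤ b ^ (2 / q - 1) * rearr μ h b := by
  refine sInf_le ((measure_mono fun x hx => ?_).trans (measure_lt_rearr_le (μ := μ) (h := h) b))
  by_contra hle
  rw [mem_ofPred_eq, not_lt] at hle
  rw [mem_ofPred_eq] at hx
  refine absurd hx (not_lt.2 ?_)
  have hexp : 2 / q - 1 ≤ 0 := by
    have : 2 / q < 1 := (div_lt_one (by linarith)).2 hq
    linarith
  calc lorentzDual q μ h x ≤ ∫⁻ l in Ioi (0 : ℝ), b ^ (2 / q - 1) *
        {l | ENNReal.ofReal l < rearr μ h b}.indicator 1 l := by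
        refine lintegral_mono fun l => ?_
        by_cases hl : ENNReal.ofReal l < h x
        · have hl' := hl.trans_le hle
          rw [indicator_of_mem (by exact hl), indicator_of_mem (by exact hl'), Pi.one_apply, mul_one]
          have h1 := ENNReal.inv_le_inv.2 (ENNReal.rpow_le_rpow (lt_rearr_iff.1 hl').le
            (neg_nonneg.2 hexp))
          rwa [← ENNReal.rpow_neg, ← ENNReal.rpow_neg, neg_neg] at h1
        · rw [indicator_of_notMem (by exact hl)]
          exact zero_le
    _ = _ := by
        rw [lintegral_const_mul, lintegral_Ioi_indicator_lt]
        exact measurable_one.indicator (measurableSet_lt ENNReal.measurable_ofReal measurable_const)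

/-- The weights agree exactly because 1/q' + 2/q - 1 = 1/q. -/
theorem lorentzNorm_lorentzDual_le {q : ℝ} (hq : 2 < q) (h : α → ℝ≥0∞) :
    lorentzNorm q.conjExponent 2 μ (lorentzDual q μ h) ≤ lorentzNorm q 2 μ h := by
  have hc := Real.HolderConjugate.conjExponent (show 1 < q by linarith)
  refine (lorentzNorm_le_of_rearr_le hc.symm.pos (by simp) fun b _ =>
    rearr_lorentzDual_le hq _).trans ?_
  rw [lorentzNorm_eq_eLpNorm_rearr hc.pos (by simp)]
  refine eLpNorm_mono_enorm_ae ?_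
  filter_upwards [ae_dilationMeasure_pos] with b hb
  simp only [enorm_eq_self]
  rw [← mul_assoc, ← ENNReal.rpow_add _ _ (by simpa using hb) ENNReal.ofReal_ne_top]
  have : 1 / q.conjExponent + (2 / q - 1) = 1 / q := by
    have := hc.inv_add_inv_eq_one
    simp only [div_eq_mul_inv, one_mul] at this ⊢
    linarith
  rw [this]

/-- By Tonelli the pairing is the integral over l of m(l)^(2/q-1) times the integral of h over {h >
l}. The latter is at least l · m(l), which leaves ∫ l m(l)^(2/q) dl, the squared norm divided by q.
-/
theorem lorentzNorm_two_sq_le [SFinite μ] {q : ℝ} (hq : 2 < q) {h : α → ℝ≥0∞} (hh : Measurable h)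
    (hfin : lorentzNorm q 2 μ h < ∞) :
    lorentzNorm q 2 μ h ^ 2 ≤ ENNReal.ofReal q * ∫⁻ x, h x * lorentzDual q μ h x ∂μ := by
  have hq0 : 0 < q := by linarith
  set m : ℝ → ℝ≥0∞ := fun l => μ {x | ENNReal.ofReal l < h x} with hm
  have hmm : Measurable m := measurable_measure_lt.comp ENNReal.measurable_ofReal
  have hgm : Measurable fun l : ℝ => ENNReal.ofReal l * m l ^ (1 / q) :=
    ENNReal.measurable_ofReal.mul (hmm.pow_const _)
  -- Finiteness of m(l) is needed to combine m · m^(2/q-1) into m^(2/q); at m = ∞ the negative power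
  -- vanishes.
  have hmfin : ∀ᵐ l ∂dilationMeasure, m l < ∞ := by
    have h1 : eLpNorm (fun l : ℝ => ENNReal.ofReal l * m l ^ (1 / q)) 2 dilationMeasure < ∞ := by
      rw [lorentzNorm] at hfin
      refine lt_top_iff_ne_top.2 fun htop => ?_
      rw [show eLpNorm (fun l : ℝ => ENNReal.ofReal l * μ {x | ENNReal.ofReal l < h x} ^ (1 / q)) 2
        dilationMeasure = ∞ from htop, ENNReal.mul_top] at hfin
      · exact lt_irrefl _ hfin
      · exact (ENNReal.rpow_pos (by simpa using hq0) ENNReal.ofReal_ne_top).ne'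
    filter_upwards [ae_lt_top_of_eLpNorm_lt_top hgm (by simp) h1, ae_dilationMeasure_pos] with l hl hl0
    refine lt_top_iff_ne_top.2 fun htop => ?_
    rw [htop, ENNReal.top_rpow_of_pos (by positivity), ENNReal.mul_top (by simpa using hl0)] at hl
    exact lt_irrefl _ hl
  have hL : lorentzNorm q 2 μ h ^ 2 =
      ENNReal.ofReal q * ∫⁻ l, ENNReal.ofReal l ^ 2 * m l ^ (2 / q) ∂dilationMeasure := by
    rw [lorentzNorm, eLpNorm_dilationMeasure_eq_lintegral (by simp) (by simp), mul_pow,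
      ← ENNReal.rpow_natCast, ← ENNReal.rpow_natCast, ← ENNReal.rpow_mul, ← ENNReal.rpow_mul]
    simp only [ENNReal.toReal_inv, ENNReal.toReal_ofNat, Nat.cast_ofNat, ENNReal.rpow_ofNat, mul_pow]
    norm_num
    congr 1
    refine lintegral_congr fun l => ?_
    congr 1
    rw [← ENNReal.rpow_natCast, ← ENNReal.rpow_mul]
    congr 1
    push_cast
    ring
  rw [hL]
  gcongr
  have hjoint : Measurable fun z : α × ℝ => h z.1 * {l | ENNReal.ofReal l < h z.1}.indicator
      (fun l => m l ^ (2 / q - 1)) z.2 := by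
    refine (hh.comp measurable_fst).mul ?_
    have : Measurable fun z : α × ℝ => {z : α × ℝ | ENNReal.ofReal z.2 < h z.1}.indicator
        (fun z => m z.2 ^ (2 / q - 1)) z :=
      Measurable.indicator ((hmm.comp measurable_snd).pow_const _)
        (measurableSet_lt (ENNReal.measurable_ofReal.comp measurable_snd) (hh.comp measurable_fst))
    exact this
  have hE : ∫⁻ x, h x * lorentzDual q μ h x ∂μ = ∫⁻ l in Ioi (0 : ℝ),
      (∫⁻ x, h x * {l | ENNReal.ofReal l < h x}.indicator (fun l => m l ^ (2 / q - 1)) l ∂μ) := by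
    rw [← lintegral_lintegral_swap hjoint.aemeasurable]
    refine lintegral_congr fun x => ?_
    rw [lorentzDual, ← lintegral_const_mul]
    exact (hmm.pow_const _).indicator (measurableSet_lt ENNReal.measurable_ofReal measurable_const)
  rw [hE, lintegral_eq_setLIntegral_dilationMeasure]
  refine lintegral_mono_ae ?_
  filter_upwards [hmfin, ae_dilationMeasure_pos] with l hl hl0
  have hAm : MeasurableSet {x | ENNReal.ofReal l < h x} := measurableSet_lt measurable_const hh
  have h2 : ENNReal.ofReal l * (m l * m l ^ (2 / q - 1)) ≤
      ∫⁻ x, h x * {l | ENNReal.ofReal l < h x}.indicator (fun l => m l ^ (2 / q - 1)) l ∂μ := by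
    calc ENNReal.ofReal l * (m l * m l ^ (2 / q - 1))
        = ∫⁻ x in {x | ENNReal.ofReal l < h x}, ENNReal.ofReal l * m l ^ (2 / q - 1) ∂μ := by
          rw [setLIntegral_const]
          ring
      _ = ∫⁻ x, {x | ENNReal.ofReal l < h x}.indicator
          (fun _ => ENNReal.ofReal l * m l ^ (2 / q - 1)) x ∂μ := (lintegral_indicator hAm _).symm
      _ ≤ _ := by
          refine lintegral_mono fun x => ?_
          by_cases hx : ENNReal.ofReal l < h x
          · rw [indicator_of_mem (by exact hx), indicator_of_mem (by exact hx)]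
            gcongr
          · rw [indicator_of_notMem (by exact hx)]
            exact zero_le
  refine le_trans (le_of_eq ?_) (mul_le_mul_right h2 _)
  rcases eq_or_ne (m l) 0 with h0 | h0
  · rw [h0, ENNReal.zero_rpow_of_pos (by positivity)]
    simp
  · rw [ENNReal.self_mul_rpow h0 hl.ne, add_sub_cancel]
    ring

end Rearrangement

end

/-! ### The flow on L² and its jointly measurable versions -/

noncomputable section

section FlowL2

open FourierTransform

variable {d : ℕ}

local notation "ℝᵈ" => EuclideanSpace ℝ (Fin d)

/-- Complex conjugation of Schwartz functions. -/
def conjSchwartz (u : 𝓢(ℝᵈ, ℂ)) : 𝓢(ℝᵈ, ℂ) :=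
  SchwartzMap.postcompCLM (Complex.conjCLE : ℂ →L[ℝ] ℂ) u

theorem conjSchwartz_apply (u : 𝓢(ℝᵈ, ℂ)) (x : ℝᵈ) :
    conjSchwartz u x = starRingEnd ℂ (u x) := rfl

theorem conj_fourierChar_smul (a : ℝ) (z : ℂ) :
    starRingEnd ℂ (Real.fourierChar a • z) = Real.fourierChar (-a) • starRingEnd ℂ z := by
  simp only [Circle.smul_def, smul_eq_mul, map_mul]
  rw [AddChar.map_neg_eq_inv, Circle.coe_inv_eq_conj]

theorem fourierInv_conjSchwartz (u : 𝓢(ℝᵈ, ℂ)) (ξ : ℝᵈ) :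
    (𝓕⁻ (conjSchwartz u)) ξ = starRingEnd ℂ ((𝓕⁻ u) (-ξ)) := by
  rw [SchwartzMap.fourierInv_coe, SchwartzMap.fourierInv_coe, Real.fourierInv_eq,
    Real.fourierInv_eq, ← integral_conj]
  refine integral_congr_ae (Filter.Eventually.of_forall fun v => ?_)
  simp only [conj_fourierChar_smul, inner_neg_right, neg_neg, conjSchwartz_apply]

theorem conj_schrodingerSymbol_neg (τ : ℝ) (ξ : ℝᵈ) :
    starRingEnd ℂ (schrodingerSymbol (-τ) (-ξ)) = schrodingerSymbol τ ξ := by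
  rw [schrodingerSymbol, schrodingerSymbol, ← Complex.exp_conj, map_mul, Complex.conj_I,
    Complex.conj_ofReal, norm_neg]
  congr 1
  push_cast
  ring

theorem schwartzFlow_conjSchwartz (τ : ℝ) (u : 𝓢(ℝᵈ, ℂ)) (x : ℝᵈ) :
    schwartzFlow τ (conjSchwartz u) x = starRingEnd ℂ (schwartzFlow (-τ) u x) := by
  rw [schwartzFlow_apply, schwartzFlow_apply, ← integral_conj, ← integral_neg_eq_self]
  refine integral_congr_ae (Filter.Eventually.of_forall fun ξ => ?_)
  simp only [fourierInv_conjSchwartz, conj_fourierChar_smul, map_mul, inner_neg_left, neg_neg]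
  rw [← conj_schrodingerSymbol_neg τ (-ξ), neg_neg]

theorem schwartzFlow_zero (u : 𝓢(ℝᵈ, ℂ)) : schwartzFlow 0 u = u := by
  have h1 : SchwartzMap.smulLeftCLM ℂ (schrodingerSymbol (d := d) 0) (𝓕⁻ u) = 𝓕⁻ u := by
    ext ξ
    rw [SchwartzMap.smulLeftCLM_apply_apply (schrodingerSymbol_hasTemperateGrowth 0)]
    simp [schrodingerSymbol]
  rw [schwartzFlow, h1, fourier_fourierInv_eq]

/-- The adjoint for the inner product is the flow at time -τ, and conjugation reverses time once
more, so the flow is symmetric for the bilinear pairing. This identifies the L² extension with the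
distributional propagator. -/
theorem integral_mul_schwartzFlow (τ : ℝ) (g h : 𝓢(ℝᵈ, ℂ)) :
    ∫ x, g x * schwartzFlow τ h x = ∫ x, schwartzFlow τ g x * h x := by
  have h1 := integral_conj_schwartzFlow_mul τ 0 (conjSchwartz g) h
  simpa [schwartzFlow_zero, schwartzFlow_conjSchwartz, conjSchwartz_apply] using h1

/-- The propagator on Schwartz functions as a linear map. -/
def schwartzFlowLinear (τ : ℝ) : 𝓢(ℝᵈ, ℂ) →ₗ[ℂ] 𝓢(ℝᵈ, ℂ) where
  toFun := schwartzFlow τ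
  map_add' u v := by
    ext x
    exact schwartzFlow_add_apply τ u v x
  map_smul' c u := by
    ext x
    exact schwartzFlow_smul_apply τ c u x

/-- The embedding of Schwartz functions into `L²`. -/
def schwartzToL2 : 𝓢(ℝᵈ, ℂ) →ₗ[ℂ] Lp ℂ 2 (volume : Measure ℝᵈ) :=
  (SchwartzMap.toLpCLM ℂ ℂ 2 (volume : Measure ℝᵈ)).toLinearMap

theorem coeFn_schwartzToL2 (g : 𝓢(ℝᵈ, ℂ)) : schwartzToL2 g =ᵐ[volume] g :=
  g.coeFn_toLp 2 volume

theorem denseRange_schwartzToL2 : DenseRange (schwartzToL2 (d := d)) :=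
  SchwartzMap.denseRange_toLpCLM (by simp)

theorem enorm_schwartzToL2 (g : 𝓢(ℝᵈ, ℂ)) : ‖schwartzToL2 g‖ₑ = eLpNorm g 2 volume := by
  rw [Lp.enorm_def]
  exact eLpNorm_congr_ae (coeFn_schwartzToL2 g)

theorem norm_schwartzToL2_schwartzFlow (τ : ℝ) (g : 𝓢(ℝᵈ, ℂ)) :
    ‖schwartzToL2 (schwartzFlow τ g)‖ = ‖schwartzToL2 g‖ := by
  rw [← toReal_enorm, ← toReal_enorm, enorm_schwartzToL2, enorm_schwartzToL2,
    eLpNorm_schwartzFlow_two]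

/-- The propagator on `L²`. -/
def flowL2 (τ : ℝ) : Lp ℂ 2 (volume : Measure ℝᵈ) →L[ℂ] Lp ℂ 2 (volume : Measure ℝᵈ) :=
  (schwartzToL2 ∘ₗ schwartzFlowLinear τ).extendOfNorm schwartzToL2

theorem norm_comp_schwartzFlowLinear_le (τ : ℝ) (g : 𝓢(ℝᵈ, ℂ)) :
    ‖(schwartzToL2 ∘ₗ schwartzFlowLinear τ) g‖ ≤ 1 * ‖schwartzToL2 g‖ := by
  rw [one_mul]
  exact (norm_schwartzToL2_schwartzFlow τ g).le

theorem flowL2_schwartzToL2 (τ : ℝ) (g : 𝓢(ℝᵈ, ℂ)) :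
    flowL2 τ (schwartzToL2 g) = schwartzToL2 (schwartzFlow τ g) :=
  LinearMap.extendOfNorm_eq denseRange_schwartzToL2 ⟨1, norm_comp_schwartzFlowLinear_le τ⟩ g

theorem norm_flowL2_le (τ : ℝ) (f : Lp ℂ 2 (volume : Measure ℝᵈ)) : ‖flowL2 τ f‖ ≤ ‖f‖ := by
  have := LinearMap.norm_extendOfNorm_apply_le denseRange_schwartzToL2 1
    (norm_comp_schwartzFlowLinear_le τ) f
  rwa [one_mul] at this

theorem inner_schwartzToL2_conjSchwartz (g : 𝓢(ℝᵈ, ℂ)) (f : Lp ℂ 2 (volume : Measure ℝᵈ)) :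
    inner ℂ (schwartzToL2 (conjSchwartz g)) f = ∫ x, g x * f x := by
  rw [L2.inner_def]
  refine integral_congr_ae ?_
  filter_upwards [coeFn_schwartzToL2 (conjSchwartz g)] with x hx
  rw [hx, RCLike.inner_apply, conjSchwartz_apply, Complex.conj_conj, mul_comm]

theorem integral_mul_flowL2 (τ : ℝ) (g : 𝓢(ℝᵈ, ℂ)) (f : Lp ℂ 2 (volume : Measure ℝᵈ)) :
    ∫ x, g x * flowL2 τ f x = ∫ x, schwartzFlow τ g x * f x := by
  rw [← inner_schwartzToL2_conjSchwartz, ← inner_schwartzToL2_conjSchwartz]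
  refine isClosed_property denseRange_schwartzToL2 (p := fun f =>
    inner ℂ (schwartzToL2 (conjSchwartz g)) (flowL2 τ f) =
      inner ℂ (schwartzToL2 (conjSchwartz (schwartzFlow τ g))) f)
    (isClosed_eq (by fun_prop) (by fun_prop)) (fun h => ?_) f
  rw [flowL2_schwartzToL2, inner_schwartzToL2_conjSchwartz, inner_schwartzToL2_conjSchwartz]
  have h1 : ∀ a b : 𝓢(ℝᵈ, ℂ), ∫ x, a x * schwartzToL2 b x = ∫ x, a x * b x := by
    intro a b
    refine integral_congr_ae ?_
    filter_upwards [coeFn_schwartzToL2 b] with x hx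
    rw [hx]
  rw [h1, h1, integral_mul_schwartzFlow]

/-- `u` is a jointly measurable version of the flow of `f`. -/
structure IsFlowVersion (f : Lp ℂ 2 (volume : Measure ℝᵈ)) (u : ℝ → ℝᵈ → ℂ) : Prop where
  measurable : Measurable (Function.uncurry u)
  ae_eq : ∀ t, u t =ᵐ[volume] flowL2 t f

theorem exists_isFlowVersion (f : Lp ℂ 2 (volume : Measure ℝᵈ)) : ∃ u, IsFlowVersion f u := by
  obtain ⟨G, hG1, hG2⟩ := exists_stronglyMeasurable_uncurry (v := fun t => flowL2 t f)
    (fun t => (Lp.memLp (flowL2 t f)).locallyIntegrable (by norm_num)) fun g => by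
      simp only [integral_mul_flowL2]
      refine StronglyMeasurable.integral_prod_right'
        (f := fun z : ℝ × ℝᵈ => schwartzFlow z.1 g z.2 * f z.2) ?_
      exact (continuous_schwartzFlow g).stronglyMeasurable.mul
        ((Lp.stronglyMeasurable f).comp_measurable measurable_snd)
  exact ⟨G, hG1.measurable, hG2⟩

theorem isFlowVersion_schwartzFlow (g : 𝓢(ℝᵈ, ℂ)) :
    IsFlowVersion (schwartzToL2 g) fun t => schwartzFlow t g :=
  ⟨(continuous_schwartzFlow g).measurable, fun t => by
    rw [flowL2_schwartzToL2]
    exact (coeFn_schwartzToL2 _).symm⟩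

variable {f : Lp ℂ 2 (volume : Measure (EuclideanSpace ℝ (Fin d)))}
  {u : ℝ → EuclideanSpace ℝ (Fin d) → ℂ}

theorem IsFlowVersion.memLp (h : IsFlowVersion f u) (t : ℝ) : MemLp (u t) 2 volume :=
  (memLp_congr_ae (h.ae_eq t)).2 (Lp.memLp _)

theorem IsFlowVersion.eLpNorm_le (h : IsFlowVersion f u) (t : ℝ) :
    eLpNorm (u t) 2 volume ≤ ‖f‖ₑ := by
  rw [eLpNorm_congr_ae (h.ae_eq t), ← Lp.enorm_def, ← ofReal_norm, ← ofReal_norm]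
  exact ENNReal.ofReal_le_ofReal (norm_flowL2_le t f)

theorem IsFlowVersion.sub {f' : Lp ℂ 2 (volume : Measure ℝᵈ)} {u' : ℝ → ℝᵈ → ℂ}
    (h : IsFlowVersion f u) (h' : IsFlowVersion f' u') :
    IsFlowVersion (f - f') fun t x => u t x - u' t x := by
  refine ⟨h.measurable.sub h'.measurable, fun t => ?_⟩
  rw [map_sub]
  filter_upwards [h.ae_eq t, h'.ae_eq t, Lp.coeFn_sub (flowL2 t f) (flowL2 t f')] with x h1 h2 h3
  rw [h3, h1, h2, Pi.sub_apply]

theorem IsFlowVersion.integral_mul (h : IsFlowVersion f u) (t : ℝ) (g : 𝓢(ℝᵈ, ℂ)) :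
    ∫ x, g x * u t x = ∫ x, schwartzFlow t g x * f x := by
  rw [← integral_mul_flowL2]
  refine integral_congr_ae ?_
  filter_upwards [h.ae_eq t] with x hx
  rw [hx]

theorem IsFlowVersion.isFunction (h : IsFlowVersion f u) (t : ℝ) :
    IsFunction (freeFlow t (Lp.toTemperedDistribution f)) (u t) := by
  intro g
  refine ⟨(h.memLp t).weightedMemL2.integrable_mul g, ?_⟩
  rw [h.integral_mul, freeFlow_apply, Lp.toTemperedDistribution_apply]
  rfl

end FlowL2

end

/-! ### Norming functions for the mixed norm, and truncations -/

noncomputable section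

section DualTest

variable {α β : Type*} [MeasurableSpace α] [MeasurableSpace β]

theorem lorentzNorm_two_indicator_const_lt_top {μ : Measure α} {p : ℝ} (hp : 0 < p) {s : Set α}
    (hs : μ s ≠ ∞) {c : ℝ≥0∞} (hc : c ≠ ∞) :
    lorentzNorm p 2 μ (s.indicator fun _ => c) < ∞ := by
  have hle : ∀ l : ℝ, ENNReal.ofReal l * μ {x | ENNReal.ofReal l < s.indicator (fun _ => c) x} ^ (1 / p) ≤
      μ s ^ (1 / p) * {l | ENNReal.ofReal l < c}.indicator (fun l => ENNReal.ofReal l) l := by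
    intro l
    by_cases hl : ENNReal.ofReal l < c
    · rw [indicator_of_mem (by exact hl), mul_comm]
      gcongr
      intro x hx
      by_contra hxs
      rw [mem_ofPred_eq, indicator_of_notMem hxs] at hx
      exact absurd hx not_lt_zero
    · have : {x | ENNReal.ofReal l < s.indicator (fun _ => c) x} = ∅ := by
        ext x
        simp only [mem_ofPred_eq, mem_empty_iff_false, iff_false]
        exact fun hx => hl (hx.trans_le (indicator_le_self' (fun _ _ => zero_le) x))
      rw [this, measure_empty, ENNReal.zero_rpow_of_pos (by positivity), mul_zero]
      exact zero_le
  have hm : Measurable fun l : ℝ => {l | ENNReal.ofReal l < c}.indicator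
      (fun l => ENNReal.ofReal l) l := ENNReal.measurable_ofReal.indicator
    (measurableSet_lt ENNReal.measurable_ofReal measurable_const)
  have hfin : eLpNorm (fun l : ℝ => {l | ENNReal.ofReal l < c}.indicator
      (fun l => ENNReal.ofReal l) l) 2 dilationMeasure < ∞ := by
    rw [eLpNorm_dilationMeasure_eq_lintegral (by simp) (by simp)]
    refine ENNReal.rpow_lt_top_of_nonneg (by positivity) fun htop => ?_
    have h1 := lintegral_dilationMeasure_rpow (r := 2) (by norm_num) c
    have h2 : ∀ l : ℝ, {l | ENNReal.ofReal l < c}.indicator (fun l => ENNReal.ofReal l ^ (2 : ℝ)) l =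
        {l | ENNReal.ofReal l < c}.indicator (fun l => ENNReal.ofReal l) l ^ (2 : ℝ≥0∞).toReal := by
      intro l
      by_cases hl : l ∈ {l | ENNReal.ofReal l < c}
      · rw [indicator_of_mem hl, indicator_of_mem hl, ENNReal.toReal_ofNat]
      · rw [indicator_of_notMem hl, indicator_of_notMem hl, ENNReal.zero_rpow_of_pos (by simp)]
    simp only [h2, htop] at h1
    rw [ENNReal.mul_top (by simp)] at h1
    exact ENNReal.rpow_ne_top_of_nonneg (by norm_num) hc h1.symm
  refine ENNReal.mul_lt_top (ENNReal.rpow_lt_top_of_nonneg (by simp) ENNReal.ofReal_ne_top) ?_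
  refine (eLpNorm_mono_enorm (g := fun l : ℝ => μ s ^ (1 / p) *
    {l | ENNReal.ofReal l < c}.indicator (fun l => ENNReal.ofReal l) l) hle).trans_lt ?_
  rw [eLpNorm_const_mul_ennreal hm (by simp)]
  exact ENNReal.mul_lt_top (ENNReal.rpow_lt_top_of_nonneg (by positivity) hs) hfin

/-- Functions norming the mixed Lorentz space with second exponents `2`. -/
theorem exists_lorentz_dual_test {μ : Measure α} {ν : Measure β} [SFinite μ] [SFinite ν] {p q : ℝ}
    (hp : 2 < p) (hq : 2 < q) {H : β → α → ℝ≥0∞} (hH : Measurable (Function.uncurry H))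
    (hfin : lorentzNorm p 2 ν (fun t => lorentzNorm q 2 μ (H t)) < ∞) :
    ∃ W : β → α → ℝ≥0∞, Measurable (Function.uncurry W) ∧
      lorentzNorm p.conjExponent 2 ν (fun t => lorentzNorm q.conjExponent 2 μ (W t)) ≤
        lorentzNorm p 2 ν (fun t => lorentzNorm q 2 μ (H t)) ∧
      lorentzNorm p 2 ν (fun t => lorentzNorm q 2 μ (H t)) ^ 2 ≤
        ENNReal.ofReal p * ENNReal.ofReal q * ∫⁻ t, ∫⁻ x, H t x * W t x ∂μ ∂ν := by
  have hp' := (Real.HolderConjugate.conjExponent (show 1 < p by linarith)).symm.pos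
  have hq' := (Real.HolderConjugate.conjExponent (show 1 < q by linarith)).symm.pos
  set N : β → ℝ≥0∞ := fun t => lorentzNorm q 2 μ (H t) with hN
  have hNm : Measurable N := measurable_lorentzNorm_prodMk_left hH q 2
  set M : β → ℝ≥0∞ := lorentzDual p ν N with hM
  have hMm : Measurable M := by
    have h1 : Measurable (Function.uncurry fun _ : Unit => N) := hNm.comp measurable_snd
    exact (measurable_lorentzDual p h1).of_uncurry_left (x := ())
  have hDm := measurable_lorentzDual (μ := μ) q hH
  have hNfin : ∀ᵐ t ∂ν, N t < ∞ := ae_lt_top_of_lorentzNorm_lt_top (by linarith) (by simp) hfin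
  -- The spatial dual of H t has norm at most N t, so rescaling by M/N gives spatial norm at most M
  -- t, where M is the dual function of N in time.
  refine ⟨fun t x => M t / N t * lorentzDual q μ (H t) x, ?_, ?_, ?_⟩
  · exact ((hMm.div hNm).comp measurable_fst).mul hDm
  · refine le_trans (lorentzNorm_mono_ae hp' ?_) (lorentzNorm_lorentzDual_le hp N)
    refine Filter.Eventually.of_forall fun t => ?_
    refine (lorentzNorm_const_mul_le hq' (by simp) _).trans ?_
    refine (mul_le_mul_right (lorentzNorm_lorentzDual_le hq (H t)) _).trans ?_
    exact (mul_comm _ _).trans_le ENNReal.mul_div_le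
  · refine (lorentzNorm_two_sq_le hp hNm hfin).trans ?_
    rw [mul_assoc]
    refine mul_le_mul_right ?_ _
    rw [← lintegral_const_mul' _ _ ENNReal.ofReal_ne_top]
    refine lintegral_mono_ae ?_
    filter_upwards [hNfin] with t ht
    have hHt : Measurable (H t) := hH.comp measurable_prodMk_left
    have hDt : Measurable (lorentzDual q μ (H t)) := hDm.comp measurable_prodMk_left
    have h1 := lorentzNorm_two_sq_le hq hHt ht
    have h2 : ∫⁻ x, H t x * (M t / N t * lorentzDual q μ (H t) x) ∂μ =
        M t / N t * ∫⁻ x, H t x * lorentzDual q μ (H t) x ∂μ := by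
      rw [← lintegral_const_mul _ (show Measurable fun x => H t x * lorentzDual q μ (H t) x from
        hHt.mul hDt)]
      simp only [mul_left_comm]
    rw [h2]
    rcases eq_or_ne (N t) 0 with h0 | h0
    · rw [h0, zero_mul]
      exact zero_le
    · calc N t * M t = M t / N t * N t ^ 2 := by
            rw [sq, ← mul_assoc, ENNReal.div_mul_cancel h0 ht.ne, mul_comm]
        _ ≤ M t / N t * (ENNReal.ofReal q * ∫⁻ x, H t x * lorentzDual q μ (H t) x ∂μ) := by gcongr
        _ = _ := by ring

end DualTest

section BoxTrunc

variable {d : ℕ}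

local notation "ℝᵈ" => EuclideanSpace ℝ (Fin d)

/-- Truncation of a space-time function in height and support. -/
def boxTrunc (k : ℕ) (H : ℝ → ℝᵈ → ℝ≥0∞) (t : ℝ) (x : ℝᵈ) : ℝ≥0∞ :=
  (Metric.closedBall (0 : ℝ) k).indicator 1 t *
    ((Metric.closedBall (0 : ℝᵈ) k).indicator 1 x * min (H t x) k)

variable {H : ℝ → EuclideanSpace ℝ (Fin d) → ℝ≥0∞}

theorem measurable_boxTrunc (k : ℕ) (hH : Measurable (Function.uncurry H)) :
    Measurable (Function.uncurry (boxTrunc k H)) :=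
  ((measurable_one.indicator measurableSet_closedBall).comp measurable_fst).mul
    (((measurable_one.indicator measurableSet_closedBall).comp measurable_snd).mul
      (hH.min measurable_const))

theorem boxTrunc_le (k : ℕ) (t : ℝ) (x : ℝᵈ) : boxTrunc k H t x ≤ H t x := by
  have h1 : ∀ {X : Type} (s : Set X) (z : X), s.indicator (1 : X → ℝ≥0∞) z ≤ 1 := fun s z =>
    indicator_le_self' (fun _ _ => zero_le) z
  calc boxTrunc k H t x ≤ 1 * (1 * H t x) :=
        mul_le_mul' (h1 _ _) (mul_le_mul' (h1 _ _) (min_le_left _ _))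
    _ = _ := by rw [one_mul, one_mul]

theorem boxTrunc_le_indicator (k : ℕ) (t : ℝ) (x : ℝᵈ) : boxTrunc k H t x ≤
    (Metric.closedBall (0 : ℝ) k).indicator 1 t *
      (Metric.closedBall (0 : ℝᵈ) k).indicator (fun _ => (k : ℝ≥0∞)) x := by
  unfold boxTrunc
  gcongr
  by_cases hx : x ∈ Metric.closedBall (0 : ℝᵈ) (k : ℝ)
  · rw [indicator_of_mem hx, indicator_of_mem hx, Pi.one_apply, one_mul]
    exact min_le_right _ _
  · rw [indicator_of_notMem hx, indicator_of_notMem hx, zero_mul]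

theorem monotone_boxTrunc (H : ℝ → ℝᵈ → ℝ≥0∞) : Monotone fun k => boxTrunc k H := by
  intro i j hij t x
  have hij' : (i : ℝ) ≤ j := by exact_mod_cast hij
  refine mul_le_mul' ?_ (mul_le_mul' ?_ (min_le_min le_rfl (by exact_mod_cast hij)))
  · exact indicator_le_indicator_of_subset (Metric.closedBall_subset_closedBall hij')
      (fun _ => zero_le) t
  · exact indicator_le_indicator_of_subset (Metric.closedBall_subset_closedBall hij')
      (fun _ => zero_le) x

theorem iSup_boxTrunc (H : ℝ → ℝᵈ → ℝ≥0∞) (t : ℝ) (x : ℝᵈ) :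
    ⨆ k, boxTrunc k H t x = H t x := by
  refine le_antisymm (iSup_le fun k => boxTrunc_le k t x) (le_of_forall_lt fun l hl => ?_)
  obtain ⟨n, hn⟩ := ENNReal.exists_nat_gt (hl.trans_le le_top).ne
  obtain ⟨k, hk⟩ := exists_nat_ge (max (max ‖t‖ ‖x‖) n)
  have h1 : t ∈ Metric.closedBall (0 : ℝ) k := by
    simpa using ((le_max_left _ _).trans (le_max_left _ _)).trans hk
  have h2 : x ∈ Metric.closedBall (0 : ℝᵈ) k := by
    simpa using ((le_max_right _ _).trans (le_max_left _ _)).trans hk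
  have h3 : n ≤ k := by exact_mod_cast (le_max_right _ _).trans hk
  refine lt_of_lt_of_le ?_ (le_iSup (fun k => boxTrunc k H t x) k)
  simp only [boxTrunc, indicator_of_mem h1, indicator_of_mem h2, Pi.one_apply, one_mul]
  exact lt_min hl (hn.trans_le (by exact_mod_cast h3))

theorem boxTrunc_ne_top (k : ℕ) (t : ℝ) (x : ℝᵈ) : boxTrunc k H t x ≠ ∞ := by
  refine ne_top_of_le_ne_top (ENNReal.natCast_ne_top k) ((mul_le_mul' (b := 1) (d := (k : ℝ≥0∞))
    (indicator_le_self' (fun _ _ => zero_le) t) ?_).trans (one_mul _).le)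
  refine (mul_le_mul' (b := 1) (d := (k : ℝ≥0∞)) (indicator_le_self' (fun _ _ => zero_le) x)
    (min_le_right _ _)).trans (one_mul _).le

/-- Truncations have finite norm a priori, so that a power of the norm can be cancelled in the
duality argument. -/
theorem mixed_lorentzNorm_boxTrunc_lt_top {p q : ℝ} (hp : 0 < p) (hq : 0 < q) (J : Set ℝ) (k : ℕ) :
    lorentzNorm p 2 (volume.restrict J) (fun t => lorentzNorm q 2 volume (boxTrunc k H t)) < ∞ := by
  set A := lorentzNorm q 2 (volume : Measure ℝᵈ)
    ((Metric.closedBall (0 : ℝᵈ) k).indicator fun _ => (k : ℝ≥0∞)) with hA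
  have hAt : A < ∞ := lorentzNorm_two_indicator_const_lt_top hq measure_closedBall_lt_top.ne
    (ENNReal.natCast_ne_top k)
  refine lt_of_le_of_lt (lorentzNorm_mono_ae hp (h' := (Metric.closedBall (0 : ℝ) k).indicator
    fun _ => A) (Filter.Eventually.of_forall fun t => ?_)) (lorentzNorm_two_indicator_const_lt_top hp
      ((Measure.restrict_apply_le _ _).trans_lt measure_closedBall_lt_top).ne hAt.ne)
  refine (lorentzNorm_mono_ae hq (Filter.Eventually.of_forall
    (boxTrunc_le_indicator k t))).trans ?_
  refine (lorentzNorm_const_mul_le hq (by simp) _).trans ?_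
  by_cases ht : t ∈ Metric.closedBall (0 : ℝ) (k : ℝ)
  · rw [indicator_of_mem ht, indicator_of_mem ht, Pi.one_apply, one_mul]
  · rw [indicator_of_notMem ht, indicator_of_notMem ht, zero_mul]

theorem setLIntegral_eLpNorm_lt_top_of_le_boxTrunc (J : Set ℝ) (k : ℕ) {F : ℝ → ℝᵈ → ℂ}
    (hF : ∀ t x, ‖F t x‖ₑ ≤ boxTrunc k H t x) :
    ∫⁻ s in J, eLpNorm (F s) 2 volume < ∞ := by
  set A := eLpNorm ((Metric.closedBall (0 : ℝᵈ) k).indicator fun _ => (k : ℝ)) 2 volume with hA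
  have hAt : A < ∞ := by
    rw [hA, eLpNorm_indicator_const measurableSet_closedBall (by simp) (by simp)]
    exact ENNReal.mul_lt_top enorm_lt_top
      (ENNReal.rpow_lt_top_of_nonneg (by positivity) measure_closedBall_lt_top.ne)
  have h1 : ∀ s, eLpNorm (F s) 2 volume ≤ (Metric.closedBall (0 : ℝ) k).indicator (fun _ => A) s := by
    intro s
    by_cases hs : s ∈ Metric.closedBall (0 : ℝ) (k : ℝ)
    · rw [indicator_of_mem hs]
      refine eLpNorm_mono_enorm fun x => (hF s x).trans ((boxTrunc_le_indicator k s x).trans ?_)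
      rw [indicator_of_mem hs, Pi.one_apply, one_mul, enorm_indicator_eq_indicator_enorm]
      simp
    · rw [indicator_of_notMem hs]
      have : F s = 0 := by
        funext x
        have := (hF s x).trans (boxTrunc_le_indicator k s x)
        rw [indicator_of_notMem hs, zero_mul] at this
        simpa using this
      rw [this, eLpNorm_zero]
  refine (lintegral_mono h1).trans_lt ?_
  rw [lintegral_indicator_const measurableSet_closedBall]
  exact ENNReal.mul_lt_top hAt ((Measure.restrict_apply_le _ _).trans_lt measure_closedBall_lt_top)

end BoxTrunc

end

/-! ### The homogeneous estimate by TT* and duality -/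

noncomputable section

section DualStrichartz

variable {d : ℕ}

local notation "ℝᵈ" => EuclideanSpace ℝ (Fin d)

variable {J : Set ℝ} {F : ℝ → EuclideanSpace ℝ (Fin d) → ℂ}
  {f : Lp ℂ 2 (volume : Measure (EuclideanSpace ℝ (Fin d)))}
  {u : ℝ → EuclideanSpace ℝ (Fin d) → ℂ}

theorem enorm_integral_mul_le (f y : Lp ℂ 2 (volume : Measure ℝᵈ)) :
    ‖∫ x, f x * y x‖ₑ ≤ ‖f‖ₑ * ‖y‖ₑ := by
  refine (enorm_integral_le_lintegral_enorm _).trans ?_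
  simp only [enorm_mul, Lp.enorm_def]
  exact lintegral_enorm_mul_le (Lp.aestronglyMeasurable f) (Lp.aestronglyMeasurable y)

theorem IsFlowVersion.lintegral_enorm_mul_le (h : IsFlowVersion f u)
    (hF : Measurable (Function.uncurry F)) :
    ∫⁻ z, ‖u z.1 z.2 * F z.1 z.2‖ₑ ∂((volume.restrict J).prod volume) ≤
      ‖f‖ₑ * ∫⁻ s in J, eLpNorm (F s) 2 volume := by
  have hm : Measurable fun z : ℝ × ℝᵈ => ‖u z.1 z.2 * F z.1 z.2‖ₑ := (h.measurable.mul hF).enorm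
  rw [lintegral_prod _ hm.aemeasurable, ← lintegral_const_mul' _ _ enorm_ne_top]
  refine lintegral_mono fun s => ?_
  simp only [enorm_mul]
  exact (_root_.lintegral_enorm_mul_le (h.memLp s).1
    (hF.comp measurable_prodMk_left).aestronglyMeasurable).trans
      (mul_le_mul_left (h.eLpNorm_le s) _)

theorem IsFlowVersion.integrable_mul (h : IsFlowVersion f u) (hF : Measurable (Function.uncurry F))
    (hK : ∫⁻ s in J, eLpNorm (F s) 2 volume ≠ ∞) :
    Integrable (fun z : ℝ × ℝᵈ => u z.1 z.2 * F z.1 z.2) ((volume.restrict J).prod volume) := by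
  refine ⟨(h.measurable.mul hF).aestronglyMeasurable, ?_⟩
  rw [hasFiniteIntegral_iff_enorm]
  exact (h.lintegral_enorm_mul_le hF).trans_lt (ENNReal.mul_lt_top enorm_lt_top hK.lt_top)

/-- Space-time pairings with the flow are pairings with a fixed square-integrable function. -/
theorem exists_integral_flow_mul_eq (hF : Measurable (Function.uncurry F))
    (hK : ∫⁻ s in J, eLpNorm (F s) 2 volume ≠ ∞) :
    ∃ y : Lp ℂ 2 (volume : Measure ℝᵈ), ∀ (f : Lp ℂ 2 (volume : Measure ℝᵈ)) (u : ℝ → ℝᵈ → ℂ),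
      IsFlowVersion f u → ∫ z, u z.1 z.2 * F z.1 z.2 ∂((volume.restrict J).prod volume) =
        ∫ x, f x * y x := by
  have hint := fun g : 𝓢(ℝᵈ, ℂ) => (isFlowVersion_schwartzFlow g).integrable_mul hF hK
  set T : 𝓢(ℝᵈ, ℂ) →ₗ[ℂ] ℂ :=
    { toFun := fun g => ∫ z, schwartzFlow z.1 g z.2 * F z.1 z.2 ∂((volume.restrict J).prod volume)
      map_add' := fun g g' => by
        rw [← integral_add (hint g) (hint g')]
        refine integral_congr_ae (Filter.Eventually.of_forall fun z => ?_)
        simp only [schwartzFlow_add_apply, add_mul]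
      map_smul' := fun c g => by
        rw [RingHom.id_apply, smul_eq_mul, ← integral_const_mul]
        refine integral_congr_ae (Filter.Eventually.of_forall fun z => ?_)
        simp only [schwartzFlow_smul_apply, mul_assoc] } with hT
  obtain ⟨y₀, hy₀, hTy⟩ := exists_memLp_two_of_bound T hK fun g => by
    refine (enorm_integral_le_lintegral_enorm _).trans ?_
    refine ((isFlowVersion_schwartzFlow g).lintegral_enorm_mul_le hF).trans ?_
    rw [enorm_schwartzToL2, mul_comm]
  set y := hy₀.toLp y₀
  have hyy₀ : y =ᵐ[volume] y₀ := hy₀.coeFn_toLp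
  refine ⟨y, fun f u hu => ?_⟩
  set K := ∫⁻ s in J, eLpNorm (F s) 2 volume
  set Δ : ℂ := (∫ z, u z.1 z.2 * F z.1 z.2 ∂((volume.restrict J).prod volume)) -
    ∫ x, f x * y x with hΔ
  -- The identity holds on Schwartz functions by construction of y. Its defect at f is bounded by a
  -- multiple of the distance from f to any Schwartz function, hence vanishes by density.
  have hle : ∀ g : 𝓢(ℝᵈ, ℂ), ‖Δ‖ₑ ≤ ‖f - schwartzToL2 g‖ₑ * (K + ‖y‖ₑ) := by
    intro g
    have hw := hu.sub (isFlowVersion_schwartzFlow g)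
    have h1 : ∫ z, (u z.1 z.2 - schwartzFlow z.1 g z.2) * F z.1 z.2
        ∂((volume.restrict J).prod volume) =
        (∫ z, u z.1 z.2 * F z.1 z.2 ∂((volume.restrict J).prod volume)) - T g := by
      simp only [sub_mul]
      exact integral_sub (hu.integrable_mul hF hK) (hint g)
    have h2 : ∫ x, (f - schwartzToL2 g) x * y x = (∫ x, f x * y x) - T g := by
      rw [hTy g]
      have h3 : ∫ x, g x * y₀ x = ∫ x, schwartzToL2 g x * y x := by
        refine integral_congr_ae ?_
        filter_upwards [hyy₀, coeFn_schwartzToL2 g] with x hx1 hx2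
        rw [hx1, hx2]
      rw [h3, ← integral_sub (integrable_mul_of_memLp_two (Lp.memLp f) (Lp.memLp y))
        (integrable_mul_of_memLp_two (Lp.memLp _) (Lp.memLp y))]
      refine integral_congr_ae ?_
      filter_upwards [Lp.coeFn_sub f (schwartzToL2 g)] with x hx
      rw [hx, Pi.sub_apply, sub_mul]
    have h4 : Δ = (∫ z, (u z.1 z.2 - schwartzFlow z.1 g z.2) * F z.1 z.2
        ∂((volume.restrict J).prod volume)) - ∫ x, (f - schwartzToL2 g) x * y x := by
      rw [h1, h2, hΔ]
      ring
    rw [h4, mul_add]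
    refine enorm_sub_le.trans (add_le_add ?_ (enorm_integral_mul_le _ _))
    exact (enorm_integral_le_lintegral_enorm _).trans (hw.lintegral_enorm_mul_le hF)
  have hΔ0 : ‖Δ‖ₑ ≤ ‖f - f‖ₑ * (K + ‖y‖ₑ) := by
    refine isClosed_property denseRange_schwartzToL2 (p := fun w => ‖Δ‖ₑ ≤ ‖f - w‖ₑ * (K + ‖y‖ₑ))
      (isClosed_le continuous_const ?_) hle f
    exact (ENNReal.continuous_mul_const (ENNReal.add_ne_top.2 ⟨hK, enorm_ne_top⟩)).comp
      (continuous_const.sub continuous_id).enorm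
  rw [sub_self, enorm_zero, zero_mul, nonpos_iff_eq_zero, enorm_eq_zero] at hΔ0
  exact sub_eq_zero.1 hΔ0

/-- The TT* step. With y representing the pairing with F, the flow w of the conjugate of y has
Schwartz pairings dominated by the Duhamel majorant of F over all of J, so its mixed norm is at most
C‖F‖. Hölder in x and then in t gives ‖y‖² ≤ C‖F‖². -/
theorem exists_enorm_integral_flow_mul_le (d : ℕ) {p q : ℝ} (hp : 2 < p) (hq : 2 < q)
    (hpq : 2 / p + (d : ℝ) / q = (d : ℝ) / 2) :
    ∃ C : ℝ≥0, ∀ (J : Set ℝ) (_ : MeasurableSet J) (F : ℝ → EuclideanSpace ℝ (Fin d) → ℂ)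
      (_ : Measurable (Function.uncurry F)) (_ : ∫⁻ s in J, eLpNorm (F s) 2 volume ≠ ∞)
      (f : Lp ℂ 2 (volume : Measure (EuclideanSpace ℝ (Fin d))))
      (u : ℝ → EuclideanSpace ℝ (Fin d) → ℂ) (_ : IsFlowVersion f u),
      ‖∫ z, u z.1 z.2 * F z.1 z.2 ∂((volume.restrict J).prod volume)‖ₑ ≤
        C * ‖f‖ₑ * mixedLorentzNorm p.conjExponent 2 q.conjExponent 2 J F := by
  obtain ⟨C₁, hC₁⟩ := exists_lorentzNorm_le_forcingPotential d hp hq hpq (r := 2) (by norm_num)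
  obtain ⟨C₂, hC₂⟩ := exists_lorentzNorm_forcingPotential_le hp (θ := 2) (by simp)
  -- Adding 1 avoids a square root: C₁C₂ ≤ (C₁C₂ + 1)².
  refine ⟨C₁ * C₂ + 1, fun J hJ F hF hK f u hu => ?_⟩
  obtain ⟨y, hy⟩ := exists_integral_flow_mul_eq hF hK
  set X := mixedLorentzNorm p.conjExponent 2 q.conjExponent 2 J F with hX
  obtain ⟨w, hw⟩ := exists_isFlowVersion (star y)
  have hpair : ∀ (t : ℝ) (g : 𝓢(EuclideanSpace ℝ (Fin d), ℂ)), ‖∫ x, g x * w t x‖ₑ ≤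
      ∫⁻ s in J, ∫⁻ x, ‖F s x‖ₑ * ‖schwartzFlow (t - s) g x‖ₑ := by
    intro t g
    -- Testing y on the conjugate of the flow of g to time t produces, at time s, the conjugate of
    -- the flow of g to time t - s.
    have h1 := hy _ _ (isFlowVersion_schwartzFlow (conjSchwartz (schwartzFlow t g)))
    have h2 : ∫ x, g x * w t x = starRingEnd ℂ
        (∫ x, schwartzToL2 (conjSchwartz (schwartzFlow t g)) x * y x) := by
      rw [hw.integral_mul, ← integral_conj]
      refine integral_congr_ae ?_
      filter_upwards [Lp.coeFn_star y, coeFn_schwartzToL2 (conjSchwartz (schwartzFlow t g))]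
        with x hx1 hx2
      rw [hx1, hx2, map_mul, conjSchwartz_apply, Complex.conj_conj]
      rfl
    rw [h2, ← h1, RCLike.enorm_conj]
    refine (enorm_integral_le_lintegral_enorm _).trans ?_
    have hm : Measurable fun z : ℝ × EuclideanSpace ℝ (Fin d) =>
        ‖schwartzFlow z.1 (conjSchwartz (schwartzFlow t g)) z.2 * F z.1 z.2‖ₑ :=
      ((continuous_schwartzFlow _).measurable.mul hF).enorm
    rw [lintegral_prod _ hm.aemeasurable]
    refine le_of_eq (lintegral_congr fun s => lintegral_congr fun x => ?_)
    rw [enorm_mul, schwartzFlow_conjSchwartz, RCLike.enorm_conj, schwartzFlow_add, mul_comm,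
      neg_add_eq_sub]
  have hmixed : mixedLorentzNorm p 2 q 2 J w ≤ C₁ * C₂ * X := by
    refine (lorentzNorm_mono_ae (h' := fun t => C₁ * forcingPotential p q 2 J
      (fun s x => ‖F s x‖ₑ) t) (by linarith) (Filter.Eventually.of_forall fun t => ?_)).trans ?_
    · exact hC₁ J _ (measurable_enorm_uncurry hF) t _ (hw.memLp t).weightedMemL2 (hpair t)
    · refine (lorentzNorm_const_mul_le (by linarith) (by simp) _).trans ?_
      rw [mul_assoc]
      gcongr
      exact hC₂ q 2 J hJ _ (measurable_enorm_uncurry hF)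
  have hsq : ‖y‖ₑ ^ 2 ≤ C₁ * C₂ * X * X := by
    have h1 : ‖y‖ₑ ^ 2 = ‖∫ x, (star y : Lp ℂ 2 (volume : Measure (EuclideanSpace ℝ (Fin d)))) x * y x‖ₑ := by
      have h2 : ∫ x, (star y : Lp ℂ 2 (volume : Measure (EuclideanSpace ℝ (Fin d)))) x * y x =
          inner ℂ y y := by
        rw [L2.inner_def]
        refine integral_congr_ae ?_
        filter_upwards [Lp.coeFn_star y] with x hx
        rw [hx, RCLike.inner_apply, mul_comm]
        rfl
      rw [h2, inner_self_eq_norm_sq_to_K, enorm_pow]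
      congr 1
      simp [← ofReal_norm]
    rw [h1, ← hy _ _ hw]
    refine (enorm_integral_le_lintegral_enorm _).trans ?_
    have hm : Measurable fun z : ℝ × EuclideanSpace ℝ (Fin d) => ‖w z.1 z.2 * F z.1 z.2‖ₑ :=
      (hw.measurable.mul hF).enorm
    rw [lintegral_prod _ hm.aemeasurable]
    simp only [enorm_mul]
    have hwm : Measurable (Function.uncurry fun s x => ‖w s x‖ₑ) := hw.measurable.enorm
    have hFm := measurable_enorm_uncurry hF
    refine (lintegral_mono fun s => lintegral_mul_le_lorentzNorm (show 1 < q by linarith)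
      (hwm.comp measurable_prodMk_left) (hFm.comp measurable_prodMk_left)).trans ?_
    refine (lintegral_mul_le_lorentzNorm (show 1 < p by linarith)
      (measurable_lorentzNorm_prodMk_left hwm _ _)
      (measurable_lorentzNorm_prodMk_left hFm _ _)).trans ?_
    exact mul_le_mul_left hmixed X
  have hyX : ‖y‖ₑ ≤ (C₁ * C₂ + 1) * X := by
    refine (ENNReal.pow_le_pow_left_iff two_ne_zero).1 (hsq.trans ?_)
    have h1 : (C₁ * C₂ : ℝ≥0∞) ≤ (C₁ * C₂ + 1) ^ 2 := by
      rw [sq]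
      calc (C₁ * C₂ : ℝ≥0∞) ≤ (C₁ * C₂ + 1) * 1 := by rw [mul_one]; exact le_self_add
        _ ≤ _ := by gcongr; exact le_add_self
    calc C₁ * C₂ * X * X ≤ (C₁ * C₂ + 1) ^ 2 * X * X := by gcongr
      _ = _ := by ring
  rw [hy _ _ hu]
  refine (enorm_integral_mul_le f y).trans ?_
  refine (mul_le_mul_right hyX _).trans (le_of_eq ?_)
  push_cast
  ring

/-- Giving a truncation of H the conjugate phase of u removes all cancellation from the space-time
pairing; the truncation is then lifted by monotone convergence. -/
theorem exists_lintegral_enorm_flow_mul_le (d : ℕ) {p q : ℝ} (hp : 2 < p) (hq : 2 < q)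
    (hpq : 2 / p + (d : ℝ) / q = (d : ℝ) / 2) :
    ∃ C : ℝ≥0, ∀ (J : Set ℝ) (_ : MeasurableSet J) (H : ℝ → EuclideanSpace ℝ (Fin d) → ℝ≥0∞)
      (_ : Measurable (Function.uncurry H))
      (f : Lp ℂ 2 (volume : Measure (EuclideanSpace ℝ (Fin d))))
      (u : ℝ → EuclideanSpace ℝ (Fin d) → ℂ) (_ : IsFlowVersion f u),
      ∫⁻ s in J, ∫⁻ x, ‖u s x‖ₑ * H s x ≤ C * ‖f‖ₑ *
        lorentzNorm p.conjExponent 2 (volume.restrict J)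
          (fun s => lorentzNorm q.conjExponent 2 volume (H s)) := by
  obtain ⟨C, hC⟩ := exists_enorm_integral_flow_mul_le d hp hq hpq
  refine ⟨C, fun J hJ H hH f u hu => ?_⟩
  have hp' := (Real.HolderConjugate.conjExponent (show 1 < p by linarith)).symm.pos
  have hq' := (Real.HolderConjugate.conjExponent (show 1 < q by linarith)).symm.pos
  have hum : Measurable (Function.uncurry fun s x => ‖u s x‖ₑ) := hu.measurable.enorm
  have hprod : ∀ H' : ℝ → EuclideanSpace ℝ (Fin d) → ℝ≥0∞, Measurable (Function.uncurry H') →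
      ∫⁻ s in J, ∫⁻ x, ‖u s x‖ₑ * H' s x =
        ∫⁻ z, ‖u z.1 z.2‖ₑ * H' z.1 z.2 ∂((volume.restrict J).prod volume) := by
    intro H' hH'
    have hm : Measurable fun z : ℝ × EuclideanSpace ℝ (Fin d) => ‖u z.1 z.2‖ₑ * H' z.1 z.2 :=
      hum.mul hH'
    rw [lintegral_prod _ hm.aemeasurable]
  rw [hprod H hH]
  have hsup : ∀ z : ℝ × EuclideanSpace ℝ (Fin d), ‖u z.1 z.2‖ₑ * H z.1 z.2 =
      ⨆ k, ‖u z.1 z.2‖ₑ * boxTrunc k H z.1 z.2 := by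
    intro z
    rw [← ENNReal.mul_iSup, iSup_boxTrunc]
  simp only [hsup]
  rw [lintegral_iSup (f := fun k (z : ℝ × EuclideanSpace ℝ (Fin d)) =>
    ‖u z.1 z.2‖ₑ * boxTrunc k H z.1 z.2) (fun k => hum.mul (measurable_boxTrunc k hH)) fun i j hij z =>
    mul_le_mul_right (monotone_boxTrunc H hij z.1 z.2) _]
  refine iSup_le fun k => ?_
  set F : ℝ → EuclideanSpace ℝ (Fin d) → ℂ := fun s x =>
    ((boxTrunc k H s x).toReal : ℂ) * (starRingEnd ℂ (u s x) / ‖u s x‖) with hFdef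
  have hF : Measurable (Function.uncurry F) := by
    refine Measurable.mul (Complex.measurable_ofReal.comp
      (measurable_boxTrunc k hH).ennreal_toReal) ?_
    exact (Complex.continuous_conj.measurable.comp hu.measurable).div
      (Complex.measurable_ofReal.comp hu.measurable.norm)
  have hFle : ∀ s x, ‖F s x‖ₑ ≤ boxTrunc k H s x := by
    intro s x
    rw [hFdef, enorm_mul, ← ofReal_norm, Complex.norm_real,
      Real.norm_of_nonneg ENNReal.toReal_nonneg, ENNReal.ofReal_toReal (boxTrunc_ne_top k s x)]
    refine mul_le_of_le_one_right' ?_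
    rw [← ofReal_norm, ← ENNReal.ofReal_one]
    refine ENNReal.ofReal_le_ofReal ?_
    rw [norm_div, RCLike.norm_conj, Complex.norm_real, norm_norm]
    exact div_self_le_one _
  have hK := (setLIntegral_eLpNorm_lt_top_of_le_boxTrunc J k hFle).ne
  have huF : ∀ z : ℝ × EuclideanSpace ℝ (Fin d), u z.1 z.2 * F z.1 z.2 =
      (((boxTrunc k H z.1 z.2).toReal * ‖u z.1 z.2‖ : ℝ) : ℂ) := by
    intro z
    have h1 : u z.1 z.2 * (starRingEnd ℂ (u z.1 z.2) / ‖u z.1 z.2‖) = ‖u z.1 z.2‖ := by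
      rw [mul_div_assoc', Complex.mul_conj']
      rcases eq_or_ne (‖u z.1 z.2‖ : ℂ) 0 with h | h
      · simp [h]
      · field_simp
    rw [hFdef, mul_left_comm, h1]
    push_cast
    rfl
  have hint := hu.integrable_mul hF hK
  have hmain : ∫⁻ z, ‖u z.1 z.2‖ₑ * boxTrunc k H z.1 z.2 ∂((volume.restrict J).prod volume) =
      ‖∫ z, u z.1 z.2 * F z.1 z.2 ∂((volume.restrict J).prod volume)‖ₑ := by
    simp only [huF] at hint ⊢
    rw [integral_complex_ofReal, ← ofReal_norm, Complex.norm_real, Real.norm_of_nonneg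
      (integral_nonneg fun z => mul_nonneg ENNReal.toReal_nonneg (norm_nonneg _)),
      ofReal_integral_eq_lintegral_ofReal (by simpa using hint.re)
        (Filter.Eventually.of_forall fun z => mul_nonneg ENNReal.toReal_nonneg (norm_nonneg _))]
    refine lintegral_congr fun z => ?_
    rw [ENNReal.ofReal_mul ENNReal.toReal_nonneg, ENNReal.ofReal_toReal (boxTrunc_ne_top k _ _),
      ofReal_norm, mul_comm]
  rw [hmain]
  refine (hC J hJ F hF hK f u hu).trans ?_
  refine mul_le_mul_right (lorentzNorm_mono_ae hp' (Filter.Eventually.of_forall fun s =>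
    lorentzNorm_mono_ae hq' (Filter.Eventually.of_forall fun x => ?_))) _
  exact (hFle s x).trans (boxTrunc_le k s x)

/-- Homogeneous Strichartz estimates in Lorentz spaces. -/
theorem exists_homogeneous_lorentz_strichartz (d : ℕ) {p q : ℝ} (hp : 2 < p) (hq : 2 < q)
    (hpq : 2 / p + (d : ℝ) / q = (d : ℝ) / 2) :
    ∃ C : ℝ≥0, ∀ (J : Set ℝ) (_ : MeasurableSet J)
      (f : Lp ℂ 2 (volume : Measure (EuclideanSpace ℝ (Fin d))))
      (u : ℝ → EuclideanSpace ℝ (Fin d) → ℂ) (_ : IsFlowVersion f u),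
      mixedLorentzNorm p 2 q 2 J u ≤ C * ‖f‖ₑ := by
  obtain ⟨C, hC⟩ := exists_lintegral_enorm_flow_mul_le d hp hq hpq
  refine ⟨p.toNNReal * q.toNNReal * C, fun J hJ f u hu => ?_⟩
  have hp0 : 0 < p := by linarith
  have hq0 : 0 < q := by linarith
  set H : ℝ → EuclideanSpace ℝ (Fin d) → ℝ≥0∞ := fun s x => ‖u s x‖ₑ with hH
  have hHm : Measurable (Function.uncurry H) := hu.measurable.enorm
  have key : ∀ k, lorentzNorm p 2 (volume.restrict J)
      (fun t => lorentzNorm q 2 volume (boxTrunc k H t)) ≤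
        ENNReal.ofReal p * ENNReal.ofReal q * (C * ‖f‖ₑ) := by
    intro k
    have hfin := mixed_lorentzNorm_boxTrunc_lt_top (H := H) hp0 hq0 J k
    obtain ⟨W, hW, hW1, hW2⟩ := exists_lorentz_dual_test hp hq (measurable_boxTrunc k hHm) hfin
    set X := lorentzNorm p 2 (volume.restrict J)
      (fun t => lorentzNorm q 2 volume (boxTrunc k H t)) with hX
    -- The norming function W for the truncation has dual norm at most X, so one factor of the
    -- finite quantity X can be cancelled.
    have h1 : X * X ≤ ENNReal.ofReal p * ENNReal.ofReal q * (C * ‖f‖ₑ) * X := by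
      rw [← sq]
      refine hW2.trans ?_
      rw [mul_assoc _ (C * ‖f‖ₑ) X]
      refine mul_le_mul_right ?_ _
      calc _ ≤ ∫⁻ s in J, ∫⁻ x, ‖u s x‖ₑ * W s x :=
            lintegral_mono fun s => lintegral_mono fun x =>
              mul_le_mul_left (boxTrunc_le k s x) _
        _ ≤ _ := (hC J hJ W hW f u hu).trans (mul_le_mul_right hW1 _)
    rcases eq_or_ne X 0 with h0 | h0
    · rw [h0]
      exact zero_le
    · exact (ENNReal.mul_le_mul_iff_left h0 hfin.ne).1 h1
  -- Monotone convergence of Lorentz quasinorms is applied twice, in space here and in time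
  -- afterwards.
  have hsup : ∀ t, lorentzNorm q 2 volume (fun x => ‖u t x‖ₑ) ≤
      ⨆ k, lorentzNorm q 2 volume (boxTrunc k H t) := by
    intro t
    have h1 := lorentzNorm_iSup_le (μ := volume) hq0 (r := 2) (by simp) (by simp)
      (h := fun k => boxTrunc k H t) (fun i j hij => monotone_boxTrunc H hij t)
      fun k => le_iSup (fun k => lorentzNorm q 2 volume (boxTrunc k H t)) k
    simpa only [iSup_boxTrunc] using h1
  refine (lorentzNorm_mono_ae hp0 (Filter.Eventually.of_forall hsup)).trans ?_
  refine lorentzNorm_iSup_le hp0 (by simp) (by simp) (fun i j hij t =>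
    lorentzNorm_mono_ae hq0 (Filter.Eventually.of_forall (monotone_boxTrunc H hij t)))
    fun k => (key k).trans (le_of_eq ?_)
  push_cast
  rw [← mul_assoc]
  rfl

end DualStrichartz

end

/-! ### Both estimates combined -/

theorem mainTheorem8 (d : ℕ) (hd : 3 ≤ d) (p q : ℝ) (hp : 2 < p) (hq : 2 < q)
    (hpq : 2 / p + (d : ℝ) / q = (d : ℝ) / 2) :
    (∃ C : ℝ≥0, ∀ J : Set ℝ, J.OrdConnected →
      ∀ f : Lp ℂ 2 (volume : Measure (EuclideanSpace ℝ (Fin d))),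
        ∃ u : ℝ → EuclideanSpace ℝ (Fin d) → ℂ,
          AEStronglyMeasurable (Function.uncurry u) ((volume.restrict J).prod volume) ∧
          (∀ t ∈ J, IsFunction (freeFlow t (Lp.toTemperedDistribution f)) (u t)) ∧
          mixedLorentzNorm p 2 q 2 J u ≤ C * ‖f‖ₑ) ∧
    (∀ θ φ : ℝ≥0∞, 0 < θ → 1 ≤ φ →
      ∃ C : ℝ≥0, ∀ J : Set ℝ, J.OrdConnected →
        ∀ I : ℝ → Set ℝ, (∀ t ∈ J, (I t).OrdConnected ∧ I t ⊆ J) →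
        ∀ F : ℝ → EuclideanSpace ℝ (Fin d) → ℂ,
          AEStronglyMeasurable (Function.uncurry F) ((volume.restrict J).prod volume) →
          mixedLorentzNorm p.conjExponent θ q.conjExponent φ J F < ∞ →
          ∃ G : ℝ → EuclideanSpace ℝ (Fin d) → ℂ,
            (MeasurableSet {z : ℝ × ℝ | z.1 ∈ J ∧ z.2 ∈ I z.1} →
              AEStronglyMeasurable (Function.uncurry G) ((volume.restrict J).prod volume)) ∧
            (∀ᵐ t ∂(volume.restrict J), IsDuhamelIntegral (I t) t F (G t)) ∧
            mixedLorentzNorm p θ q φ J G ≤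
              C * mixedLorentzNorm p.conjExponent θ q.conjExponent φ J F) := by
  refine ⟨?_, fun θ φ hθ hφ => exists_retarded_lorentz_strichartz d hp hq hpq hθ hφ⟩
  obtain ⟨C, hC⟩ := exists_homogeneous_lorentz_strichartz d hp hq hpq
  refine ⟨C, fun J hJ f => ?_⟩
  obtain ⟨u, hu⟩ := exists_isFlowVersion f
  exact ⟨u, hu.measurable.aestronglyMeasurable, fun t _ => hu.isFunction t,
    hC J hJ.measurableSet f u hu⟩
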